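/- **Setting.** Fix $T>0$, a real constant $k$ ($k=0$ allowed), a smooth real function $\gamma$ with $\gamma(s+T)-\gamma(s)$ constant, a smooth complex function $\kappa$ with $e^{-i\gamma}\kappa$ $T$-periodic, a smooth $T$-periodic $B_0>0$ and a smooth $T$-periodic complex $A_2$; put $\tau=\gamma'$ and $C_2=\bar A_2/B_0$. All forms are formal: power series in a complex coordinate and its conjugate whose coefficients are smooth functions of $s$. Let $$\alpha=\tilde\alpha_s\,ds-\tfrac1{4i}\tilde\alpha_u\,(u\,d\bar u-\bar u\,du)$$ be a formal vector potential of a Beltrami (or, for $k=0$, vacuum) field near the axis $u=0$: it solves $(\star d)^2\alpha=k\star d\alpha$ for the metric $h^2ds^2+du\,d\bar u$, $h=1-\tfrac12(\bar\kappa u+\kappa\bar u)$; $\star d\alpha=B_0\,ds$ on the axis; written in $z=e^{-i\gamma}u$ its components $\alpha_s,\alpha_z$ are real with $T$-periodic coefficients; $\alpha_s$ has no terms of degree less than $2$, and $A_2$ is its coefficient of $z^2$. In the canonical coordinate $Z=\bar z\sqrt{\alpha_z}$ it is the Liouville form $\alpha=\tfrac1{4i}(Z\,d\bar Z-\bar Z\,dZ)-H\,ds$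 of the near-axis Hamiltonian $H$, a real formal series with smooth $T$-periodic coefficients. The leading-order dynamics is $$\dot Z=4i\bar C_2\bar Z-i(\tfrac12k-\tau)Z ,$$ with real fundamental matrix $X(s)$ in the coordinates $(\mathrm{Re}\,Z,\mathrm{Im}\,Z)$, $X(0)=I$. The axis is *elliptic* if $X(T)=e^{TC}$ for a real matrix $C$ with eigenvalues $\pm if$, $f\ne0$ real; it is *hyperbolic* if $X(T)=\sigma e^{TC}$ with $\sigma=\pm1$ and $C$ real with eigenvalues $\pm\nu$, $\nu\neq0$ real (direct for $\sigma=1$, reflection hyperbolic for $\sigma=-1$). **Lemma.** (a) Suppose that the axis is elliptic with matrix $C$, and that the invariant ellipses (the images under $X(s)$ of the orbits of $e^{tC}$) have a principal axis whose direction, as an unoriented line, depends smoothly and $T$-periodically on $s$. Then there are smooth $\delta,\eta$, with $\eta$ $T$-periodic and $\delta(s+T)-\delta(s)=j\pi$ for some $j\in\mathbb Z$, such that, with $$\iota(s)=\int_0^s(\tfrac12k+\delta'-\tau)\,\mathrm{sech}(2\eta)\,ds,\qquad \iota_0=\begin{cases}\iota(T)/T,& j \text{ even},\\(\iota(T)+\pi)/T,&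 j\text{ odd},\end{cases}$$ the transformation $$Z=e^{i\delta}(\cosh(\eta)\,v-\sinh(\eta)\,\bar v),\qquad v=e^{-i(\iota(s)-\iota_0s)}w$$ brings the Liouville form to $$\alpha=\tfrac1{4i}(w\,d\bar w-\bar w\,dw)-H_0\,ds-\sum_{n\ge1}H_n(s,w,\bar w)\,ds,\qquad H_0=\tfrac12\iota_0w\bar w .$$ (b) If the axis is hyperbolic, there are smooth $\delta,\eta$, with $\eta$ $T$-periodic, $\delta(s+T)-\delta(s)=j\pi$ and $j\in\mathbb Z$ even exactly when $\sigma=1$, and a smooth function $F$ with $F\sinh(2\eta)=\tfrac12k+\delta'-\tau$ (so $F=(\tfrac12k+\delta'-\tau)\,\mathrm{csch}(2\eta)$ where $\eta\ne0$), such that, with $\nu(s)=\int_0^sF\,ds$ and $\nu_0=\nu(T)/T$, the transformation $$Z=e^{i\delta}(\cosh(\eta)\,v-\sinh(\eta)\,\bar v),\qquad v=\cosh(\nu(s)-\nu_0s)\,w-i\sinh(\nu(s)-\nu_0s)\,\bar w$$ brings the Liouville form to the same form with $H_0=\tfrac14\nu_0(w^2+\bar w^2)$. In both cases the functions $\delta,\eta$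 (and $F$) depend only on the fixed data $T,k,\gamma,\kappa,B_0,A_2$ (and in (a) on $C$), not on the higher-order terms of $\alpha$, and for $n\ge1$ $$H_n=C_n(s)\,w^{n+2}+\bar C_n(s)\,\bar w^{n+2}+P_n(s,w,\bar w),$$ where $P_n$ is a real homogeneous polynomial of degree $n+2$ in $w,\bar w$ without the pure powers $w^{n+2},\bar w^{n+2}$, which for the given data is determined by the functions $C_1,\dots,C_n$. The coefficients of $H_n$ are smooth functions of $s$; they are $T$-periodic in the elliptic and the direct hyperbolic case, and satisfy $c(s+T)=(-1)^nc(s)$ in the reflection hyperbolic case. -/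

import Mathlib

open scoped ContDiff ComplexConjugate

noncomputable section

namespace NearAxis

/-! ### Formal functions and formal one-forms near the axis

A formal function is a power series in two conjugate variables (variable `0` is the complex
coordinate, `z` say, variable `1` is its conjugate) whose coefficients are functions of `s`. -/

/-- Formal power series in a complex coordinate and its conjugate, over functions of `s`. -/
abbrev FS : Type := MvPowerSeries (Fin 2) (ℝ → ℂ)

/-- The coefficient of `z ^ i * z̄ ^ j`. -/
def cf (f : FS) (i j : ℕ) : ℝ → ℂ :=
  MvPowerSeries.coeff (Finsupp.single 0 i + Finsupp.single 1 j) f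

/-- The complex coordinate. -/
def Zv : FS := MvPowerSeries.X 0

/-- The conjugate coordinate. -/
def Zb : FS := MvPowerSeries.X 1

/-- A function of `s` alone. -/
def fn (a : ℝ → ℂ) : FS := MvPowerSeries.C a

/-- A numerical constant. -/
def cst (c : ℂ) : FS := fn fun _ => c

/-- Derivative with respect to `s`, the other two variables being fixed. -/
def ds (f : FS) : FS := fun m => deriv (MvPowerSeries.coeff m f)

/-- Derivative with respect to the complex coordinate. -/
def dZ (f : FS) : FS := MvPowerSeries.pderiv (ℝ → ℂ) 0 f

/-- Derivative with respect to the conjugate coordinate. -/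
def dZb (f : FS) : FS := MvPowerSeries.pderiv (ℝ → ℂ) 1 f

/-- The part of `f` that is homogeneous of degree `n` in the two conjugate variables. -/
def homPart (n : ℕ) (f : FS) : FS :=
  fun m => if m.degree = n then MvPowerSeries.coeff m f else 0

/-- The coefficients are smooth functions of `s`. -/
def IsSmooth (f : FS) : Prop := ∀ m, ContDiff ℝ ∞ (MvPowerSeries.coeff m f)

/-- The formal function is real-valued. -/
def IsReal (f : FS) : Prop := ∀ i j s, cf f j i s = conj (cf f i j s)

/-- The coefficients are `T`-periodic functions of `s`. -/
def IsPeriodic (T : ℝ) (f : FS) : Prop := ∀ m, Function.Periodic (MvPowerSeries.coeff m f) T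

/-- A real formal function on the solid torus of length `T`. -/
structure IsTorusFunction (T : ℝ) (f : FS) : Prop where
  smooth : IsSmooth f
  real : IsReal f
  periodic : IsPeriodic T f

/-- The formal one-form `a dz + b dz̄ + c ds`. -/
@[ext] structure OneForm where
  a : FS
  b : FS
  c : FS

instance : SMul ℝ OneForm :=
  ⟨fun k θ => ⟨cst k * θ.a, cst k * θ.b, cst k * θ.c⟩⟩

/-- Composition with the formal map `(w, w̄, s) ↦ (φ, ψ, s)`. -/
def comp (φ ψ f : FS) : FS := MvPowerSeries.subst ![φ, ψ] f

/-- Pullback of a one-form under the formal map `(w, w̄, s) ↦ (φ, ψ, s)`. -/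
def pullback (φ ψ : FS) (θ : OneForm) : OneForm where
  a := comp φ ψ θ.a * dZ φ + comp φ ψ θ.b * dZ ψ
  b := comp φ ψ θ.a * dZb φ + comp φ ψ θ.b * dZb ψ
  c := comp φ ψ θ.a * ds φ + comp φ ψ θ.b * ds ψ + comp φ ψ θ.c

/-- Pullback under the real-linear, `s`-dependent change of coordinate `z = p w + q w̄`. -/
def linPullback (p q : ℝ → ℂ) (θ : OneForm) : OneForm :=
  pullback (fn p * Zv + fn q * Zb)
    (fn (fun s => conj (q s)) * Zv + fn (fun s => conj (p s)) * Zb) θ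

/-- The Liouville one-form `(1 / 4i) (Z dZ̄ - Z̄ dZ) - H ds` of a Hamiltonian `H`. -/
def liouville (H : FS) : OneForm where
  a := -(cst (1 / (4 * Complex.I)) * Zb)
  b := cst (1 / (4 * Complex.I)) * Zv
  c := -H

/-! ### Beltrami and vacuum fields in rotation minimizing coordinates -/

/-- The metric coefficient `h = 1 - (κ̄ u + κ ū) / 2` of the rotation minimizing metric
`h² ds² + du dū`, where `κ = κ₁ + i κ₂` is the normal development of the axis. -/
def metricH (κ : ℝ → ℂ) : FS :=
  1 - cst (1 / 2) * (fn (fun s => conj (κ s)) * Zv + fn κ * Zb)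

/-- The operator `⋆ d` on one-forms for the metric `h² ds² + du dū`, in the coordinates
`(u, ū, s)`. -/
def starD (κ : ℝ → ℂ) (θ : OneForm) : OneForm where
  a := cst Complex.I * MvPowerSeries.invOfUnit (metricH κ) 1 * (dZ θ.c - ds θ.a)
  b := -(cst Complex.I * MvPowerSeries.invOfUnit (metricH κ) 1 * (dZb θ.c - ds θ.b))
  c := cst (2 * Complex.I) * metricH κ * (dZb θ.a - dZ θ.b)

/-- The one-form `αs ds - (1 / 4i) αu (u dū - ū du)`. -/
def potential (αs αu : FS) : OneForm where
  a := cst (1 / (4 * Complex.I)) * (αu * Zb)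
  b := -(cst (1 / (4 * Complex.I)) * (αu * Zv))
  c := αs

/-- The data along a magnetic axis of length `T`: the Beltrami constant `k` (`k = 0` for a vacuum
field), the normal development `κ` of the axis in a rotation minimizing frame, the angle `γ` from
that frame to a periodic one, the field strength `B₀` on the axis, and the free function `A₂` of
degree two. -/
structure AxisData where
  T : ℝ
  T_pos : 0 < T
  k : ℝ
  γ : ℝ → ℝ
  γ_smooth : ContDiff ℝ ∞ γ
  γ_shift : ∃ γ₀ : ℝ, ∀ s, γ (s + T) - γ s = γ₀
  κ : ℝ → ℂ
  κ_smooth : ContDiff ℝ ∞ κ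
  κ_periodic : Function.Periodic (fun s => Complex.exp (-(γ s * Complex.I)) * κ s) T
  B₀ : ℝ → ℝ
  B₀_smooth : ContDiff ℝ ∞ B₀
  B₀_periodic : Function.Periodic B₀ T
  B₀_pos : ∀ s, 0 < B₀ s
  A₂ : ℝ → ℂ
  A₂_smooth : ContDiff ℝ ∞ A₂
  A₂_periodic : Function.Periodic A₂ T

namespace AxisData

variable (D : AxisData)

/-- `τ = γ'`. -/
def τ : ℝ → ℝ := deriv D.γ

/-- A formal function of `(u, ū, s)` written in the periodic coordinate `z = e^{-iγ} u`. -/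
def toZ (f : FS) : FS :=
  comp (fn (fun s => Complex.exp (D.γ s * Complex.I)) * Zv)
    (fn (fun s => Complex.exp (-(D.γ s * Complex.I))) * Zb) f

/-- `αs ds - (1 / 4i) αu (u dū - ū du)` is a formal vector potential of a Beltrami (or vacuum)
field with the given data: it solves `(⋆d)² α = k ⋆d α`, the field `⋆d α` is `B₀ ds` on the axis,
the components are real and periodic in the coordinate `z`, `αs` has no terms of degree less than
two, and `A₂` is its coefficient of `z²`. -/
structure IsPotential (αs αu : FS) : Prop where
  torus_s : IsTorusFunction D.T (D.toZ αs)
  torus_u : IsTorusFunction D.T (D.toZ αu)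
  beltrami : starD D.κ (starD D.κ (potential αs αu)) = D.k • starD D.κ (potential αs αu)
  axis_s : cf (starD D.κ (potential αs αu)).c 0 0 = fun s => (D.B₀ s : ℂ)
  axis_u : cf (starD D.κ (potential αs αu)).a 0 0 = 0
  axis_ub : cf (starD D.κ (potential αs αu)).b 0 0 = 0
  gauge : ∀ i j, i + j < 2 → cf αs i j = 0
  quadratic : cf (D.toZ αs) 2 0 = D.A₂

/-- `H` is the near-axis Hamiltonian of the potential: in the canonical coordinate
`Z = z̄ √αz`, with `αz` the second component of the potential as a function of `z`, the potential
is the Liouville one-form of `H`. -/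
def IsHamiltonian (αs αu H : FS) : Prop :=
  IsTorusFunction D.T H ∧
  ∃ S : FS, S * S = D.toZ αu ∧ cf S 0 0 = (fun s => (Real.sqrt (D.B₀ s) : ℂ)) ∧
    pullback (Zb * S) (Zv * S) (liouville H) =
      linPullback (fun s => Complex.exp (D.γ s * Complex.I)) 0 (potential αs αu)

/-! ### The leading-order dynamics and its Floquet exponents -/

/-- The function `C₂ = Ā₂ / B₀`. -/
def C₂ (s : ℝ) : ℂ := conj (D.A₂ s) / D.B₀ s

/-- The right-hand side of the leading-order dynamics `Z' = 4 i C̄₂ Z̄ - i (k / 2 - τ) Z`. -/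
def linRhs (s : ℝ) (Z : ℂ) : ℂ :=
  4 * Complex.I * conj (D.C₂ s) * conj Z - Complex.I * (D.k / 2 - D.τ s) * Z

/-- The matrix of `linRhs` in the real coordinates `(Re Z, Im Z)`. -/
def linMatrix (s : ℝ) : Matrix (Fin 2) (Fin 2) ℝ :=
  !![(D.linRhs s 1).re, (D.linRhs s Complex.I).re;
     (D.linRhs s 1).im, (D.linRhs s Complex.I).im]

/-- `X` is the fundamental matrix of the leading-order dynamics with `X(0) = 1`. -/
def IsFundamental (X : ℝ → Matrix (Fin 2) (Fin 2) ℝ) : Prop :=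
  X 0 = 1 ∧ ∀ s i j, HasDerivAt (fun t => X t i j) ((D.linMatrix s * X s) i j) s

/-- The axis is elliptic and `C` is a Floquet matrix: `X(T) = e^{T C}`, where the eigenvalues of
the real matrix `C`, the Floquet exponents, are `± i f` with `f ≠ 0`. -/
def IsElliptic (X : ℝ → Matrix (Fin 2) (Fin 2) ℝ) (C : Matrix (Fin 2) (Fin 2) ℝ) : Prop :=
  X D.T = NormedSpace.exp (D.T • C) ∧
  ∃ f : ℝ, f ≠ 0 ∧ C.charpoly = Polynomial.X ^ 2 + Polynomial.C (f ^ 2)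

/-- The axis is hyperbolic, direct for `σ = 1` and reflection hyperbolic for `σ = -1`:
`X(T) = σ e^{T C}`, where the eigenvalues of the real matrix `C`, the Floquet exponents, are `± ν`
with `ν ≠ 0`. -/
def IsHyperbolic (X : ℝ → Matrix (Fin 2) (Fin 2) ℝ) (σ : ℝ) : Prop :=
  (σ = 1 ∨ σ = -1) ∧ ∃ C : Matrix (Fin 2) (Fin 2) ℝ,
    X D.T = σ • NormedSpace.exp (D.T • C) ∧
    ∃ ν : ℝ, ν ≠ 0 ∧ C.charpoly = Polynomial.X ^ 2 - Polynomial.C (ν ^ 2)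

end AxisData

/-- The symmetric matrix of the invariant ellipses in the section `s`. With `J = (0 1; -1 0)` the
orbits of `e^{t C}` lie on the ellipses `x ⬝ J C x = const`, and these are carried along by
`X(s)`. -/
def ellipseMatrix (X : ℝ → Matrix (Fin 2) (Fin 2) ℝ) (C : Matrix (Fin 2) (Fin 2) ℝ) (s : ℝ) :
    Matrix (Fin 2) (Fin 2) ℝ :=
  ((X s)⁻¹).transpose * (!![0, 1; -1, 0] * C) * (X s)⁻¹

/-- The invariant ellipses have a principal axis whose direction, as an unoriented line, depends
smoothly and `T`-periodically on `s`. -/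
def HasSmoothPrincipalAxis (T : ℝ) (X : ℝ → Matrix (Fin 2) (Fin 2) ℝ)
    (C : Matrix (Fin 2) (Fin 2) ℝ) : Prop :=
  ∃ d : ℝ → Fin 2 → ℝ, ContDiff ℝ ∞ d ∧ (∀ s, d s 0 ^ 2 + d s 1 ^ 2 = 1) ∧
    (∀ s, d (s + T) = d s ∨ d (s + T) = -d s) ∧
    ∀ s, ∃ μ : ℝ, (ellipseMatrix X C s).mulVec (d s) = μ • d s

/-! ### The transformations to Floquet coordinates -/

/-- The transformation `Z = e^{iδ} (cosh η v - sinh η v̄)`. -/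
def rotateScale (δ η : ℝ → ℝ) (θ : OneForm) : OneForm :=
  linPullback (fun s => Complex.exp (δ s * Complex.I) * Real.cosh (η s))
    (fun s => -(Complex.exp (δ s * Complex.I) * Real.sinh (η s))) θ

/-- The transformation `v = e^{-i (ι(s) - ι₀ s)} w`. -/
def averageElliptic (ι : ℝ → ℝ) (ι₀ : ℝ) (θ : OneForm) : OneForm :=
  linPullback (fun s => Complex.exp (-((ι s - ι₀ * s : ℝ) * Complex.I))) 0 θ

/-- The transformation `v = cosh (ν(s) - ν₀ s) w - i sinh (ν(s) - ν₀ s) w̄`. -/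
def averageHyperbolic (ν : ℝ → ℝ) (ν₀ : ℝ) (θ : OneForm) : OneForm :=
  linPullback (fun s => Real.cosh (ν s - ν₀ * s))
    (fun s => -(Complex.I * Real.sinh (ν s - ν₀ * s))) θ

namespace AxisData

/-- `k / 2 + δ' - τ`. -/
def rate (D : AxisData) (δ : ℝ → ℝ) (s : ℝ) : ℝ := D.k / 2 + deriv δ s - D.τ s

/-- The transformation `Ψ` of one-forms takes the Liouville one-form of every near-axis
Hamiltonian with the given data to `(1 / 4i) (w dw̄ - w̄ dw) - (H₀ + H₁ + H₂ + ⋯) ds` with the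
prescribed quadratic part `H₀` and, for `n ≥ 1`,
`Hₙ = Cₙ w ^ (n + 2) + C̄ₙ w̄ ^ (n + 2) + Pₙ`. Here `Pₙ` is a real homogeneous polynomial of degree
`n + 2` in which the two pure powers do not occur, it is determined by the functions `C₁, …, Cₙ`,
and the coefficients of `Hₙ` are smooth and get the factor `σ ^ n` under `s ↦ s + T`. -/
def HasFloquetForm (D : AxisData) (Ψ : OneForm → OneForm) (H₀ : FS) (σ : ℝ) : Prop :=
  ∃ P : ℕ → (ℕ → ℝ → ℂ) → MvPolynomial (Fin 2) (ℝ → ℂ),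
    (∀ n c c', (∀ j, 1 ≤ j → j ≤ n → c j = c' j) → P n c = P n c') ∧
    ∀ αs αu H : FS, D.IsPotential αs αu → D.IsHamiltonian αs αu H →
      ∃ (K : FS) (c : ℕ → ℝ → ℂ),
        Ψ (liouville H) = liouville K ∧
        homPart 0 K = 0 ∧ homPart 1 K = 0 ∧ homPart 2 K = H₀ ∧
        ∀ n, 1 ≤ n →
          homPart (n + 2) K = fn (c n) * Zv ^ (n + 2)
            + fn (fun s => conj (c n s)) * Zb ^ (n + 2) + (P n c : FS) ∧
          ContDiff ℝ ∞ (c n) ∧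
          (∀ s, c n (s + D.T) = (σ : ℂ) ^ n * c n s) ∧
          (P n c).IsHomogeneous (n + 2) ∧
          cf (P n c : FS) (n + 2) 0 = 0 ∧ cf (P n c : FS) 0 (n + 2) = 0 ∧
          IsReal (P n c : FS) ∧ IsSmooth (P n c : FS) ∧
          ∀ m s, (P n c).coeff m (s + D.T) = (σ : ℂ) ^ n * (P n c).coeff m s

end AxisData

end NearAxis

end

/-!
The transformations are real-linear and canonical, `z = p w + q w̄` with `|p|² - |q|² = 1`. Such a
map takes the Liouville form of `H` to that of the composition of `H` with the map, up to a
quadratic form coming from the `s`-dependence (`linPullback_liouville`). The theorem thus splits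
into two independent statements: one on the terms of degree at least three, for arbitrary
canonical maps, and one on the quadratic part.

*Higher degrees* (`hasFloquetForm_of_lin`). Two potentials with the same data are compared order
by order. If they and their Hamiltonians agree below degree `m`, the Beltrami equation along the
axis is in degree `m` a Laplace equation for the difference of the first components, and leaves
only the pure powers of the complex coordinate and its conjugate free; the transversal Beltrami
equations then determine the second component. The canonical coordinate `Z = z̄ √αz` is to leading
order `√B₀ z̄`, so the same holds for the Hamiltonians (`agree_step`). If in addition the pure
coefficients of the *transformed* Hamiltonians agree in degree `m`, then so do those of the
Hamiltonians themselves: the transformed coefficient of `f z^m + f̄ z̄^m` is `f p^m + f̄ q̄^m`,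
which vanishes only for `f = 0` because `|p| > |q|` (`pure_eq_zero_of_lin`). So the mixed terms
`Pₙ` are a function of the pure coefficients `C₁, …, Cₙ` (`admissible_agree`). The quadratic part
of the Hamiltonian is given by the data alone (`homPart_two_hamiltonian`).

*Quadratic part.* A pair `(δ, η)` is a normal frame (`IsNormalFrame`) if rotation by `δ` and
scaling by `η` bring the leading-order dynamics to the form `v' = -i G v` or `v' = i G v̄` with a
real function `G`; averaging `G` over a period by a rotation, respectively a hyperbolic rotation,
then produces `H₀` (`hasFloquetForm_elliptic`, `hasFloquetForm_hyperbolic`). To find a normal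
frame, conjugate the Floquet matrix `C` by `X(s)`. Since `C` commutes with the monodromy matrix
`X(T)`, the result is `T`-periodic; multiplied by the standard symplectic matrix it is a symmetric
matrix of constant determinant, i.e. an invariant quadratic form (`exists_isInvariantForm`). The
angle of a smooth principal axis of this form is `δ`, and its eigenvalue `μ` on this axis gives `η
= (1 / 2) log |μ / f|`, where `± f²` is the determinant: differentiating the diagonalized form
gives exactly the two equations of a normal frame (`IsInvariantForm.exists_isNormalFrame`). In the
elliptic case the principal axis is a hypothesis; in the hyperbolic case the form is indefinite,
its principal axes never degenerate, and a smooth choice exists. That the parity of `j` is then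
given by the sign `σ` of `X(T)` follows from the explicit solution along the direction `v ∝ 1 + i`
of the normal frame: it is multiplied by `(-1) ^ j` times a positive number over a period, and
`e^{TC}` has positive eigenvalues (`pos_of_exp_mulVec`).
-/

noncomputable section

namespace NearAxis

/-! ### Coefficients, order and homogeneous parts of formal functions -/

theorem exponent_eq (d : Fin 2 →₀ ℕ) :
    Finsupp.single 0 (d 0) + Finsupp.single 1 (d 1) = d := by
  ext x; fin_cases x <;> simp

theorem exponent_degree (d : Fin 2 →₀ ℕ) : d.degree = d 0 + d 1 := by
  rw [Finsupp.degree_eq_sum, Fin.sum_univ_two]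

theorem coeff_eq_cf (d : Fin 2 →₀ ℕ) (f : FS) :
    MvPowerSeries.coeff d f = cf f (d 0) (d 1) := by
  rw [cf, exponent_eq]

theorem ext_cf {f g : FS} (h : ∀ i j, cf f i j = cf g i j) : f = g := by
  ext1 d
  rw [coeff_eq_cf, coeff_eq_cf, h]

@[simp] theorem cf_add (f g : FS) (i j : ℕ) : cf (f + g) i j = cf f i j + cf g i j := by
  simp [cf]

@[simp] theorem cf_sub (f g : FS) (i j : ℕ) : cf (f - g) i j = cf f i j - cf g i j := by
  simp [cf]

@[simp] theorem cf_neg (f : FS) (i j : ℕ) : cf (-f) i j = -cf f i j := by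
  simp [cf]

@[simp] theorem cf_zero (i j : ℕ) : cf 0 i j = 0 := by
  simp [cf]

@[simp] theorem cf_fn_mul (a : ℝ → ℂ) (f : FS) (i j : ℕ) : cf (fn a * f) i j = a * cf f i j := by
  simp [cf, fn]

theorem cf_sum {ι : Type*} (t : Finset ι) (f : ι → FS) (i j : ℕ) :
    cf (∑ x ∈ t, f x) i j = ∑ x ∈ t, cf (f x) i j := by
  simp [cf]

theorem cf_ds (f : FS) (i j : ℕ) : cf (ds f) i j = deriv (cf f i j) := rfl

theorem cf_dZ (f : FS) (i j : ℕ) : cf (dZ f) i j = cf f (i + 1) j * (i + 1) := by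
  rw [cf, dZ, MvPowerSeries.coeff_pderiv, coeff_eq_cf]
  simp

theorem cf_dZb (f : FS) (i j : ℕ) : cf (dZb f) i j = cf f i (j + 1) * (j + 1) := by
  rw [cf, dZb, MvPowerSeries.coeff_pderiv, coeff_eq_cf]
  simp

theorem cf_homPart (n : ℕ) (f : FS) (i j : ℕ) :
    cf (homPart n f) i j = if i + j = n then cf f i j else 0 := by
  change (if _ then _ else _) = _
  rw [exponent_degree]
  simp [cf]

theorem cf_zero_zero (f : FS) : cf f 0 0 = MvPowerSeries.constantCoeff f := by
  simp [cf]

theorem cf_zero_zero_mul (f g : FS) : cf (f * g) 0 0 = cf f 0 0 * cf g 0 0 := by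
  simp [cf_zero_zero]

theorem monomial_eq (a : ℝ → ℂ) (i j : ℕ) :
    fn a * Zv ^ i * Zb ^ j
      = MvPowerSeries.monomial (Finsupp.single 0 i + Finsupp.single 1 j) a := by
  rw [fn, Zv, Zb, MvPowerSeries.X_pow_eq, MvPowerSeries.X_pow_eq,
    ← MvPowerSeries.monomial_zero_eq_C_apply, MvPowerSeries.monomial_mul_monomial,
    MvPowerSeries.monomial_mul_monomial]
  simp

theorem cf_monomial (a : ℝ → ℂ) (i j k l : ℕ) :
    cf (fn a * Zv ^ i * Zb ^ j) k l = if k = i ∧ l = j then a else 0 := by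
  rw [monomial_eq, cf, MvPowerSeries.coeff_monomial]
  congr 1
  refine propext ⟨fun h => ⟨?_, ?_⟩, fun h => by rw [h.1, h.2]⟩
  · simpa using DFunLike.congr_fun h 0
  · simpa using DFunLike.congr_fun h 1

theorem homPart_eq_sum (n : ℕ) (f : FS) :
    homPart n f
      = ∑ x ∈ Finset.HasAntidiagonal.antidiagonal n, fn (cf f x.1 x.2) * Zv ^ x.1 * Zb ^ x.2 := by
  refine ext_cf fun i j => ?_
  rw [cf_homPart, cf_sum]
  simp_rw [cf_monomial]
  split_ifs with h
  · rw [Finset.sum_eq_single (i, j)]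
    · simp
    · rintro ⟨k, l⟩ _ hne
      rw [if_neg]
      rintro ⟨rfl, rfl⟩
      exact hne rfl
    · simp [h]
  · refine (Finset.sum_eq_zero ?_).symm
    rintro ⟨k, l⟩ hkl
    rw [if_neg]
    rintro ⟨rfl, rfl⟩
    exact h (by simpa using hkl)

/-- The ideal of formal functions without terms of degree less than `n` in the two conjugate
variables. -/
def Ord (n : ℕ) : Ideal FS where
  carrier := {f | ∀ i j, i + j < n → cf f i j = 0}
  zero_mem' := by intro i j _; simp
  add_mem' := by
    intro f g hf hg i j h
    rw [cf_add, hf i j h, hg i j h, add_zero]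
  smul_mem' := by
    intro f g hg i j h
    classical
    rw [smul_eq_mul, cf, MvPowerSeries.coeff_mul]
    refine Finset.sum_eq_zero fun x hx => ?_
    have hx := Finset.HasAntidiagonal.mem_antidiagonal.1 hx
    have h0 := DFunLike.congr_fun hx 0
    have h1 := DFunLike.congr_fun hx 1
    simp at h0 h1
    rw [coeff_eq_cf x.2, hg _ _ (by omega), mul_zero]

theorem Ord_zero (f : FS) : f ∈ Ord 0 := fun _ _ h => absurd h (Nat.not_lt_zero _)

theorem Ord_mono {m n : ℕ} (h : m ≤ n) {f : FS} (hf : f ∈ Ord n) : f ∈ Ord m :=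
  fun i j hij => hf i j (hij.trans_le h)

theorem Ord_mul {m n : ℕ} {f g : FS} (hf : f ∈ Ord m) (hg : g ∈ Ord n) : f * g ∈ Ord (m + n) := by
  intro i j h
  classical
  rw [cf, MvPowerSeries.coeff_mul]
  refine Finset.sum_eq_zero fun x hx => ?_
  have hx := Finset.HasAntidiagonal.mem_antidiagonal.1 hx
  have h0 := DFunLike.congr_fun hx 0
  have h1 := DFunLike.congr_fun hx 1
  simp at h0 h1
  rcases lt_or_ge (x.1 0 + x.1 1) m with h' | h'
  · rw [coeff_eq_cf x.1, hf _ _ h', zero_mul]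
  · rw [coeff_eq_cf x.2, hg _ _ (by omega), mul_zero]

theorem Ord_pow {f : FS} (hf : f ∈ Ord 1) (i : ℕ) : f ^ i ∈ Ord i := by
  induction i with
  | zero => exact Ord_zero _
  | succ i ih => rw [pow_succ]; exact Ord_mul ih hf

theorem Zv_mem : Zv ∈ Ord 1 := by
  intro i j h
  have := cf_monomial 1 1 0 i j
  simp only [pow_one, pow_zero, mul_one, fn, map_one, one_mul] at this
  rw [this, if_neg (by omega)]

theorem Zb_mem : Zb ∈ Ord 1 := by
  intro i j h
  have := cf_monomial 1 0 1 i j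
  simp only [pow_one, pow_zero, mul_one, fn, map_one, one_mul] at this
  rw [this, if_neg (by omega)]

theorem mem_Ord_one {f : FS} : f ∈ Ord 1 ↔ cf f 0 0 = 0 := by
  refine ⟨fun h => h 0 0 one_pos, fun h i j hij => ?_⟩
  obtain ⟨rfl, rfl⟩ : i = 0 ∧ j = 0 := by omega
  exact h

theorem ds_sub_mem {n : ℕ} {f g : FS} (h : f - g ∈ Ord n) : ds f - ds g ∈ Ord n := by
  intro i j hij
  have := h i j hij
  rw [cf_sub, sub_eq_zero] at this
  rw [cf_sub, cf_ds, cf_ds, this, sub_self]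

theorem dZ_mem {n : ℕ} {f : FS} (h : f ∈ Ord (n + 1)) : dZ f ∈ Ord n := by
  intro i j hij
  rw [cf_dZ, h _ _ (by omega), zero_mul]

theorem dZb_mem {n : ℕ} {f : FS} (h : f ∈ Ord (n + 1)) : dZb f ∈ Ord n := by
  intro i j hij
  rw [cf_dZb, h _ _ (by omega), zero_mul]

/-- A formal function without constant term whose two derivatives vanish to order `n` vanishes to
order `n + 1`. -/
theorem mem_Ord_succ_of_derivatives {n : ℕ} {f : FS} (h0 : cf f 0 0 = 0) (h1 : dZ f ∈ Ord n)
    (h2 : dZb f ∈ Ord n) : f ∈ Ord (n + 1) := by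
  intro i j hij
  rcases i with _ | i
  · rcases j with _ | j
    · exact h0
    · have := h2 0 j (by omega)
      rw [cf_dZb] at this
      funext s
      have hs := congrFun this s
      simp only [Pi.mul_apply, Pi.add_apply, Pi.natCast_apply, Pi.one_apply, Pi.zero_apply,
        mul_eq_zero] at hs
      exact hs.resolve_right (by exact_mod_cast Nat.succ_ne_zero j)
  · have := h1 i j (by omega)
    rw [cf_dZ] at this
    funext s
    have hs := congrFun this s
    simp only [Pi.mul_apply, Pi.add_apply, Pi.natCast_apply, Pi.one_apply, Pi.zero_apply,
      mul_eq_zero] at hs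
    exact hs.resolve_right (by exact_mod_cast Nat.succ_ne_zero i)

/-! ### Substitution -/

theorem hasSubst_pair {φ ψ : FS} (hφ : φ ∈ Ord 1) (hψ : ψ ∈ Ord 1) :
    MvPowerSeries.HasSubst ![φ, ψ] := by
  refine MvPowerSeries.hasSubst_of_constantCoeff_zero fun x => ?_
  fin_cases x
  · simpa [cf_zero_zero] using mem_Ord_one.1 hφ
  · simpa [cf_zero_zero] using mem_Ord_one.1 hψ

/-- Composition with a formal map that fixes the axis, as a ring homomorphism. -/
def compHom {φ ψ : FS} (hφ : φ ∈ Ord 1) (hψ : ψ ∈ Ord 1) : FS →+* FS :=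
  (MvPowerSeries.substAlgHom (R := ℝ → ℂ) (hasSubst_pair hφ hψ)).toRingHom

theorem compHom_apply {φ ψ : FS} (hφ : φ ∈ Ord 1) (hψ : ψ ∈ Ord 1) (f : FS) :
    compHom hφ hψ f = comp φ ψ f := by
  simp [compHom, comp]

section
variable {φ ψ : FS} (hφ : φ ∈ Ord 1) (hψ : ψ ∈ Ord 1)
include hφ hψ

theorem comp_add (f g : FS) : comp φ ψ (f + g) = comp φ ψ f + comp φ ψ g := by
  simp only [← compHom_apply hφ hψ, map_add]

theorem comp_sub (f g : FS) : comp φ ψ (f - g) = comp φ ψ f - comp φ ψ g := by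
  simp only [← compHom_apply hφ hψ, map_sub]

theorem comp_neg (f : FS) : comp φ ψ (-f) = -comp φ ψ f := by
  simp only [← compHom_apply hφ hψ, map_neg]

theorem comp_mul (f g : FS) : comp φ ψ (f * g) = comp φ ψ f * comp φ ψ g := by
  simp only [← compHom_apply hφ hψ, map_mul]

theorem comp_pow (f : FS) (n : ℕ) : comp φ ψ (f ^ n) = comp φ ψ f ^ n := by
  simp only [← compHom_apply hφ hψ, map_pow]

theorem comp_sum {ι : Type*} (t : Finset ι) (f : ι → FS) :
    comp φ ψ (∑ x ∈ t, f x) = ∑ x ∈ t, comp φ ψ (f x) := by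
  simp only [← compHom_apply hφ hψ, map_sum]

theorem comp_Zv : comp φ ψ Zv = φ := by
  rw [comp, Zv, MvPowerSeries.subst_X (hasSubst_pair hφ hψ)]; rfl

theorem comp_Zb : comp φ ψ Zb = ψ := by
  rw [comp, Zb, MvPowerSeries.subst_X (hasSubst_pair hφ hψ)]; rfl

theorem cf_comp (f : FS) (i j : ℕ) :
    cf (comp φ ψ f) i j
      = ∑ᶠ d : Fin 2 →₀ ℕ, cf f (d 0) (d 1) * cf (φ ^ d 0 * ψ ^ d 1) i j := by
  rw [cf, comp, MvPowerSeries.coeff_subst (hasSubst_pair hφ hψ)]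
  refine finsum_congr fun d => ?_
  rw [Finsupp.prod_fintype _ _ (by simp), Fin.prod_univ_two, coeff_eq_cf d, smul_eq_mul]
  rfl

omit hφ hψ in
theorem comp_fn (a : ℝ → ℂ) : comp φ ψ (fn a) = fn a := by
  rw [comp, fn, MvPowerSeries.subst_C]

theorem comp_comp {φ' ψ' : FS} (hφ' : φ' ∈ Ord 1) (hψ' : ψ' ∈ Ord 1) (f : FS) :
    comp φ ψ (comp φ' ψ' f) = comp (comp φ ψ φ') (comp φ ψ ψ') f := by
  rw [comp, comp, MvPowerSeries.subst_comp_subst_apply (hasSubst_pair hφ' hψ')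
    (hasSubst_pair hφ hψ), comp]
  congr 1
  funext x
  fin_cases x <;> rfl

end

theorem pow_sub_pow_mem {l : ℕ} {φ φ' : FS} (hφ : φ ∈ Ord 1) (hφ' : φ' ∈ Ord 1)
    (h : φ - φ' ∈ Ord (l + 1)) (i : ℕ) : φ ^ i - φ' ^ i ∈ Ord (i + l) := by
  induction i with
  | zero => simp
  | succ i ih =>
    have : φ ^ (i + 1) - φ' ^ (i + 1) = φ ^ i * (φ - φ') + (φ ^ i - φ' ^ i) * φ' := by ring
    rw [this]
    refine add_mem (Ord_mono (by omega) (Ord_mul (Ord_pow hφ i) h))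
      (Ord_mono (by omega) (Ord_mul ih hφ'))

/-- Changing an axis-preserving map in degrees above `l` changes the pullback of a function of
order `r` only in degrees at least `r + l`. -/
theorem comp_sub_comp_mem {l r : ℕ} {φ φ' ψ ψ' f : FS} (hφ : φ ∈ Ord 1) (hφ' : φ' ∈ Ord 1)
    (hψ : ψ ∈ Ord 1) (hψ' : ψ' ∈ Ord 1) (h : φ - φ' ∈ Ord (l + 1)) (h' : ψ - ψ' ∈ Ord (l + 1))
    (hf : f ∈ Ord r) : comp φ ψ f - comp φ' ψ' f ∈ Ord (r + l) := by
  intro i j hij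
  rw [cf_sub, cf_comp hφ hψ, cf_comp hφ' hψ', sub_eq_zero]
  refine finsum_congr fun d => ?_
  rcases lt_or_ge (d 0 + d 1) r with hd | hd
  · rw [hf _ _ hd, zero_mul, zero_mul]
  · congr 1
    have e : φ ^ d 0 * ψ ^ d 1 - φ' ^ d 0 * ψ' ^ d 1
        = φ ^ d 0 * (ψ ^ d 1 - ψ' ^ d 1) + (φ ^ d 0 - φ' ^ d 0) * ψ' ^ d 1 := by ring
    have hm : φ ^ d 0 * ψ ^ d 1 - φ' ^ d 0 * ψ' ^ d 1 ∈ Ord (d 0 + d 1 + l) := by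
      rw [e]
      refine add_mem
        (Ord_mono (by omega) (Ord_mul (Ord_pow hφ _) (pow_sub_pow_mem hψ hψ' h' _)))
        (Ord_mono (by omega) (Ord_mul (pow_sub_pow_mem hφ hφ' h _) (Ord_pow hψ' _)))
    have := hm i j (by omega)
    rwa [cf_sub, sub_eq_zero] at this

theorem comp_mem {r : ℕ} {φ ψ f : FS} (hφ : φ ∈ Ord 1) (hψ : ψ ∈ Ord 1) (hf : f ∈ Ord r) :
    comp φ ψ f ∈ Ord r := by
  intro i j hij
  rw [cf_comp hφ hψ]
  refine finsum_eq_zero_of_forall_eq_zero fun d => ?_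
  rcases lt_or_ge (d 0 + d 1) r with hd | hd
  · rw [hf _ _ hd, zero_mul]
  · rw [Ord_mul (Ord_pow hφ _) (Ord_pow hψ _) i j (by omega), mul_zero]

/-! ### Linear substitutions -/

/-- The linear form `a z + b z̄`. -/
def lform (a b : ℝ → ℂ) : FS := fn a * Zv + fn b * Zb

theorem lform_mem (a b : ℝ → ℂ) : lform a b ∈ Ord 1 :=
  add_mem (Ideal.mul_mem_left _ _ Zv_mem) (Ideal.mul_mem_left _ _ Zb_mem)

theorem cf_Zv (i j : ℕ) : cf Zv i j = if i = 1 ∧ j = 0 then 1 else 0 := by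
  have := cf_monomial 1 1 0 i j
  simpa only [pow_one, pow_zero, mul_one, fn, map_one, one_mul] using this

theorem cf_Zb (i j : ℕ) : cf Zb i j = if i = 0 ∧ j = 1 then 1 else 0 := by
  have := cf_monomial 1 0 1 i j
  simpa only [pow_one, pow_zero, mul_one, fn, map_one, one_mul] using this

theorem isHomogeneous_fn (a : ℝ → ℂ) : MvPowerSeries.IsHomogeneous (fn a) 0 := by
  rw [fn, ← MvPowerSeries.monomial_zero_eq_C_apply]
  intro d hd
  rw [MvPowerSeries.eq_of_coeff_monomial_ne_zero hd]
  simp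

theorem isHomogeneous_X (x : Fin 2) :
    MvPowerSeries.IsHomogeneous (MvPowerSeries.X x : FS) 1 := by
  rw [MvPowerSeries.X_def]
  intro d hd
  rw [MvPowerSeries.eq_of_coeff_monomial_ne_zero hd]
  simp [Finsupp.weight_apply]

theorem isHomogeneous_lform (a b : ℝ → ℂ) : MvPowerSeries.IsHomogeneous (lform a b) 1 :=
  MvPowerSeries.IsHomogeneous.add
    (MvPowerSeries.IsHomogeneous.mul (isHomogeneous_fn a) (isHomogeneous_X 0))
    (MvPowerSeries.IsHomogeneous.mul (isHomogeneous_fn b) (isHomogeneous_X 1))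

theorem isHomogeneous_pow {f : FS} {n : ℕ} (hf : MvPowerSeries.IsHomogeneous f n) (k : ℕ) :
    MvPowerSeries.IsHomogeneous (f ^ k) (k * n) := by
  induction k with
  | zero =>
    rw [pow_zero, zero_mul, ← map_one MvPowerSeries.C]
    exact isHomogeneous_fn 1
  | succ k ih =>
    rw [pow_succ, Nat.succ_mul]
    exact MvPowerSeries.IsHomogeneous.mul ih hf

theorem cf_lform_pow_mul (a b c d : ℝ → ℂ) (k l i j : ℕ) (h : i + j ≠ k + l) :
    cf (lform a b ^ k * lform c d ^ l) i j = 0 := by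
  refine MvPowerSeries.IsHomogeneous.coeff_eq_zero (MvPowerSeries.IsHomogeneous.mul
    (isHomogeneous_pow (isHomogeneous_lform a b) k)
    (isHomogeneous_pow (isHomogeneous_lform c d) l)) ?_
  rw [exponent_degree]
  simpa using h

theorem homPart_comp_lform (a b c d : ℝ → ℂ) (n : ℕ) (f : FS) :
    homPart n (comp (lform a b) (lform c d) f) = comp (lform a b) (lform c d) (homPart n f) := by
  refine ext_cf fun i j => ?_
  rw [cf_homPart, cf_comp (lform_mem _ _) (lform_mem _ _), cf_comp (lform_mem _ _) (lform_mem _ _)]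
  split_ifs with h
  · refine finsum_congr fun e => ?_
    rw [cf_homPart]
    split_ifs with h'
    · rfl
    · rw [cf_lform_pow_mul _ _ _ _ _ _ _ _ (by omega), mul_zero, mul_zero]
  · refine (finsum_eq_zero_of_forall_eq_zero fun e => ?_).symm
    rw [cf_homPart]
    split_ifs with h'
    · rw [cf_lform_pow_mul _ _ _ _ _ _ _ _ (by omega), mul_zero]
    · rw [zero_mul]

theorem homPart_comp_lform_eq_sum (a b c d : ℝ → ℂ) (n : ℕ) (f : FS) :
    homPart n (comp (lform a b) (lform c d) f)
      = ∑ x ∈ Finset.HasAntidiagonal.antidiagonal n,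
          fn (cf f x.1 x.2) * lform a b ^ x.1 * lform c d ^ x.2 := by
  rw [homPart_comp_lform, homPart_eq_sum, comp_sum (lform_mem _ _) (lform_mem _ _)]
  refine Finset.sum_congr rfl fun x _ => ?_
  rw [comp_mul (lform_mem _ _) (lform_mem _ _), comp_mul (lform_mem _ _) (lform_mem _ _),
    comp_pow (lform_mem _ _) (lform_mem _ _), comp_pow (lform_mem _ _) (lform_mem _ _),
    comp_Zv (lform_mem _ _) (lform_mem _ _), comp_Zb (lform_mem _ _) (lform_mem _ _), comp_fn]

theorem cf_comp_lform (a b c d : ℝ → ℂ) (f : FS) (i j : ℕ) :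
    cf (comp (lform a b) (lform c d) f) i j
      = ∑ x ∈ Finset.HasAntidiagonal.antidiagonal (i + j),
          cf f x.1 x.2 * cf (lform a b ^ x.1 * lform c d ^ x.2) i j := by
  have h := congrArg (fun g => cf g i j) (homPart_comp_lform_eq_sum a b c d (i + j) f)
  simp only [cf_homPart, if_true, cf_sum] at h
  rw [h]
  refine Finset.sum_congr rfl fun x _ => ?_
  rw [mul_assoc, cf_fn_mul]

theorem fn_mul (a b : ℝ → ℂ) : fn (a * b) = fn a * fn b := map_mul _ _ _
theorem fn_add (a b : ℝ → ℂ) : fn (a + b) = fn a + fn b := map_add _ _ _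
theorem fn_sub (a b : ℝ → ℂ) : fn (a - b) = fn a - fn b := map_sub _ _ _
theorem fn_neg (a : ℝ → ℂ) : fn (-a) = -fn a := map_neg _ _
theorem fn_pow (a : ℝ → ℂ) (n : ℕ) : fn (a ^ n) = fn a ^ n := map_pow _ _ _
theorem fn_zero : fn 0 = 0 := map_zero _
theorem fn_one : fn 1 = 1 := map_one _

theorem lform_left (a : ℝ → ℂ) : lform a 0 = fn a * Zv := by
  rw [lform, fn_zero, zero_mul, add_zero]

theorem lform_right (a : ℝ → ℂ) : lform 0 a = fn a * Zb := by
  rw [lform, fn_zero, zero_mul, zero_add]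

/-- Coefficients after a diagonal linear substitution. -/
theorem cf_comp_diagonal (a d : ℝ → ℂ) (f : FS) (i j : ℕ) :
    cf (comp (fn a * Zv) (fn d * Zb) f) i j = cf f i j * (a ^ i * d ^ j) := by
  rw [← lform_left, ← lform_right, cf_comp_lform, Finset.sum_eq_single (i, j)]
  · rw [lform_left, lform_right]
    have : (fn a * Zv) ^ i * (fn d * Zb) ^ j = fn (a ^ i * d ^ j) * Zv ^ i * Zb ^ j := by
      rw [fn_mul, fn_pow, fn_pow]; ring
    rw [this, cf_monomial, if_pos ⟨rfl, rfl⟩]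
  · rintro ⟨k, l⟩ _ hne
    have : (fn a * Zv) ^ k * (fn d * Zb) ^ l = fn (a ^ k * d ^ l) * Zv ^ k * Zb ^ l := by
      rw [fn_mul, fn_pow, fn_pow]; ring
    rw [lform_left, lform_right, this, cf_monomial, if_neg, mul_zero]
    rintro ⟨rfl, rfl⟩
    exact hne rfl
  · simp

/-- Coefficients after an antidiagonal linear substitution, which exchanges the two variables. -/
theorem cf_comp_antidiagonal (b c : ℝ → ℂ) (f : FS) (i j : ℕ) :
    cf (comp (fn b * Zb) (fn c * Zv) f) i j = cf f j i * (b ^ j * c ^ i) := by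
  rw [← lform_left, ← lform_right, cf_comp_lform, Finset.sum_eq_single (j, i)]
  · rw [lform_left, lform_right]
    have : (fn b * Zb) ^ j * (fn c * Zv) ^ i = fn (b ^ j * c ^ i) * Zv ^ i * Zb ^ j := by
      rw [fn_mul, fn_pow, fn_pow]; ring
    rw [this, cf_monomial, if_pos ⟨rfl, rfl⟩]
  · rintro ⟨k, l⟩ _ hne
    have : (fn b * Zb) ^ k * (fn c * Zv) ^ l = fn (b ^ k * c ^ l) * Zv ^ l * Zb ^ k := by
      rw [fn_mul, fn_pow, fn_pow]; ring
    rw [lform_left, lform_right, this, cf_monomial, if_neg, mul_zero]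
    rintro ⟨rfl, rfl⟩
    exact hne rfl
  · intro h
    exact absurd (by simp [add_comm]) h

/-! ### Smoothness, translation and conjugation of coefficients -/

/-- The smooth functions of `s`. -/
def smoothFns : Subring (ℝ → ℂ) where
  carrier := {a | ContDiff ℝ ∞ a}
  mul_mem' := by
    intro a b (ha : ContDiff ℝ ∞ a) (hb : ContDiff ℝ ∞ b)
    exact ContDiff.mul ha hb
  one_mem' := by
    change ContDiff ℝ ∞ fun _ : ℝ => (1 : ℂ)
    exact contDiff_const
  add_mem' := by
    intro a b (ha : ContDiff ℝ ∞ a) (hb : ContDiff ℝ ∞ b)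
    exact ContDiff.add ha hb
  zero_mem' := by
    change ContDiff ℝ ∞ fun _ : ℝ => (0 : ℂ)
    exact contDiff_const
  neg_mem' := by
    intro a (ha : ContDiff ℝ ∞ a)
    exact ContDiff.neg ha

/-- The formal functions with smooth coefficients. -/
def smoothFS : Subring FS where
  carrier := {f | ∀ m, MvPowerSeries.coeff m f ∈ smoothFns}
  mul_mem' := by
    classical
    intro f g hf hg m
    rw [MvPowerSeries.coeff_mul]
    exact sum_mem fun x _ => mul_mem (hf _) (hg _)
  one_mem' := by
    classical
    intro m
    rw [MvPowerSeries.coeff_one]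
    split_ifs
    · exact one_mem _
    · exact zero_mem _
  add_mem' := by
    intro f g hf hg m
    rw [map_add]
    exact add_mem (hf m) (hg m)
  zero_mem' := by
    intro m
    rw [map_zero]
    exact zero_mem _
  neg_mem' := by
    intro f hf m
    rw [map_neg]
    exact neg_mem (hf m)

theorem fn_mem_smoothFS {a : ℝ → ℂ} (ha : ContDiff ℝ ∞ a) : fn a ∈ smoothFS := by
  classical
  intro m
  rw [fn, MvPowerSeries.coeff_C]
  split_ifs
  · exact ha
  · exact zero_mem _

theorem X_mem_smoothFS (x : Fin 2) : (MvPowerSeries.X x : FS) ∈ smoothFS := by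
  classical
  intro m
  rw [MvPowerSeries.coeff_X]
  split_ifs
  · exact one_mem _
  · exact zero_mem _

theorem lform_mem_smoothFS {a b : ℝ → ℂ} (ha : ContDiff ℝ ∞ a) (hb : ContDiff ℝ ∞ b) :
    lform a b ∈ smoothFS :=
  add_mem (mul_mem (fn_mem_smoothFS ha) (X_mem_smoothFS 0))
    (mul_mem (fn_mem_smoothFS hb) (X_mem_smoothFS 1))

/-- Translation of the coefficients by `T`. -/
def shift (T : ℝ) : FS →+* FS :=
  MvPowerSeries.map (RingHom.pi fun s => Pi.evalRingHom (fun _ : ℝ => ℂ) (s + T))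

theorem cf_shift (T : ℝ) (f : FS) (i j : ℕ) (s : ℝ) :
    cf (shift T f) i j s = cf f i j (s + T) := by
  rw [cf, shift, MvPowerSeries.coeff_map]; rfl

theorem shift_fn (T : ℝ) (a : ℝ → ℂ) : shift T (fn a) = fn fun s => a (s + T) := by
  rw [shift, fn, MvPowerSeries.map_C]; rfl

theorem shift_Zv (T : ℝ) : shift T Zv = Zv := MvPowerSeries.map_X _ _

theorem shift_Zb (T : ℝ) : shift T Zb = Zb := MvPowerSeries.map_X _ _

/-- Pointwise conjugation of functions of `s`. -/
def cj : (ℝ → ℂ) →+* (ℝ → ℂ) :=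
  RingHom.pi fun s => (starRingEnd ℂ).comp (Pi.evalRingHom (fun _ : ℝ => ℂ) s)

@[simp] theorem cj_apply (a : ℝ → ℂ) (s : ℝ) : cj a s = conj (a s) := rfl

@[simp] theorem cj_cj (a : ℝ → ℂ) : cj (cj a) = a := by
  funext s; simp

theorem contDiff_cj {a : ℝ → ℂ} (ha : ContDiff ℝ ∞ a) : ContDiff ℝ ∞ (cj a) :=
  Complex.conjCLE.contDiff.comp ha

/-- Conjugation of formal functions: it conjugates the coefficients and exchanges the two
variables. -/
def conjFS : FS →+* FS := (MvPowerSeries.map cj).comp (compHom Zb_mem Zv_mem)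

theorem cf_conjFS (f : FS) (i j : ℕ) : cf (conjFS f) i j = cj (cf f j i) := by
  have h := cf_comp_antidiagonal 1 1 f i j
  rw [fn_one, one_mul, one_mul, one_pow, one_pow, one_mul, mul_one] at h
  rw [← h, conjFS, RingHom.comp_apply, compHom_apply]
  simp [cf]

theorem conjFS_fn (a : ℝ → ℂ) : conjFS (fn a) = fn (cj a) := by
  rw [conjFS, RingHom.comp_apply, compHom_apply, comp_fn, fn, MvPowerSeries.map_C]; rfl

theorem conjFS_Zv : conjFS Zv = Zb := by
  rw [conjFS, RingHom.comp_apply, compHom_apply, comp_Zv Zb_mem Zv_mem]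
  exact MvPowerSeries.map_X _ _

theorem conjFS_Zb : conjFS Zb = Zv := by
  rw [conjFS, RingHom.comp_apply, compHom_apply, comp_Zb Zb_mem Zv_mem]
  exact MvPowerSeries.map_X _ _

theorem conjFS_lform (a b : ℝ → ℂ) : conjFS (lform a b) = lform (cj b) (cj a) := by
  rw [lform, map_add, map_mul, map_mul, conjFS_fn, conjFS_fn, conjFS_Zv, conjFS_Zb, lform, add_comm]

theorem isReal_iff {f : FS} : IsReal f ↔ conjFS f = f := by
  constructor
  · intro h
    refine ext_cf fun i j => ?_
    rw [cf_conjFS]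
    funext s
    rw [cj_apply, ← h j i s]
  · intro h i j s
    conv_lhs => rw [← h, cf_conjFS]
    rfl

/-! ### Homogeneous parts -/

theorem homPart_sub (n : ℕ) (f g : FS) : homPart n (f - g) = homPart n f - homPart n g := by
  refine ext_cf fun i j => ?_
  simp only [cf_homPart, cf_sub]
  split_ifs
  · rfl
  · simp

theorem homPart_of_isHomogeneous {f : FS} {k : ℕ} (hf : MvPowerSeries.IsHomogeneous f k) :
    homPart k f = f := by
  refine ext_cf fun i j => ?_
  rw [cf_homPart]
  split_ifs with h
  · rfl
  · refine (hf.coeff_eq_zero ?_).symm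
    rw [exponent_degree]
    simpa using h

theorem homPart_of_isHomogeneous_ne {f : FS} {k n : ℕ} (hf : MvPowerSeries.IsHomogeneous f k)
    (h : n ≠ k) : homPart n f = 0 := by
  refine ext_cf fun i j => ?_
  rw [cf_homPart, cf_zero]
  split_ifs with h'
  · refine hf.coeff_eq_zero ?_
    rw [exponent_degree]
    simpa [h'] using h
  · rfl

theorem homPart_eq_zero_of_mem {f : FS} {k n : ℕ} (hf : f ∈ Ord k) (h : n < k) :
    homPart n f = 0 := by
  refine ext_cf fun i j => ?_
  rw [cf_homPart, cf_zero]
  split_ifs with h'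
  · exact hf i j (by omega)
  · rfl

/-! ### Real-linear changes of coordinate -/

/-- Composition with the real-linear map `z = p w + q w̄`. -/
def lin (p q : ℝ → ℂ) (f : FS) : FS := comp (lform p q) (lform (cj q) (cj p)) f

theorem lin_sub (p q : ℝ → ℂ) (f g : FS) : lin p q (f - g) = lin p q f - lin p q g :=
  comp_sub (lform_mem _ _) (lform_mem _ _) _ _

theorem homPart_lin (p q : ℝ → ℂ) (n : ℕ) (f : FS) :
    homPart n (lin p q f) = lin p q (homPart n f) :=
  homPart_comp_lform _ _ _ _ _ _

theorem comp_lform {φ ψ : FS} (hφ : φ ∈ Ord 1) (hψ : ψ ∈ Ord 1) (a b : ℝ → ℂ) :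
    comp φ ψ (lform a b) = fn a * φ + fn b * ψ := by
  rw [lform, comp_add hφ hψ, comp_mul hφ hψ, comp_mul hφ hψ, comp_fn, comp_fn, comp_Zv hφ hψ,
    comp_Zb hφ hψ]

theorem lin_lin (p q p' q' : ℝ → ℂ) (f : FS) :
    lin p' q' (lin p q f) = lin (p * p' + q * cj q') (p * q' + q * cj p') f := by
  rw [lin, lin, comp_comp (lform_mem _ _) (lform_mem _ _) (lform_mem _ _) (lform_mem _ _),
    comp_lform (lform_mem _ _) (lform_mem _ _), comp_lform (lform_mem _ _) (lform_mem _ _), lin]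
  congr 1
  · simp only [lform, fn_add, fn_mul]; ring
  · simp only [lform, fn_add, fn_mul, map_add, map_mul, cj_cj]; ring

theorem lin_mem_smoothFS {p q : ℝ → ℂ} (hp : ContDiff ℝ ∞ p) (hq : ContDiff ℝ ∞ q) {f : FS}
    (hf : IsSmooth f) (n : ℕ) : homPart n (lin p q f) ∈ smoothFS := by
  rw [lin, homPart_comp_lform_eq_sum]
  refine sum_mem fun x _ => mul_mem (mul_mem (fn_mem_smoothFS (hf _)) (pow_mem ?_ _)) (pow_mem ?_ _)
  · exact lform_mem_smoothFS hp hq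
  · exact lform_mem_smoothFS (contDiff_cj hq) (contDiff_cj hp)

theorem isReal_homPart_lin (p q : ℝ → ℂ) {f : FS} (hf : IsReal f) (n : ℕ) :
    IsReal (homPart n (lin p q f)) := by
  rw [isReal_iff] at hf ⊢
  rw [lin, homPart_comp_lform_eq_sum, map_sum, ← Finset.Nat.sum_antidiagonal_swap]
  refine Finset.sum_congr rfl fun x _ => ?_
  rw [map_mul, map_mul, map_pow, map_pow, conjFS_lform, conjFS_lform, conjFS_fn, cj_cj, cj_cj,
    Prod.fst_swap, Prod.snd_swap, ← cf_conjFS, hf]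
  ring

theorem shift_homPart_lin {p q : ℝ → ℂ} {T : ℝ} {σ : ℝ} (hp : ∀ s, p (s + T) = σ * p s)
    (hq : ∀ s, q (s + T) = σ * q s) {f : FS} (hf : IsPeriodic T f) (n : ℕ) :
    shift T (homPart n (lin p q f)) = cst ((σ : ℂ) ^ n) * homPart n (lin p q f) := by
  have hσ : ∀ k : ℕ, (cst ((σ : ℂ) ^ k)) = (cst σ) ^ k := by
    intro k
    rw [cst, cst, ← fn_pow]; rfl
  have h1 : shift T (lform p q) = cst σ * lform p q := by
    have e1 : (fun s => p (s + T)) = (fun _ => (σ : ℂ)) * p := funext hp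
    have e2 : (fun s => q (s + T)) = (fun _ => (σ : ℂ)) * q := funext hq
    rw [lform, map_add, map_mul, map_mul, shift_fn, shift_fn, shift_Zv, shift_Zb, e1, e2, fn_mul,
      fn_mul, cst]
    ring
  have h2 : shift T (lform (cj q) (cj p)) = cst σ * lform (cj q) (cj p) := by
    have e1 : (fun s => cj p (s + T)) = (fun _ => (σ : ℂ)) * cj p := by
      funext s; simp [hp]
    have e2 : (fun s => cj q (s + T)) = (fun _ => (σ : ℂ)) * cj q := by
      funext s; simp [hq]
    rw [lform, map_add, map_mul, map_mul, shift_fn, shift_fn, shift_Zv, shift_Zb, e1, e2, fn_mul,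
      fn_mul, cst]
    ring
  rw [lin, homPart_comp_lform_eq_sum, map_sum, Finset.mul_sum]
  refine Finset.sum_congr rfl fun x hx => ?_
  have hx : x.1 + x.2 = n := by simpa using hx
  have h3 : (fun s => cf f x.1 x.2 (s + T)) = cf f x.1 x.2 := funext (hf _)
  rw [map_mul, map_mul, map_pow, map_pow, h1, h2, shift_fn, h3, hσ, ← hx]
  ring

theorem ds_lform (a b : ℝ → ℂ) : ds (lform a b) = lform (deriv a) (deriv b) := by
  refine ext_cf fun i j => ?_
  have h0 : deriv (0 : ℝ → ℂ) = 0 := by funext s; simp [Pi.zero_def]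
  rw [cf_ds]
  simp only [lform, cf_add, cf_fn_mul, cf_Zv, cf_Zb]
  by_cases h1 : i = 1 ∧ j = 0
  · simp [h1]
  · by_cases h2 : i = 0 ∧ j = 1
    · simp [h2]
    · simp [h1, h2, h0]

theorem dZ_lform (a b : ℝ → ℂ) : dZ (lform a b) = fn a := by
  simp [dZ, lform, fn, Zv, Zb]

theorem dZb_lform (a b : ℝ → ℂ) : dZb (lform a b) = fn b := by
  simp [dZb, lform, fn, Zv, Zb]

/-- The quadratic form that a real-linear change of coordinate subtracts from the Hamiltonian: the
`ds`-component of the pullback of `(1 / 4i) (z dz̄ - z̄ dz)`. -/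
def drift (p q : ℝ → ℂ) : FS :=
  cst (1 / (4 * Complex.I)) * (lform p q * lform (deriv (cj q)) (deriv (cj p))
    - lform (cj q) (cj p) * lform (deriv p) (deriv q))

theorem isHomogeneous_drift (p q : ℝ → ℂ) : MvPowerSeries.IsHomogeneous (drift p q) 2 := by
  have e : drift p q = fn (fun _ => (1 / (4 * Complex.I))) *
      (lform p q * lform (deriv (cj q)) (deriv (cj p))
        + lform (cj q) (cj p) * lform (-deriv p) (-deriv q)) := by
    rw [drift, cst]
    simp only [lform, fn_neg]
    ring
  rw [e]
  change MvPowerSeries.IsHomogeneous _ (0 + (1 + 1))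
  exact MvPowerSeries.IsHomogeneous.mul (isHomogeneous_fn _) (MvPowerSeries.IsHomogeneous.add
    (MvPowerSeries.IsHomogeneous.mul (isHomogeneous_lform _ _) (isHomogeneous_lform _ _))
    (MvPowerSeries.IsHomogeneous.mul (isHomogeneous_lform _ _) (isHomogeneous_lform _ _)))

/-- A canonical real-linear change of coordinate preserves the Liouville form. -/
theorem linPullback_liouville {p q : ℝ → ℂ} (h : p * cj p - q * cj q = 1) (H : FS) :
    linPullback p q (liouville H) = liouville (lin p q H - drift p q) := by
  have hφ := lform_mem p q
  have hψ := lform_mem (cj q) (cj p)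
  have h' : fn p * fn (cj p) - fn q * fn (cj q) = 1 := by
    rw [← fn_mul, ← fn_mul, ← fn_sub, h, fn_one]
  have key : linPullback p q (liouville H)
      = pullback (lform p q) (lform (cj q) (cj p)) (liouville H) := rfl
  have ea : comp (lform p q) (lform (cj q) (cj p)) (liouville H).a
      = -(cst (1 / (4 * Complex.I)) * lform (cj q) (cj p)) := by
    rw [liouville, comp_neg hφ hψ, comp_mul hφ hψ, comp_Zb hφ hψ, cst, comp_fn]
  have eb : comp (lform p q) (lform (cj q) (cj p)) (liouville H).b
      = cst (1 / (4 * Complex.I)) * lform p q := by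
    rw [liouville, comp_mul hφ hψ, comp_Zv hφ hψ, cst, comp_fn]
  have ec : comp (lform p q) (lform (cj q) (cj p)) (liouville H).c = -lin p q H := by
    rw [liouville, comp_neg hφ hψ, lin]
  rw [key]
  ext1
  · simp only [pullback]
    rw [ea, eb, dZ_lform, dZ_lform]
    simp only [liouville, lform]
    linear_combination (-(cst (1 / (4 * Complex.I)) * Zb)) * h'
  · simp only [pullback]
    rw [ea, eb, dZb_lform, dZb_lform]
    simp only [liouville, lform]
    linear_combination (cst (1 / (4 * Complex.I)) * Zv) * h'
  · simp only [pullback]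
    rw [ea, eb, ec, ds_lform, ds_lform]
    simp only [liouville, drift]
    ring

/-- The quadratic formal function `a z z̄ - C z² - C̄ z̄²`. -/
def quad (a C : ℝ → ℂ) : FS := fn a * Zv * Zb - fn C * Zv ^ 2 - fn (cj C) * Zb ^ 2

theorem deriv_cj {p p' : ℝ → ℂ} (hp : ∀ s, HasDerivAt p (p' s) s) : deriv (cj p) = cj p' := by
  funext s
  have := (Complex.conjCLE.hasFDerivAt (x := p s)).comp_hasDerivAt s (hp s)
  exact this.deriv

/-- The transformation law of a real quadratic Hamiltonian under a canonical real-linear change of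
coordinate. -/
theorem lin_quad_sub_drift {p q p' q' a C a₁ C₁ : ℝ → ℂ} (hp : ∀ s, HasDerivAt p (p' s) s)
    (hq : ∀ s, HasDerivAt q (q' s) s) (ha : cj a = a)
    (h1 : ∀ s, a s * (p s * conj (p s) + q s * conj (q s)) - 2 * C s * p s * q s
      - 2 * conj (C s) * conj (p s) * conj (q s)
      - 1 / (4 * Complex.I) * (p s * conj (p' s) + q s * conj (q' s) - conj (q s) * q' s
        - conj (p s) * p' s) = a₁ s)
    (h2 : ∀ s, a s * p s * conj (q s) - C s * p s ^ 2 - conj (C s) * conj (q s) ^ 2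
      - 1 / (4 * Complex.I) * (p s * conj (q' s) - conj (q s) * p' s) = -C₁ s) :
    lin p q (quad a C) - drift p q = quad a₁ C₁ := by
  have hφ := lform_mem p q
  have hψ := lform_mem (cj q) (cj p)
  have dp : deriv p = p' := funext fun s => (hp s).deriv
  have dq : deriv q = q' := funext fun s => (hq s).deriv
  set e : ℝ → ℂ := fun _ => 1 / (4 * Complex.I) with he
  have hce : cj e = -e := by
    funext s
    simp only [he, cj_apply, Pi.neg_apply, map_div₀, map_mul, map_one, Complex.conj_I]
    rw [map_ofNat]
    field_simp
  have e1 : a * (p * cj p + q * cj q) - 2 * C * p * q - 2 * cj C * cj p * cj q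
      - e * (p * cj p' + q * cj q' - cj q * q' - cj p * p') = a₁ := funext h1
  have e2 : a * p * cj q - C * p ^ 2 - cj C * cj q ^ 2 - e * (p * cj q' - cj q * p') = -C₁ :=
    funext h2
  have e3 := congrArg cj e2
  simp only [map_sub, map_mul, map_neg, map_pow, cj_cj, ha, hce] at e3
  rw [quad, quad, ← e1]
  have f2 : fn C₁ = -fn (a * p * cj q - C * p ^ 2 - cj C * cj q ^ 2
      - e * (p * cj q' - cj q * p')) := by rw [e2, fn_neg, neg_neg]
  have f3 : fn (cj C₁) = -fn (a * cj p * q - cj C * cj p ^ 2 - C * q ^ 2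
      - -e * (cj p * q' - q * cj p')) := by rw [e3, fn_neg, neg_neg]
  rw [f2, f3, lin, comp_sub hφ hψ, comp_sub hφ hψ, comp_mul hφ hψ, comp_mul hφ hψ,
    comp_mul hφ hψ, comp_mul hφ hψ, comp_pow hφ hψ, comp_pow hφ hψ, comp_Zv hφ hψ, comp_Zb hφ hψ,
    comp_fn, comp_fn, comp_fn, drift, deriv_cj hp, deriv_cj hq, dp, dq, cst, ← he]
  have two : fn 2 = 2 := map_ofNat _ 2
  simp only [fn_sub, fn_add, fn_mul, fn_neg, fn_pow, lform, two]
  ring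

/-! ### The Beltrami equations order by order -/

theorem cf_mul_Zv_succ (f : FS) (i j : ℕ) : cf (f * Zv) (i + 1) j = cf f i j := by
  have h : (Finsupp.single 0 (i + 1) + Finsupp.single 1 j : Fin 2 →₀ ℕ)
      = (Finsupp.single 0 i + Finsupp.single 1 j) + Finsupp.single 0 1 := by
    rw [Finsupp.single_add]; abel
  rw [cf, h, Zv, MvPowerSeries.X_def, MvPowerSeries.coeff_add_mul_monomial, mul_one, cf]

theorem cf_mul_Zb_succ (f : FS) (i j : ℕ) : cf (f * Zb) i (j + 1) = cf f i j := by
  have h : (Finsupp.single 0 i + Finsupp.single 1 (j + 1) : Fin 2 →₀ ℕ)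
      = (Finsupp.single 0 i + Finsupp.single 1 j) + Finsupp.single 1 1 := by
    rw [Finsupp.single_add]; abel
  rw [cf, h, Zb, MvPowerSeries.X_def, MvPowerSeries.coeff_add_mul_monomial, mul_one, cf]

theorem cf_mul_Zv_zero (f : FS) (j : ℕ) : cf (f * Zv) 0 j = 0 := by
  classical
  rw [cf, Zv, MvPowerSeries.X_def, MvPowerSeries.coeff_mul_monomial, if_neg]
  intro h
  simpa using h 0

theorem cf_mul_Zb_zero (f : FS) (i : ℕ) : cf (f * Zb) i 0 = 0 := by
  classical
  rw [cf, Zb, MvPowerSeries.X_def, MvPowerSeries.coeff_mul_monomial, if_neg]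
  intro h
  simpa using h 1

theorem cf_cst_mul (c : ℂ) (f : FS) (i j : ℕ) : cf (cst c * f) i j = (fun _ => c) * cf f i j :=
  cf_fn_mul _ _ _ _

theorem cst_mul_mem {n : ℕ} (c : ℂ) {f : FS} (hf : f ∈ Ord n) : cst c * f ∈ Ord n :=
  Ideal.mul_mem_left _ _ hf

theorem cst_mul_cst (a b : ℂ) : cst a * cst b = cst (a * b) := (fn_mul _ _).symm

theorem cst_one : cst 1 = 1 := fn_one

theorem cf_metricH (κ : ℝ → ℂ) : cf (metricH κ) 0 0 = 1 := by
  simp [cf_zero_zero, metricH, Zv, Zb]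

/-- The inverse of the metric coefficient. -/
def invH (κ : ℝ → ℂ) : FS := MvPowerSeries.invOfUnit (metricH κ) 1

theorem metricH_mul_invH (κ : ℝ → ℂ) : metricH κ * invH κ = 1 :=
  MvPowerSeries.mul_invOfUnit _ _ (by rw [← cf_zero_zero, cf_metricH]; rfl)

theorem invH_sub_one_mem (κ : ℝ → ℂ) : invH κ - 1 ∈ Ord 1 := by
  rw [mem_Ord_one]
  have h := congrArg (fun f => cf f 0 0) (metricH_mul_invH κ)
  simp only [cf_zero_zero_mul, cf_metricH, one_mul] at h
  rw [cf_sub, h, sub_self]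

theorem dZ_sub (f g : FS) : dZ (f - g) = dZ f - dZ g := map_sub _ _ _
theorem dZb_sub (f g : FS) : dZb (f - g) = dZb f - dZb g := map_sub _ _ _

section
variable {κ : ℝ → ℂ} {k : ℝ} {αs αu αs' αu' : FS}

theorem starD_a (κ : ℝ → ℂ) (θ : OneForm) :
    (starD κ θ).a = cst Complex.I * invH κ * (dZ θ.c - ds θ.a) := rfl

theorem starD_b (κ : ℝ → ℂ) (θ : OneForm) :
    (starD κ θ).b = -(cst Complex.I * invH κ * (dZb θ.c - ds θ.b)) := rfl

theorem starD_c (κ : ℝ → ℂ) (θ : OneForm) :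
    (starD κ θ).c = cst (2 * Complex.I) * metricH κ * (dZb θ.a - dZ θ.b) := rfl

theorem dZ_of_beltrami {θ : OneForm} (h : starD κ θ = k • θ) :
    dZ θ.c = ds θ.a - cst (Complex.I * k) * metricH κ * θ.a := by
  have h1 : cst Complex.I * invH κ * (dZ θ.c - ds θ.a) = cst k * θ.a := congrArg OneForm.a h
  have h2 := metricH_mul_invH κ
  have h3 : cst Complex.I * cst Complex.I = -1 := by
    rw [cst_mul_cst, Complex.I_mul_I, ← cst_one]; exact fn_neg _
  rw [← cst_mul_cst]
  linear_combination (-cst Complex.I * metricH κ) * h1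
    + (metricH κ * invH κ * (dZ θ.c - ds θ.a)) * h3
    - (dZ θ.c - ds θ.a) * h2

theorem dZb_of_beltrami {θ : OneForm} (h : starD κ θ = k • θ) :
    dZb θ.c = ds θ.b + cst (Complex.I * k) * metricH κ * θ.b := by
  have h1 : -(cst Complex.I * invH κ * (dZb θ.c - ds θ.b)) = cst k * θ.b := congrArg OneForm.b h
  have h2 := metricH_mul_invH κ
  have h3 : cst Complex.I * cst Complex.I = -1 := by
    rw [cst_mul_cst, Complex.I_mul_I, ← cst_one]; exact fn_neg _
  rw [← cst_mul_cst]
  linear_combination (cst Complex.I * metricH κ) * h1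
    + (metricH κ * invH κ * (dZb θ.c - ds θ.b)) * h3
    - (dZb θ.c - ds θ.b) * h2

theorem curl_of_beltrami {θ : OneForm} (h : starD κ θ = k • θ) :
    cst 2 * (dZb θ.a - dZ θ.b) = -(cst (Complex.I * k) * invH κ * θ.c) := by
  have h1 : cst (2 * Complex.I) * metricH κ * (dZb θ.a - dZ θ.b) = cst k * θ.c :=
    congrArg OneForm.c h
  have h2 := metricH_mul_invH κ
  have h3 : cst Complex.I * cst Complex.I = -1 := by
    rw [cst_mul_cst, Complex.I_mul_I, ← cst_one]; exact fn_neg _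
  rw [← cst_mul_cst] at h1 ⊢
  linear_combination (-cst Complex.I * invH κ) * h1
    + (metricH κ * invH κ * cst 2 * (dZb θ.a - dZ θ.b)) * h3
    - (cst 2 * (dZb θ.a - dZ θ.b)) * h2

theorem potential_a_sub_mem {m : ℕ} (h : αu - αu' ∈ Ord m) :
    (potential αs αu).a - (potential αs' αu').a ∈ Ord (m + 1) := by
  have e : (potential αs αu).a - (potential αs' αu').a
      = cst (1 / (4 * Complex.I)) * ((αu - αu') * Zb) := by
    simp only [potential]; ring
  rw [e]
  exact cst_mul_mem _ (Ord_mul h Zb_mem)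

theorem potential_b_sub_mem {m : ℕ} (h : αu - αu' ∈ Ord m) :
    (potential αs αu).b - (potential αs' αu').b ∈ Ord (m + 1) := by
  have e : (potential αs αu).b - (potential αs' αu').b
      = cst (1 / (4 * Complex.I)) * (-(αu - αu') * Zv) := by
    simp only [potential]; ring
  rw [e]
  exact cst_mul_mem _ (Ord_mul (neg_mem h) Zv_mem)

/-- The field component along the axis determines the second component of the potential. -/
theorem cf_invH_mul_starD_c (αs αu : FS) (i j : ℕ) :
    cf (invH κ * (starD κ (potential αs αu)).c) i j
      = (fun _ => ((i : ℂ) + j + 2) / 2) * cf αu i j := by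
  have h2 := metricH_mul_invH κ
  have e : invH κ * (starD κ (potential αs αu)).c = cst (2 * Complex.I) *
      (dZb (potential αs αu).a - dZ (potential αs αu).b) := by
    rw [starD_c]
    linear_combination
      (cst (2 * Complex.I) * (dZb (potential αs αu).a - dZ (potential αs αu).b)) * h2
  rw [e, cf_cst_mul, cf_sub, cf_dZb, cf_dZ]
  simp only [potential, cf_neg, cf_cst_mul, cf_mul_Zv_succ, cf_mul_Zb_succ]
  funext s
  simp only [Pi.mul_apply, Pi.sub_apply, Pi.neg_apply, Pi.add_apply, Pi.natCast_apply,
    Pi.one_apply]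
  field_simp [Complex.I_ne_zero]
  ring

theorem sub_mem_of_starD_c {m : ℕ}
    (h : (starD κ (potential αs αu)).c - (starD κ (potential αs' αu')).c ∈ Ord m) :
    αu - αu' ∈ Ord m := by
  intro i j hij
  have h1 := Ideal.mul_mem_left _ (invH κ) h i j hij
  rw [mul_sub, cf_sub, cf_invH_mul_starD_c, cf_invH_mul_starD_c, ← mul_sub, ← cf_sub] at h1
  funext s
  have h2 := congrFun h1 s
  simp only [Pi.mul_apply, Pi.zero_apply, mul_eq_zero] at h2
  refine h2.resolve_left ?_
  refine div_ne_zero ?_ two_ne_zero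
  exact_mod_cast Nat.succ_ne_zero (i + j + 1)

theorem starD_c_sub_mem {m : ℕ} (h : αu - αu' ∈ Ord m) :
    (starD κ (potential αs αu)).c - (starD κ (potential αs' αu')).c ∈ Ord m := by
  have e : (starD κ (potential αs αu)).c - (starD κ (potential αs' αu')).c
      = cst (2 * Complex.I) * metricH κ *
        (dZb ((potential αs αu).a - (potential αs' αu').a)
          - dZ ((potential αs αu).b - (potential αs' αu').b)) := by
    rw [starD_c, starD_c, dZ_sub, dZb_sub]; ring
  rw [e]
  exact Ideal.mul_mem_left _ _
    (sub_mem (dZb_mem (potential_a_sub_mem h)) (dZ_mem (potential_b_sub_mem h)))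

theorem starD_a_sub_mem {m : ℕ} (hs : αs - αs' ∈ Ord (m + 1)) (hu : αu - αu' ∈ Ord m) :
    (starD κ (potential αs αu)).a - (starD κ (potential αs' αu')).a
      - cst Complex.I * dZ (αs - αs') ∈ Ord (m + 1) := by
  have e : (starD κ (potential αs αu)).a - (starD κ (potential αs' αu')).a
      - cst Complex.I * dZ (αs - αs')
      = cst Complex.I * ((invH κ - 1) * dZ (αs - αs')
        - invH κ * (ds (potential αs αu).a - ds (potential αs' αu').a)) := by
    rw [starD_a, starD_a, dZ_sub]
    simp only [potential]
    ring
  rw [e]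
  refine cst_mul_mem _ (sub_mem ?_ ?_)
  · rw [add_comm m 1]
    exact Ord_mul (invH_sub_one_mem κ) (dZ_mem hs)
  · exact Ideal.mul_mem_left _ _ (ds_sub_mem (potential_a_sub_mem hu))

theorem starD_b_sub_mem {m : ℕ} (hs : αs - αs' ∈ Ord (m + 1)) (hu : αu - αu' ∈ Ord m) :
    (starD κ (potential αs αu)).b - (starD κ (potential αs' αu')).b
      + cst Complex.I * dZb (αs - αs') ∈ Ord (m + 1) := by
  have e : (starD κ (potential αs αu)).b - (starD κ (potential αs' αu')).b
      + cst Complex.I * dZb (αs - αs')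
      = -(cst Complex.I * ((invH κ - 1) * dZb (αs - αs')
        - invH κ * (ds (potential αs αu).b - ds (potential αs' αu').b))) := by
    rw [starD_b, starD_b, dZb_sub]
    simp only [potential]
    ring
  rw [e]
  refine neg_mem (cst_mul_mem _ (sub_mem ?_ ?_))
  · rw [add_comm m 1]
    exact Ord_mul (invH_sub_one_mem κ) (dZb_mem hs)
  · exact Ideal.mul_mem_left _ _ (ds_sub_mem (potential_b_sub_mem hu))

/-- The two transversal Beltrami equations: if the first components of two potentials agree below
degree `m + 1` and the second ones below degree `m`, then the second ones agree below degree
`m + 1`. -/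
theorem second_component_agree {m : ℕ}
    (h : starD κ (starD κ (potential αs αu)) = k • starD κ (potential αs αu))
    (h' : starD κ (starD κ (potential αs' αu')) = k • starD κ (potential αs' αu'))
    (h0 : cf (starD κ (potential αs αu)).c 0 0 = cf (starD κ (potential αs' αu')).c 0 0)
    (hs : αs - αs' ∈ Ord (m + 1)) (hu : αu - αu' ∈ Ord m) : αu - αu' ∈ Ord (m + 1) := by
  have ha : (starD κ (potential αs αu)).a - (starD κ (potential αs' αu')).a ∈ Ord m := by
    have := add_mem (Ord_mono (Nat.le_succ m) (starD_a_sub_mem (κ := κ) hs hu))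
      (cst_mul_mem Complex.I (dZ_mem hs))
    rwa [sub_add_cancel] at this
  have hb : (starD κ (potential αs αu)).b - (starD κ (potential αs' αu')).b ∈ Ord m := by
    have := sub_mem (Ord_mono (Nat.le_succ m) (starD_b_sub_mem (κ := κ) hs hu))
      (cst_mul_mem Complex.I (dZb_mem hs))
    rwa [add_sub_cancel_right] at this
  refine sub_mem_of_starD_c (κ := κ) (αs := αs) (αs' := αs') (mem_Ord_succ_of_derivatives ?_ ?_ ?_)
  · rw [cf_sub, h0, sub_self]
  · rw [dZ_sub, dZ_of_beltrami h, dZ_of_beltrami h', sub_sub_sub_comm, ← mul_sub]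
    exact sub_mem (ds_sub_mem ha) (Ideal.mul_mem_left _ _ ha)
  · rw [dZb_sub, dZb_of_beltrami h, dZb_of_beltrami h', add_sub_add_comm, ← mul_sub]
    exact add_mem (ds_sub_mem hb) (Ideal.mul_mem_left _ _ hb)

/-- The Beltrami equation along the axis is a Laplace equation for the first component, which
determines it in degree `m + 1` up to the pure powers of the two variables. -/
theorem first_component_mixed {m : ℕ}
    (h : starD κ (starD κ (potential αs αu)) = k • starD κ (potential αs αu))
    (h' : starD κ (starD κ (potential αs' αu')) = k • starD κ (potential αs' αu'))
    (hs : αs - αs' ∈ Ord (m + 1)) (hu : αu - αu' ∈ Ord m) {i j : ℕ} (hij : i + j < m) :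
    cf (αs - αs') (i + 1) (j + 1) = 0 := by
  have h1 := dZb_mem (starD_a_sub_mem (κ := κ) hs hu)
  have h2 := dZ_mem (starD_b_sub_mem (κ := κ) hs hu)
  have h3 : cst 2 * ((dZb (starD κ (potential αs αu)).a - dZ (starD κ (potential αs αu)).b)
      - (dZb (starD κ (potential αs' αu')).a - dZ (starD κ (potential αs' αu')).b)) ∈ Ord m := by
    rw [mul_sub, curl_of_beltrami h, curl_of_beltrami h', neg_sub_neg, ← mul_sub]
    exact Ideal.mul_mem_left _ _ (by
      have := neg_mem (starD_c_sub_mem (κ := κ) (αs := αs) (αs' := αs') hu)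
      rwa [neg_sub] at this)
  have h3 := h3 i j hij
  have h1 := h1 i j hij
  have h2 := h2 i j hij
  simp only [cf_dZ, cf_dZb, cf_sub, cf_add, cf_cst_mul] at h1 h2 h3
  funext s
  have h1 := congrFun h1 s
  have h2 := congrFun h2 s
  have h3 := congrFun h3 s
  simp only [Pi.mul_apply, Pi.sub_apply, Pi.add_apply, Pi.natCast_apply, Pi.one_apply,
    Pi.zero_apply] at h1 h2 h3
  have h4 : (Complex.I * (((i : ℂ) + 1) * (j + 1))) *
      (cf αs (i + 1) (j + 1) s - cf αs' (i + 1) (j + 1) s) = 0 := by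
    linear_combination (-1 / 2 : ℂ) * h1 + (1 / 2 : ℂ) * h2 + (1 / 4 : ℂ) * h3
  rw [cf_sub]
  refine (mul_eq_zero.1 h4).resolve_left ?_
  refine mul_ne_zero Complex.I_ne_zero (mul_ne_zero ?_ ?_)
  · exact_mod_cast Nat.succ_ne_zero i
  · exact_mod_cast Nat.succ_ne_zero j

/-- The coefficient of `u ū` in the first component of a potential. -/
theorem first_component_one_one
    (h : starD κ (starD κ (potential αs αu)) = k • starD κ (potential αs αu))
    (hs : αs ∈ Ord 2) : cf αs 1 1 = (fun _ => -(k : ℂ) / 4) * cf αu 0 0 := by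
  have h0 : ds (0 : FS) = 0 := by
    refine ext_cf fun i j => ?_
    rw [cf_ds, cf_zero]
    funext s
    simp [Pi.zero_def]
  have z : ∀ f : FS, potential f 0 = ⟨0, 0, f⟩ := by
    intro f; simp [potential]
  have ha : (starD κ (potential αs αu)).a
      - cst Complex.I * (dZ αs - ds (potential αs αu).a) ∈ Ord 2 := by
    have e : (starD κ (potential αs αu)).a - cst Complex.I * (dZ αs - ds (potential αs αu).a)
        = cst Complex.I * ((invH κ - 1) * (dZ αs - ds (potential αs αu).a)) := by
      rw [starD_a]; simp only [potential]; ring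
    rw [e]
    refine cst_mul_mem _ (Ord_mul (invH_sub_one_mem κ) (sub_mem (dZ_mem hs) ?_))
    have := ds_sub_mem (potential_a_sub_mem (αs := αs) (αs' := 0) (αu' := 0) (Ord_zero (αu - 0)))
    rwa [z, h0, sub_zero] at this
  have hb : (starD κ (potential αs αu)).b
      + cst Complex.I * (dZb αs - ds (potential αs αu).b) ∈ Ord 2 := by
    have e : (starD κ (potential αs αu)).b + cst Complex.I * (dZb αs - ds (potential αs αu).b)
        = -(cst Complex.I * ((invH κ - 1) * (dZb αs - ds (potential αs αu).b))) := by
      rw [starD_b]; simp only [potential]; ring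
    rw [e]
    refine neg_mem
      (cst_mul_mem _ (Ord_mul (invH_sub_one_mem κ) (sub_mem (dZb_mem hs) ?_)))
    have := ds_sub_mem (potential_b_sub_mem (αs := αs) (αs' := 0) (αu' := 0) (Ord_zero (αu - 0)))
    rwa [z, h0, sub_zero] at this
  have h1 := congrArg (fun f => cf f 0 0) (curl_of_beltrami h)
  have hc := cf_invH_mul_starD_c (κ := κ) αs αu 0 0
  simp only [mul_assoc, cf_neg, cf_cst_mul, cf_sub, cf_dZ, cf_dZb, hc] at h1
  have ha := ha 0 1 (by norm_num)
  have hb := hb 1 0 (by norm_num)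
  have ea : cf (potential αs αu).a 0 1 = (fun _ => 1 / (4 * Complex.I)) * cf αu 0 0 := by
    simp only [potential, cf_cst_mul]
    rw [cf_mul_Zb_succ αu 0 0]
  have eb : cf (potential αs αu).b 1 0 = -((fun _ => 1 / (4 * Complex.I)) * cf αu 0 0) := by
    simp only [potential, cf_neg, cf_cst_mul]
    rw [cf_mul_Zv_succ αu 0 0]
  simp only [cf_sub, cf_add, cf_cst_mul, cf_dZ, cf_dZb, cf_ds, ea, eb] at ha hb
  funext s
  have h1 := congrFun h1 s
  have ha := congrFun ha s
  have hb := congrFun hb s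
  rw [deriv.neg'] at hb
  simp only [Pi.mul_apply, Pi.sub_apply, Pi.add_apply, Pi.neg_apply,
    Pi.zero_apply, Nat.cast_zero, zero_add, mul_one] at h1 ha hb ⊢
  have hI := Complex.I_mul_I
  linear_combination (-Complex.I / 4) * h1 + (Complex.I / 2) * ha - (Complex.I / 2) * hb
    + (cf αs 1 1 s + (k / 4) * cf αu 0 0 s) * hI

end

/-! ### The near-axis Hamiltonian of a potential -/

theorem ds_mul_Zv (f : FS) : ds (f * Zv) = ds f * Zv := by
  have h0 : deriv (0 : ℝ → ℂ) = 0 := by funext s; simp [Pi.zero_def]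
  refine ext_cf fun i j => ?_
  rw [cf_ds]
  rcases i with _ | i
  · rw [cf_mul_Zv_zero, cf_mul_Zv_zero, h0]
  · rw [cf_mul_Zv_succ, cf_mul_Zv_succ, cf_ds]

theorem ds_mul_Zb (f : FS) : ds (f * Zb) = ds f * Zb := by
  have h0 : deriv (0 : ℝ → ℂ) = 0 := by funext s; simp [Pi.zero_def]
  refine ext_cf fun i j => ?_
  rw [cf_ds]
  rcases j with _ | j
  · rw [cf_mul_Zb_zero, cf_mul_Zb_zero, h0]
  · rw [cf_mul_Zb_succ, cf_mul_Zb_succ, cf_ds]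

namespace AxisData

variable (D : AxisData)

/-- The phase `e^{iγ}`. -/
def phase (s : ℝ) : ℂ := Complex.exp (D.γ s * Complex.I)

theorem cj_phase : cj D.phase = fun s => Complex.exp (-(D.γ s * Complex.I)) := by
  funext s
  simp [phase, ← Complex.exp_conj]

theorem phase_mul_cj : D.phase * cj D.phase = 1 := by
  rw [cj_phase]
  funext s
  simp [phase, ← Complex.exp_add]

theorem phase_ne_zero (s : ℝ) : D.phase s ≠ 0 := Complex.exp_ne_zero _

theorem cj_phase_ne_zero (s : ℝ) : cj D.phase s ≠ 0 := by
  rw [cj_phase]; exact Complex.exp_ne_zero _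

theorem deriv_phase (s : ℝ) :
    HasDerivAt D.phase (((fun t => (D.τ t : ℂ) * Complex.I) * D.phase) s) s := by
  have h1 : HasDerivAt D.γ (D.τ s) s :=
    ((D.γ_smooth.differentiable (by simp)) s).hasDerivAt
  have h2 := (h1.ofReal_comp.mul_const Complex.I).cexp
  refine h2.congr_deriv ?_
  change Complex.exp (D.γ s * Complex.I) * (D.τ s * Complex.I)
    = D.τ s * Complex.I * Complex.exp (D.γ s * Complex.I)
  ring

theorem toZ_eq (f : FS) : D.toZ f = comp (fn D.phase * Zv) (fn (cj D.phase) * Zb) f := by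
  rw [cj_phase]; rfl

theorem cf_toZ (f : FS) (i j : ℕ) :
    cf (D.toZ f) i j = cf f i j * (D.phase ^ i * cj D.phase ^ j) := by
  rw [toZ_eq, cf_comp_diagonal]

theorem toZ_sub (f g : FS) : D.toZ (f - g) = D.toZ f - D.toZ g := by
  refine ext_cf fun i j => ?_
  rw [cf_sub, cf_toZ, cf_toZ, cf_toZ, cf_sub, sub_mul]

theorem cf_toZ_eq_zero {f : FS} {i j : ℕ} : cf (D.toZ f) i j = 0 ↔ cf f i j = 0 := by
  rw [cf_toZ]
  constructor
  · intro h
    funext s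
    have hs := congrFun h s
    simp only [Pi.mul_apply, Pi.pow_apply, Pi.zero_apply, mul_eq_zero] at hs
    exact hs.resolve_right (not_or.2
      ⟨pow_ne_zero _ (D.phase_ne_zero s), pow_ne_zero _ (D.cj_phase_ne_zero s)⟩)
  · intro h
    rw [h, zero_mul]

theorem toZ_mem {f : FS} {n : ℕ} : D.toZ f ∈ Ord n ↔ f ∈ Ord n :=
  forall₂_congr fun _ _ => imp_congr_right fun _ => D.cf_toZ_eq_zero

/-- `√B₀` as a complex function. -/
def sqrtB (s : ℝ) : ℂ := (Real.sqrt (D.B₀ s) : ℂ)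

theorem sqrtB_sq : D.sqrtB * D.sqrtB = fun s => (D.B₀ s : ℂ) := by
  funext s
  simp only [sqrtB, Pi.mul_apply]
  rw [← Complex.ofReal_mul, Real.mul_self_sqrt (D.B₀_pos s).le]

theorem sqrtB_ne_zero (s : ℝ) : D.sqrtB s ≠ 0 := by
  rw [sqrtB, Complex.ofReal_ne_zero]
  exact (Real.sqrt_pos.2 (D.B₀_pos s)).ne'

variable {D} {αs αu H αs' αu' H' : FS}

/-- The relation between the Hamiltonian and the components of the potential: the coefficients of
`ds` on the two sides of the definition of the Hamiltonian. -/
theorem comp_hamiltonian {S : FS}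
    (h : pullback (Zb * S) (Zv * S) (liouville H) =
      linPullback (fun s => Complex.exp (D.γ s * Complex.I)) 0 (potential αs αu)) :
    comp (Zb * S) (Zv * S) H
      = -D.toZ αs - fn (fun s => (D.τ s : ℂ) / 2) * (Zv * Zb) * D.toZ αu := by
  have hφ : Zb * S ∈ Ord 1 := Ideal.mul_mem_right _ _ Zb_mem
  have hψ : Zv * S ∈ Ord 1 := Ideal.mul_mem_right _ _ Zv_mem
  have hφ' : lform D.phase 0 ∈ Ord 1 := lform_mem _ _
  have hψ' : lform 0 (cj D.phase) ∈ Ord 1 := lform_mem _ _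
  have h1 := congrArg OneForm.c h
  have e1 : (pullback (Zb * S) (Zv * S) (liouville H)).c = -comp (Zb * S) (Zv * S) H := by
    simp only [pullback, liouville]
    rw [comp_neg hφ hψ, comp_neg hφ hψ, comp_mul hφ hψ, comp_mul hφ hψ, comp_Zv hφ hψ,
      comp_Zb hφ hψ, cst, comp_fn, mul_comm Zb, mul_comm Zv, ds_mul_Zb, ds_mul_Zv]
    ring
  have e2 : ∀ f, comp (lform D.phase 0) (lform 0 (cj D.phase)) f = D.toZ f := by
    intro f
    rw [toZ_eq, lform_left, lform_right]
  have e3 : (linPullback (fun s => Complex.exp (D.γ s * Complex.I)) 0 (potential αs αu))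
      = pullback (lform D.phase 0) (lform 0 (cj D.phase)) (potential αs αu) := by
    have : lform 0 (cj D.phase) = lform (cj 0) (cj D.phase) := by rw [map_zero]
    rw [this]
    rfl
  have d1 : deriv D.phase = (fun t => (D.τ t : ℂ) * Complex.I) * D.phase :=
    funext fun s => (D.deriv_phase s).deriv
  have d2 : deriv (cj D.phase) = -(fun t => (D.τ t : ℂ) * Complex.I) * cj D.phase := by
    rw [deriv_cj D.deriv_phase]
    funext s
    simp
  have d3 : deriv (0 : ℝ → ℂ) = 0 := by funext s; simp [Pi.zero_def]
  have hp : fn D.phase * fn (cj D.phase) = 1 := by rw [← fn_mul, phase_mul_cj, fn_one]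
  have hτ : fn (fun s => (D.τ s : ℂ) / 2)
      = cst (1 / (4 * Complex.I)) * (2 * fn (fun t => (D.τ t : ℂ) * Complex.I)) := by
    have two : fn 2 = 2 := map_ofNat _ 2
    rw [← two, cst, ← fn_mul, ← fn_mul]
    congr 1
    funext s
    simp only [Pi.mul_apply, Pi.ofNat_apply]
    field_simp [Complex.I_ne_zero]
    ring
  rw [e1, e3] at h1
  simp only [pullback, potential] at h1
  rw [ds_lform, ds_lform, d1, d2, d3, comp_neg hφ' hψ', comp_mul hφ' hψ', comp_mul hφ' hψ',
    comp_mul hφ' hψ', comp_mul hφ' hψ', comp_Zv hφ' hψ', comp_Zb hφ' hψ', cst, comp_fn, e2, e2,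
    lform_left, lform_left, lform_right, lform_right, fn_mul, fn_mul, fn_neg, ← cst] at h1
  rw [hτ]
  linear_combination -h1 - (cst (1 / (4 * Complex.I)) *
    (2 * fn (fun t => (D.τ t : ℂ) * Complex.I)) * (Zv * Zb) * D.toZ αu) * hp

theorem cf_zero_zero_of_sq {S : FS} (hS : S * S = D.toZ αu) (h0 : cf S 0 0 = D.sqrtB) :
    cf αu 0 0 = fun s => (D.B₀ s : ℂ) := by
  have h := congrArg (fun f => cf f 0 0) hS
  simp only [cf_zero_zero_mul, h0, D.sqrtB_sq, cf_toZ, pow_zero, mul_one] at h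
  exact h.symm

theorem gauge_mem (hp : D.IsPotential αs αu) : αs ∈ Ord 2 := hp.gauge

/-- The leading term of the pullback under the canonical coordinate `Z = z̄ √αz`. -/
theorem cf_comp_leading {S : FS} (h0 : cf S 0 0 = D.sqrtB) {m : ℕ} {f : FS} (hf : f ∈ Ord m)
    {i j : ℕ} (hij : i + j = m) :
    cf (comp (Zb * S) (Zv * S) f) i j = cf f j i * D.sqrtB ^ m := by
  have hφ : Zb * S ∈ Ord 1 := Ideal.mul_mem_right _ _ Zb_mem
  have hψ : Zv * S ∈ Ord 1 := Ideal.mul_mem_right _ _ Zv_mem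
  have hφ' : fn D.sqrtB * Zb ∈ Ord 1 := Ideal.mul_mem_left _ _ Zb_mem
  have hψ' : fn D.sqrtB * Zv ∈ Ord 1 := Ideal.mul_mem_left _ _ Zv_mem
  have hS : S - fn D.sqrtB ∈ Ord 1 := by
    rw [mem_Ord_one, cf_sub, h0, cf_zero_zero (fn _), fn, MvPowerSeries.constantCoeff_C, sub_self]
  have h1 : Zb * S - fn D.sqrtB * Zb ∈ Ord (1 + 1) := by
    have : Zb * S - fn D.sqrtB * Zb = Zb * (S - fn D.sqrtB) := by ring
    rw [this]; exact Ord_mul Zb_mem hS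
  have h2 : Zv * S - fn D.sqrtB * Zv ∈ Ord (1 + 1) := by
    have : Zv * S - fn D.sqrtB * Zv = Zv * (S - fn D.sqrtB) := by ring
    rw [this]; exact Ord_mul Zv_mem hS
  have h3 := comp_sub_comp_mem hφ hφ' hψ hψ' h1 h2 hf i j (by omega)
  rw [cf_sub, sub_eq_zero, cf_comp_antidiagonal, ← pow_add, add_comm j i, hij] at h3
  exact h3

theorem cf_eq_zero_of_leading {S : FS} (h0 : cf S 0 0 = D.sqrtB) {m : ℕ} {f : FS}
    (hf : f ∈ Ord m) {i j : ℕ} (hij : i + j = m) (h : cf (comp (Zb * S) (Zv * S) f) j i = 0) :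
    cf f i j = 0 := by
  rw [cf_comp_leading h0 hf (by omega)] at h
  funext s
  have hs := congrFun h s
  simp only [Pi.mul_apply, Pi.pow_apply, Pi.zero_apply, mul_eq_zero] at hs
  exact hs.resolve_right (pow_ne_zero _ (D.sqrtB_ne_zero s))

theorem mem_Ord_of_leading {S : FS} (h0 : cf S 0 0 = D.sqrtB) {m : ℕ} {f : FS}
    (h : comp (Zb * S) (Zv * S) f ∈ Ord m) : f ∈ Ord m := by
  induction m with
  | zero => exact Ord_zero _
  | succ m ih =>
    have hm := ih (Ord_mono (Nat.le_succ m) h)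
    intro i j hij
    rcases Nat.lt_succ_iff_lt_or_eq.1 hij with hij | hij
    · exact hm i j hij
    · exact cf_eq_zero_of_leading h0 hm hij (h j i (by omega))

theorem hamiltonian_mem (hp : D.IsPotential αs αu) (hH : D.IsHamiltonian αs αu H) : H ∈ Ord 2 := by
  obtain ⟨_, S, hS, h0, h⟩ := hH
  refine mem_Ord_of_leading h0 ?_
  rw [comp_hamiltonian h]
  refine sub_mem (neg_mem (D.toZ_mem.2 (gauge_mem hp))) (Ideal.mul_mem_right _ _
    (Ideal.mul_mem_left _ _ (Ord_mul Zv_mem Zb_mem)))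

/-- The quadratic part of the near-axis Hamiltonian, which generates the leading-order dynamics. -/
theorem homPart_two_hamiltonian (hp : D.IsPotential αs αu) (hH : D.IsHamiltonian αs αu H) :
    homPart 2 H = quad (fun s => ((D.k / 4 - D.τ s / 2 : ℝ) : ℂ)) D.C₂ := by
  have h2 := hamiltonian_mem hp hH
  obtain ⟨⟨_, hreal, _⟩, S, hS, h0, h⟩ := hH
  have hB := cf_zero_zero_of_sq hS h0
  have hB0 : ∀ s, (D.B₀ s : ℂ) ≠ 0 := fun s => Complex.ofReal_ne_zero.2 (D.B₀_pos s).ne'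
  have hrel := comp_hamiltonian h
  have mon : ∀ (a : ℝ → ℂ) (i j k l : ℕ),
      cf (fn a * Zv ^ i * Zb ^ j) k l = if k = i ∧ l = j then a else 0 := cf_monomial
  have hz : fn (fun s => (D.τ s : ℂ) / 2) * (Zv * Zb) * D.toZ αu
      = fn (fun s => (D.τ s : ℂ) / 2) * ((D.toZ αu * Zb) * Zv) := by ring
  have hsq : ∀ s, D.sqrtB s ^ 2 = D.B₀ s := fun s => by
    rw [pow_two]; exact congrFun D.sqrtB_sq s
  have e11 : ∀ s, cf H 1 1 s = D.k / 4 - D.τ s / 2 := by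
    intro s
    have h3 := congrFun (cf_comp_leading (i := 1) (j := 1) h0 h2 rfl) s
    rw [hrel, hz, cf_sub, cf_neg, cf_fn_mul, cf_mul_Zv_succ _ 0 1, cf_mul_Zb_succ _ 0 0, cf_toZ,
      cf_toZ, first_component_one_one hp.beltrami (gauge_mem hp), hB] at h3
    have hph := congrFun D.phase_mul_cj s
    simp only [Pi.mul_apply, Pi.sub_apply, Pi.neg_apply, Pi.pow_apply, pow_one, pow_zero,
      Pi.one_apply, mul_one, hsq] at h3 hph
    rw [hph] at h3
    refine mul_right_cancel₀ (hB0 s) ?_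
    rw [← h3]
    ring
  have e02 : ∀ s, cf H 0 2 s = -(D.A₂ s / D.B₀ s) := by
    intro s
    have h3 := congrFun (cf_comp_leading (i := 2) (j := 0) h0 h2 rfl) s
    rw [hrel, mul_right_comm, mul_comm Zv Zb, ← mul_assoc, cf_sub, cf_neg, hp.quadratic] at h3
    have h4 : cf (fn (fun s => (D.τ s : ℂ) / 2) * D.toZ αu * Zb * Zv) 2 0 = 0 := by
      rw [cf_mul_Zv_succ _ 1 0, cf_mul_Zb_zero]
    rw [h4, sub_zero] at h3
    simp only [Pi.mul_apply, Pi.neg_apply, Pi.pow_apply, hsq] at h3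
    rw [← neg_div, h3, mul_div_cancel_right₀ _ (hB0 s)]
  have e20 : ∀ s, cf H 2 0 s = -D.C₂ s := by
    intro s
    rw [hreal 0 2 s, e02 s, C₂, map_neg, map_div₀, Complex.conj_ofReal]
  have q1 : quad (fun s => ((D.k / 4 - D.τ s / 2 : ℝ) : ℂ)) D.C₂
      = fn (fun s => ((D.k / 4 - D.τ s / 2 : ℝ) : ℂ)) * Zv ^ 1 * Zb ^ 1
        - fn D.C₂ * Zv ^ 2 * Zb ^ 0 - fn (cj D.C₂) * Zv ^ 0 * Zb ^ 2 := by
    rw [quad]; ring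
  refine ext_cf fun i j => ?_
  rw [cf_homPart, q1, cf_sub, cf_sub, mon, mon, mon]
  by_cases h : i + j = 2
  · rw [if_pos h]
    obtain ⟨rfl, rfl⟩ | ⟨rfl, rfl⟩ | ⟨rfl, rfl⟩ :
        (i = 0 ∧ j = 2) ∨ (i = 1 ∧ j = 1) ∨ (i = 2 ∧ j = 0) := by omega
    · funext s
      simp [e02, C₂]
    · funext s
      simp [e11]
    · funext s
      simp [e20]
  · rw [if_neg h, if_neg (by omega), if_neg (by omega), if_neg (by omega)]
    simp

theorem sqrt_sub_mem {S S' : FS} (h0 : cf S 0 0 = D.sqrtB) (h0' : cf S' 0 0 = D.sqrtB) {m : ℕ}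
    (h : S * S - S' * S' ∈ Ord m) : S - S' ∈ Ord m := by
  have hu : IsUnit (S + S') := by
    rw [MvPowerSeries.isUnit_iff_constantCoeff, ← cf_zero_zero, cf_add, h0, h0', Pi.isUnit_iff]
    intro s
    rw [isUnit_iff_ne_zero, Pi.add_apply, ← two_mul]
    exact mul_ne_zero two_ne_zero (D.sqrtB_ne_zero s)
  obtain ⟨v, hv⟩ := hu
  have e : S - S' = (S * S - S' * S') * (v⁻¹ : FSˣ) := by
    have hv' : (S + S') * (v⁻¹ : FSˣ) = 1 := by rw [← hv, Units.mul_inv]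
    linear_combination (-(S - S')) * hv'
  rw [e]
  exact Ideal.mul_mem_right _ _ h

/-- One step of the recursion: if two potentials with the same data, and their Hamiltonians, agree
below degree `m`, then in degree `m` the Hamiltonians can differ by pure powers only, and if these
agree as well, everything agrees below degree `m + 1`. -/
theorem agree_step (hp : D.IsPotential αs αu) (hp' : D.IsPotential αs' αu')
    (hH : D.IsHamiltonian αs αu H) (hH' : D.IsHamiltonian αs' αu' H') {m : ℕ} (hm : 1 ≤ m)
    (hs : αs - αs' ∈ Ord m) (hu : αu - αu' ∈ Ord m) (hHH : H - H' ∈ Ord m) :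
    (∀ i j, i + j = m → 0 < i → 0 < j → cf (H - H') i j = 0) ∧
    (cf (H - H') m 0 = 0 →
      αs - αs' ∈ Ord (m + 1) ∧ αu - αu' ∈ Ord (m + 1) ∧ H - H' ∈ Ord (m + 1)) := by
  have h2 := hamiltonian_mem hp hH
  obtain ⟨⟨_, hreal, _⟩, S, hS, h0, h⟩ := hH
  obtain ⟨⟨_, hreal', _⟩, S', hS', h0', h'⟩ := hH'
  have hφ : Zb * S ∈ Ord 1 := Ideal.mul_mem_right _ _ Zb_mem
  have hψ : Zv * S ∈ Ord 1 := Ideal.mul_mem_right _ _ Zv_mem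
  have hφ' : Zb * S' ∈ Ord 1 := Ideal.mul_mem_right _ _ Zb_mem
  have hψ' : Zv * S' ∈ Ord 1 := Ideal.mul_mem_right _ _ Zv_mem
  have hSS : S - S' ∈ Ord m := by
    refine sqrt_sub_mem h0 h0' ?_
    rw [hS, hS', ← toZ_sub]
    exact D.toZ_mem.2 hu
  have d1 : Zb * S - Zb * S' ∈ Ord (m + 1) := by
    rw [← mul_sub, add_comm m 1]; exact Ord_mul Zb_mem hSS
  have d2 : Zv * S - Zv * S' ∈ Ord (m + 1) := by
    rw [← mul_sub, add_comm m 1]; exact Ord_mul Zv_mem hSS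
  -- Up to terms of degree above `m`, the difference of the Hamiltonians pulls back to the
  -- difference of the first components of the potentials.
  have key : comp (Zb * S') (Zv * S') (H - H') + D.toZ (αs - αs') ∈ Ord (m + 1) := by
    have h3 := Ord_mono (show m + 1 ≤ 2 + m by omega) (comp_sub_comp_mem hφ hφ' hψ hψ' d1 d2 h2)
    have h4 : fn (fun s => (D.τ s : ℂ) / 2) * (Zv * Zb) * D.toZ (αu - αu') ∈ Ord (m + 1) :=
      Ord_mono (show m + 1 ≤ 1 + 1 + m by omega)
        (Ord_mul (Ideal.mul_mem_left _ _ (Ord_mul Zv_mem Zb_mem)) (D.toZ_mem.2 hu))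
    have h5 := neg_mem (add_mem h3 h4)
    have e : comp (Zb * S') (Zv * S') (H - H') + D.toZ (αs - αs')
        = -(comp (Zb * S) (Zv * S) H - comp (Zb * S') (Zv * S') H
          + fn (fun s => (D.τ s : ℂ) / 2) * (Zv * Zb) * D.toZ (αu - αu')) := by
      rw [comp_sub hφ' hψ', comp_hamiltonian h, comp_hamiltonian h', toZ_sub, toZ_sub]
      ring
    rwa [e]
  have lead : ∀ i j, i + j = m → (cf (H - H') i j = 0 ↔ cf (αs - αs') j i = 0) := by
    intro i j hij
    have h3 := key j i (by omega)
    rw [cf_add] at h3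
    constructor
    · intro h4
      rw [cf_comp_leading h0' hHH (by omega), h4, zero_mul, zero_add] at h3
      exact D.cf_toZ_eq_zero.1 h3
    · intro h4
      rw [D.cf_toZ_eq_zero.2 h4, add_zero] at h3
      exact cf_eq_zero_of_leading h0' hHH hij h3
  have mixed : ∀ i j, i + j = m → 0 < i → 0 < j → cf (H - H') i j = 0 := by
    intro i j hij hi hj
    obtain ⟨n, rfl⟩ : ∃ n, m = n + 1 := ⟨m - 1, by omega⟩
    obtain ⟨i, rfl⟩ : ∃ n, i = n + 1 := ⟨i - 1, by omega⟩
    obtain ⟨j, rfl⟩ : ∃ n, j = n + 1 := ⟨j - 1, by omega⟩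
    exact (lead _ _ hij).2 (first_component_mixed hp.beltrami hp'.beltrami hs
      (Ord_mono (Nat.le_succ n) hu) (by omega))
  refine ⟨mixed, fun hpure => ?_⟩
  have hpure' : cf (H - H') 0 m = 0 := by
    funext s
    have h3 := congrFun hpure s
    rw [cf_sub, Pi.sub_apply, Pi.zero_apply] at h3 ⊢
    rw [hreal m 0 s, hreal' m 0 s, ← map_sub, h3, map_zero]
  have hall : ∀ i j, i + j = m → cf (H - H') i j = 0 := by
    intro i j hij
    rcases Nat.eq_zero_or_pos i with rfl | hi
    · rw [zero_add] at hij; rw [hij]; exact hpure'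
    · rcases Nat.eq_zero_or_pos j with rfl | hj
      · rw [add_zero] at hij; rw [hij]; exact hpure
      · exact mixed i j hij hi hj
  have hs' : αs - αs' ∈ Ord (m + 1) := by
    intro i j hij
    rcases Nat.lt_succ_iff_lt_or_eq.1 hij with hij | hij
    · exact hs i j hij
    · exact (lead j i (by omega)).1 (hall j i (by omega))
  refine ⟨hs', second_component_agree hp.beltrami hp'.beltrami ?_ hs' hu, ?_⟩
  · rw [hp.axis_s, hp'.axis_s]
  · intro i j hij
    rcases Nat.lt_succ_iff_lt_or_eq.1 hij with hij | hij
    · exact hHH i j hij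
    · exact hall i j hij

theorem agree_base (hp : D.IsPotential αs αu) (hp' : D.IsPotential αs' αu')
    (hH : D.IsHamiltonian αs αu H) (hH' : D.IsHamiltonian αs' αu' H') :
    αs - αs' ∈ Ord 2 ∧ αu - αu' ∈ Ord 2 ∧ H - H' ∈ Ord 2 := by
  have hs : αs - αs' ∈ Ord 2 := sub_mem (gauge_mem hp) (gauge_mem hp')
  have h0 : cf (starD D.κ (potential αs αu)).c 0 0 = cf (starD D.κ (potential αs' αu')).c 0 0 := by
    rw [hp.axis_s, hp'.axis_s]
  have h1 := second_component_agree hp.beltrami hp'.beltrami h0 (Ord_mono one_le_two hs)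
    (Ord_zero _)
  exact ⟨hs, second_component_agree hp.beltrami hp'.beltrami h0 hs h1,
    sub_mem (hamiltonian_mem hp hH) (hamiltonian_mem hp' hH')⟩

end AxisData

/-! ### The terms of higher degree in Floquet coordinates -/

/-- The part of degree `n + 2` of a formal function without its two pure powers. -/
def mixedPoly (n : ℕ) (K : FS) : MvPolynomial (Fin 2) (ℝ → ℂ) :=
  ∑ x ∈ Finset.HasAntidiagonal.antidiagonal (n + 2) with x.1 ≠ 0 ∧ x.2 ≠ 0,
    MvPolynomial.monomial (Finsupp.single 0 x.1 + Finsupp.single 1 x.2) (cf K x.1 x.2)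

theorem coeff_mixedPoly (n : ℕ) (K : FS) (m : Fin 2 →₀ ℕ) :
    (mixedPoly n K).coeff m
      = if m 0 + m 1 = n + 2 ∧ m 0 ≠ 0 ∧ m 1 ≠ 0 then cf K (m 0) (m 1) else 0 := by
  classical
  rw [mixedPoly, MvPolynomial.coeff_sum]
  simp_rw [MvPolynomial.coeff_monomial]
  have key : ∀ x : ℕ × ℕ, (Finsupp.single 0 x.1 + Finsupp.single 1 x.2 : Fin 2 →₀ ℕ) = m
      ↔ x = (m 0, m 1) := by
    rintro ⟨i, j⟩
    constructor
    · rintro rfl; simp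
    · intro h
      simp only [Prod.mk.injEq] at h
      rw [h.1, h.2]
      exact exponent_eq m
  simp_rw [key, Finset.sum_ite_eq']
  simp

theorem cf_mixedPoly (n : ℕ) (K : FS) (i j : ℕ) :
    cf (mixedPoly n K : FS) i j = if i + j = n + 2 ∧ i ≠ 0 ∧ j ≠ 0 then cf K i j else 0 := by
  rw [cf, MvPolynomial.coeff_coe, coeff_mixedPoly]
  simp

theorem isHomogeneous_mixedPoly (n : ℕ) (K : FS) : (mixedPoly n K).IsHomogeneous (n + 2) := by
  refine MvPolynomial.IsHomogeneous.sum _ _ _ fun x hx => ?_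
  refine MvPolynomial.isHomogeneous_monomial _ ?_
  rw [exponent_degree]
  simpa using (Finset.mem_filter.1 hx).1

theorem cf_lform_pow (a b : ℝ → ℂ) (m : ℕ) : cf (lform a b ^ m) m 0 = a ^ m := by
  induction m with
  | zero => simp [cf_zero_zero]
  | succ m ih =>
    have e : lform a b ^ (m + 1)
        = fn a * (lform a b ^ m * Zv) + fn b * (lform a b ^ m * Zb) := by
      rw [pow_succ]; nth_rewrite 2 [lform]; ring
    rw [e, cf_add, cf_fn_mul, cf_fn_mul, cf_mul_Zv_succ, cf_mul_Zb_zero, ih, mul_zero, add_zero,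
      pow_succ']

/-- A real homogeneous polynomial consisting of two pure powers is determined by either pure power
after a canonical real-linear change of coordinate, since `|p| > |q|`. -/
theorem pure_eq_zero_of_lin {p q : ℝ → ℂ} (hpq : p * cj p - q * cj q = 1) {m : ℕ} (hm : 1 ≤ m)
    {f : FS} (hf : IsReal f) (hmix : ∀ i j, i + j = m → 0 < i → 0 < j → cf f i j = 0)
    (h : cf (lin p q f) m 0 = 0) : cf f m 0 = 0 := by
  rw [lin, cf_comp_lform, add_zero, Finset.sum_eq_add (m, 0) (0, m)] at h
  · simp only [pow_zero, mul_one, one_mul, cf_lform_pow] at h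
    funext s
    have hs := congrFun h s
    have hn := congrFun hpq s
    simp only [Pi.mul_apply, Pi.sub_apply, Pi.one_apply, Pi.add_apply, Pi.pow_apply, cj_apply,
      Complex.mul_conj, Pi.zero_apply] at hs hn ⊢
    rw [hf m 0 s, add_eq_zero_iff_eq_neg] at hs
    have h1 := congrArg norm hs
    rw [norm_mul, norm_neg, norm_mul, norm_pow, norm_pow, Complex.norm_conj, Complex.norm_conj]
      at h1
    by_contra h2
    have h3 := mul_left_cancel₀ (norm_ne_zero_iff.2 h2) h1
    have h4 : ‖p s‖ = ‖q s‖ :=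
      (pow_left_inj₀ (norm_nonneg _) (norm_nonneg _) (by omega)).1 h3
    rw [Complex.normSq_eq_norm_sq, Complex.normSq_eq_norm_sq, h4, sub_self] at hn
    exact zero_ne_one hn
  · intro h; simp only [Prod.mk.injEq] at h; omega
  · rintro ⟨i, j⟩ hij hne
    have hij : i + j = m := by simpa using hij
    simp only [ne_eq, Prod.mk.injEq] at hne
    rw [hmix i j hij (by omega) (by omega), zero_mul]
  · intro h; simp at h
  · intro h; simp at h

namespace AxisData

variable (D : AxisData)

/-- The transformed Hamiltonians `K` of all potentials with the given data for which the pure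
coefficients of degree `3, …, n + 2` are prescribed. -/
def admissible (p q : ℝ → ℂ) (Q : FS) (n : ℕ) (c : ℕ → ℝ → ℂ) : Set FS :=
  {K | ∃ αs αu H, D.IsPotential αs αu ∧ D.IsHamiltonian αs αu H ∧ K = lin p q H - Q ∧
    ∀ j, 1 ≤ j → j ≤ n → cf K (j + 2) 0 = c j}

theorem admissible_congr (p q : ℝ → ℂ) (Q : FS) {n : ℕ} {c c' : ℕ → ℝ → ℂ}
    (h : ∀ j, 1 ≤ j → j ≤ n → c j = c' j) :
    D.admissible p q Q n c = D.admissible p q Q n c' := by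
  have : ∀ K : FS, (∀ j, 1 ≤ j → j ≤ n → cf K (j + 2) 0 = c j)
      ↔ ∀ j, 1 ≤ j → j ≤ n → cf K (j + 2) 0 = c' j := fun K =>
    forall_congr' fun j => forall₂_congr fun h1 h2 => by rw [h j h1 h2]
  simp only [admissible, this]

/-- The free functions determine the transformed Hamiltonian. -/
theorem admissible_agree {p q : ℝ → ℂ} (hpq : p * cj p - q * cj q = 1) {Q : FS} {n : ℕ}
    {c : ℕ → ℝ → ℂ} {K K' : FS} (hK : K ∈ D.admissible p q Q n c)
    (hK' : K' ∈ D.admissible p q Q n c) : K - K' ∈ Ord (n + 3) := by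
  obtain ⟨αs, αu, H, hp, hH, rfl, hc⟩ := hK
  obtain ⟨αs', αu', H', hp', hH', rfl, hc'⟩ := hK'
  have e : lin p q H - Q - (lin p q H' - Q) = lin p q (H - H') := by
    rw [lin_sub]; ring
  have hreal : IsReal (H - H') := by
    have h1 := isReal_iff.1 hH.1.real
    have h2 := isReal_iff.1 hH'.1.real
    rw [isReal_iff, map_sub, h1, h2]
  have key : ∀ m, 2 ≤ m → m ≤ n + 3 →
      αs - αs' ∈ Ord m ∧ αu - αu' ∈ Ord m ∧ H - H' ∈ Ord m := by
    intro m hm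
    induction m, hm using Nat.le_induction with
    | base => exact fun _ => agree_base hp hp' hH hH'
    | succ m hm ih =>
      intro hmn
      obtain ⟨hs, hu, hh⟩ := ih (by omega)
      obtain ⟨hmix, hnext⟩ := agree_step hp hp' hH hH' (by omega) hs hu hh
      refine hnext ?_
      rcases hm.eq_or_lt with rfl | hm3
      · have h1 := congrArg (fun f => cf f 2 0)
          ((homPart_two_hamiltonian hp hH).trans (homPart_two_hamiltonian hp' hH').symm)
        simp only [cf_homPart, add_zero, if_true] at h1
        rw [cf_sub, h1, sub_self]
      · refine pure_eq_zero_of_lin hpq (by omega) hreal hmix ?_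
        obtain ⟨l, rfl⟩ : ∃ l, m = l + 2 := ⟨m - 2, by omega⟩
        rw [← e, cf_sub, hc l (by omega) (by omega), hc' l (by omega) (by omega), sub_self]
  rw [e]
  exact comp_mem (lform_mem _ _) (lform_mem _ _) (key (n + 3) (by omega) le_rfl).2.2

/-- A canonical real-linear change of coordinate that normalizes the quadratic part of the
Hamiltonian brings the Liouville form into the required form in all higher degrees. -/
theorem hasFloquetForm_of_lin {Ψ : OneForm → OneForm} {H₀ Q : FS} {p q : ℝ → ℂ} {σ : ℝ}
    (hpq : p * cj p - q * cj q = 1) (hp : ContDiff ℝ ∞ p) (hq : ContDiff ℝ ∞ q)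
    (hσ : σ ^ 2 = 1) (hpT : ∀ s, p (s + D.T) = σ * p s) (hqT : ∀ s, q (s + D.T) = σ * q s)
    (hQ : MvPowerSeries.IsHomogeneous Q 2)
    (hΨ : ∀ H, Ψ (liouville H) = liouville (lin p q H - Q))
    (h2 : lin p q (quad (fun s => ((D.k / 4 - D.τ s / 2 : ℝ) : ℂ)) D.C₂) - Q = H₀) :
    D.HasFloquetForm Ψ H₀ σ := by
  refine ⟨fun n c => mixedPoly n (Classical.epsilon fun K => K ∈ D.admissible p q Q n c),
    fun n c c' h => by dsimp only; rw [D.admissible_congr p q Q h], ?_⟩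
  intro αs αu H hpot hH
  set K := lin p q H - Q with hK
  have hσ' : ∀ n : ℕ, (σ : ℂ) ^ (n + 2) = (σ : ℂ) ^ n := by
    intro n
    rw [pow_add, ← Complex.ofReal_pow σ 2, hσ, Complex.ofReal_one, mul_one]
  have hH2 := hamiltonian_mem hpot hH
  have hlow : ∀ n, n < 2 → homPart n K = 0 := by
    intro n hn
    rw [hK, homPart_sub, homPart_of_isHomogeneous_ne hQ hn.ne, sub_zero]
    exact homPart_eq_zero_of_mem (comp_mem (lform_mem _ _) (lform_mem _ _) hH2) hn
  have hhigh : ∀ n, 1 ≤ n → homPart (n + 2) K = homPart (n + 2) (lin p q H) := by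
    intro n hn
    rw [hK, homPart_sub, homPart_of_isHomogeneous_ne hQ (by omega), sub_zero]
  refine ⟨K, fun n => cf K (n + 2) 0, hΨ H, hlow 0 two_pos, hlow 1 one_lt_two, ?_, ?_⟩
  · rw [hK, homPart_sub, homPart_of_isHomogeneous hQ, homPart_lin,
      homPart_two_hamiltonian hpot hH, h2]
  intro n hn
  -- The chosen representative of the admissible set has the same terms of degree `n + 2` as `K`.
  have hP : mixedPoly n (Classical.epsilon fun K' =>
      K' ∈ D.admissible p q Q n fun n => cf K (n + 2) 0) = mixedPoly n K := by
    have hKa : K ∈ D.admissible p q Q n fun n => cf K (n + 2) 0 :=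
      ⟨αs, αu, H, hpot, hH, hK, fun _ _ _ => rfl⟩
    have hE := Classical.epsilon_spec (p := fun K' =>
      K' ∈ D.admissible p q Q n fun n => cf K (n + 2) 0) ⟨K, hKa⟩
    have hag := D.admissible_agree hpq hE hKa
    rw [mixedPoly, mixedPoly]
    refine Finset.sum_congr rfl fun x hx => ?_
    have hx : x.1 + x.2 = n + 2 := by simpa using (Finset.mem_filter.1 hx).1
    have h3 := hag x.1 x.2 (by omega)
    rw [cf_sub, sub_eq_zero] at h3
    rw [h3]
  have hcf : ∀ i j, i + j = n + 2 → cf (homPart (n + 2) (lin p q H)) i j = cf K i j := by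
    intro i j hij
    rw [← hhigh n hn, cf_homPart, if_pos hij]
  have hreal : ∀ i j, i + j = n + 2 → ∀ s, cf K j i s = conj (cf K i j s) := by
    intro i j hij s
    rw [← hcf i j hij, ← hcf j i (by omega)]
    exact isReal_homPart_lin p q hH.1.real (n + 2) i j s
  have hsmooth : ∀ i j, i + j = n + 2 → ContDiff ℝ ∞ (cf K i j) := by
    intro i j hij
    rw [← hcf i j hij]
    exact lin_mem_smoothFS hp hq hH.1.smooth (n + 2) _
  have hshift : ∀ i j, i + j = n + 2 → ∀ s, cf K i j (s + D.T) = (σ : ℂ) ^ n * cf K i j s := by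
    intro i j hij s
    rw [← hcf i j hij, ← cf_shift, shift_homPart_lin hpT hqT hH.1.periodic, cf_cst_mul, hσ']
    rfl
  dsimp only
  rw [hP]
  refine ⟨?_, hsmooth _ _ (by omega), hshift _ _ (by omega), isHomogeneous_mixedPoly n K, ?_, ?_,
    ?_, ?_, ?_⟩
  · refine ext_cf fun i j => ?_
    have m1 := cf_monomial (cf K (n + 2) 0) (n + 2) 0 i j
    have m2 := cf_monomial (fun s => conj (cf K (n + 2) 0 s)) 0 (n + 2) i j
    rw [pow_zero, mul_one] at m1 m2
    rw [cf_add, cf_add, m1, m2, cf_mixedPoly, cf_homPart]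
    by_cases hij : i + j = n + 2
    · rcases Nat.eq_zero_or_pos i with rfl | hi
      · obtain rfl : j = n + 2 := by omega
        rw [if_pos hij, if_neg (by omega), if_pos ⟨rfl, rfl⟩, if_neg (by omega)]
        funext s
        simp [hreal (n + 2) 0 (by omega) s]
      · rcases Nat.eq_zero_or_pos j with rfl | hj
        · obtain rfl : i = n + 2 := by omega
          rw [if_pos hij, if_pos ⟨rfl, rfl⟩, if_neg (by omega), if_neg (by omega), add_zero,
            add_zero]
        · rw [if_pos hij, if_neg (by omega), if_neg (by omega), if_pos (by omega), zero_add,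
            zero_add]
    · rw [if_neg hij, if_neg (by omega), if_neg (by omega), if_neg (by omega), add_zero, add_zero]
  · rw [cf_mixedPoly, if_neg (by omega)]
  · rw [cf_mixedPoly, if_neg (by omega)]
  · intro i j s
    rw [cf_mixedPoly, cf_mixedPoly]
    by_cases hij : i + j = n + 2 ∧ i ≠ 0 ∧ j ≠ 0
    · rw [if_pos hij, if_pos (by omega), hreal i j hij.1]
    · rw [if_neg hij, if_neg (by omega)]
      simp
  · intro m
    rw [MvPolynomial.coeff_coe, coeff_mixedPoly]
    split_ifs with h
    · exact hsmooth _ _ h.1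
    · exact zero_mem smoothFns
  · intro m s
    rw [coeff_mixedPoly]
    split_ifs with h
    · exact hshift _ _ h.1 s
    · simp

end AxisData

/-! ### Normalization of the quadratic part -/

theorem isHomogeneous_lin_drift (p q p' q' : ℝ → ℂ) :
    MvPowerSeries.IsHomogeneous (lin p q (drift p' q') + drift p q) 2 := by
  intro d hd
  by_contra hne
  have h1 := homPart_lin p q 2 (drift p' q')
  rw [homPart_of_isHomogeneous (isHomogeneous_drift p' q')] at h1
  have hdeg : d 0 + d 1 ≠ 2 := by
    rw [← exponent_degree, Finsupp.degree_eq_weight_one]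
    exact hne
  have h2 : MvPowerSeries.coeff d (lin p q (drift p' q')) = 0 := by
    rw [← h1, coeff_eq_cf, cf_homPart, if_neg hdeg]
  have h3 : MvPowerSeries.coeff d (drift p q) = 0 :=
    MvPowerSeries.IsHomogeneous.coeff_eq_zero (isHomogeneous_drift p q) (by rwa [exponent_degree])
  rw [map_add, h2, h3, add_zero] at hd
  exact hd rfl

namespace AxisData

variable (D : AxisData)

/-- A rotation-and-scaling followed by an averaging transformation gives the Floquet form as soon
as the quadratic part is transformed into the prescribed one. -/
theorem hasFloquetForm_of_linPullback {p q p' q' a C : ℝ → ℂ} {H₀ : FS} {σ : ℝ}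
    (h : p * cj p - q * cj q = 1) (h' : p' * cj p' - q' * cj q' = 1)
    (hp : ContDiff ℝ ∞ p) (hq : ContDiff ℝ ∞ q) (hp' : ContDiff ℝ ∞ p') (hq' : ContDiff ℝ ∞ q')
    (hσ : σ ^ 2 = 1)
    (hpT : ∀ s, (p * p' + q * cj q') (s + D.T) = σ * (p * p' + q * cj q') s)
    (hqT : ∀ s, (p * q' + q * cj p') (s + D.T) = σ * (p * q' + q * cj p') s)
    (h1 : lin p q (quad (fun s => ((D.k / 4 - D.τ s / 2 : ℝ) : ℂ)) D.C₂) - drift p q = quad a C)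
    (h2 : lin p' q' (quad a C) - drift p' q' = H₀) :
    D.HasFloquetForm (fun θ => linPullback p' q' (linPullback p q θ)) H₀ σ := by
  refine D.hasFloquetForm_of_lin (p := p * p' + q * cj q') (q := p * q' + q * cj p')
    (Q := lin p' q' (drift p q) + drift p' q') ?_
    ((hp.mul hp').add (hq.mul (contDiff_cj hq')))
    ((hp.mul hq').add (hq.mul (contDiff_cj hp'))) hσ hpT hqT (isHomogeneous_lin_drift _ _ _ _) ?_ ?_
  · simp only [map_add, map_mul, cj_cj]
    linear_combination (p' * cj p' - q' * cj q') * h + h'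
  · intro H
    rw [linPullback_liouville h, linPullback_liouville h', lin_sub, lin_lin]
    congr 1
    ring
  · rw [← lin_lin, ← h2, ← h1, lin_sub]
    ring

/-- The coefficient `4 C₂ e^{2iδ}` of the quadratic part in the frame rotated by `δ`. -/
def rotated (δ : ℝ → ℝ) (s : ℝ) : ℂ := 4 * D.C₂ s * Complex.exp (2 * δ s * Complex.I)

/-- The first coefficient of the rotation-and-scaling transformation. -/
def scaleP (δ η : ℝ → ℝ) (s : ℝ) : ℂ := Complex.exp (δ s * Complex.I) * Real.cosh (η s)

/-- The second coefficient of the rotation-and-scaling transformation. -/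
def scaleQ (δ η : ℝ → ℝ) (s : ℝ) : ℂ := -(Complex.exp (δ s * Complex.I) * Real.sinh (η s))

theorem expI_mul_conj (t : ℝ) :
    Complex.exp (t * Complex.I) * conj (Complex.exp (t * Complex.I)) = 1 := by
  rw [← Complex.exp_conj, ← Complex.exp_add]
  simp

theorem cosh_sq_complex (t : ℝ) : (Real.cosh t : ℂ) ^ 2 - (Real.sinh t : ℂ) ^ 2 = 1 := by
  rw [← Complex.ofReal_pow, ← Complex.ofReal_pow, ← Complex.ofReal_sub, Real.cosh_sq_sub_sinh_sq,
    Complex.ofReal_one]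

theorem scale_canonical (δ η : ℝ → ℝ) :
    scaleP δ η * cj (scaleP δ η) - scaleQ δ η * cj (scaleQ δ η) = 1 := by
  funext s
  simp only [Pi.sub_apply, Pi.mul_apply, cj_apply, scaleP, scaleQ, map_mul, map_neg,
    Complex.conj_ofReal, Pi.one_apply]
  linear_combination ((Real.cosh (η s) : ℂ) ^ 2 - (Real.sinh (η s) : ℂ) ^ 2)
    * expI_mul_conj (δ s) + cosh_sq_complex (η s)

theorem contDiff_expI {δ : ℝ → ℝ} (hδ : ContDiff ℝ ∞ δ) :
    ContDiff ℝ ∞ fun s => Complex.exp (δ s * Complex.I) :=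
  ((Complex.ofRealCLM.contDiff.comp hδ).mul contDiff_const).cexp

theorem contDiff_cosh_complex {η : ℝ → ℝ} (hη : ContDiff ℝ ∞ η) :
    ContDiff ℝ ∞ fun s => (Real.cosh (η s) : ℂ) :=
  Complex.ofRealCLM.contDiff.comp (Real.contDiff_cosh.comp hη)

theorem contDiff_sinh_complex {η : ℝ → ℝ} (hη : ContDiff ℝ ∞ η) :
    ContDiff ℝ ∞ fun s => (Real.sinh (η s) : ℂ) :=
  Complex.ofRealCLM.contDiff.comp (Real.contDiff_sinh.comp hη)

theorem contDiff_scaleP {δ η : ℝ → ℝ} (hδ : ContDiff ℝ ∞ δ) (hη : ContDiff ℝ ∞ η) :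
    ContDiff ℝ ∞ (scaleP δ η) :=
  (contDiff_expI hδ).mul (contDiff_cosh_complex hη)

theorem contDiff_scaleQ {δ η : ℝ → ℝ} (hδ : ContDiff ℝ ∞ δ) (hη : ContDiff ℝ ∞ η) :
    ContDiff ℝ ∞ (scaleQ δ η) :=
  ((contDiff_expI hδ).mul (contDiff_sinh_complex hη)).neg

/-- The quadratic Hamiltonian after rotation by `δ` and scaling by `η`, if the scaling removes the
diagonal part of the leading-order dynamics. -/
theorem lin_quad_rotateScale {δ η : ℝ → ℝ} (hδ : ContDiff ℝ ∞ δ)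
    (hη : ∀ s, HasDerivAt η (-(D.rotated δ s).im) s) {A B : ℝ → ℝ}
    (hA : ∀ s, A s = Real.exp (2 * η s) * ((D.rotated δ s).re + D.rate δ s))
    (hB : ∀ s, B s = Real.exp (-(2 * η s)) * ((D.rotated δ s).re - D.rate δ s)) :
    lin (scaleP δ η) (scaleQ δ η) (quad (fun s => ((D.k / 4 - D.τ s / 2 : ℝ) : ℂ)) D.C₂)
      - drift (scaleP δ η) (scaleQ δ η)
      = quad (fun s => (((A s - B s) / 4 : ℝ) : ℂ)) (fun s => (((A s + B s) / 8 : ℝ) : ℂ)) := by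
  have hδ' : ∀ s, HasDerivAt δ (deriv δ s) s := fun s =>
    ((hδ.differentiable (by simp)) s).hasDerivAt
  have du : ∀ s, HasDerivAt (fun s => Complex.exp (δ s * Complex.I))
      (Complex.exp (δ s * Complex.I) * (deriv δ s * Complex.I)) s := fun s =>
    ((hδ' s).ofReal_comp.mul_const Complex.I).cexp
  have dc : ∀ s, HasDerivAt (fun s => (Real.cosh (η s) : ℂ))
      ((Real.sinh (η s) * -(D.rotated δ s).im : ℝ) : ℂ) s := fun s => (hη s).cosh.ofReal_comp
  have dsh : ∀ s, HasDerivAt (fun s => (Real.sinh (η s) : ℂ))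
      ((Real.cosh (η s) * -(D.rotated δ s).im : ℝ) : ℂ) s := fun s => (hη s).sinh.ofReal_comp
  refine lin_quad_sub_drift (fun s => (du s).mul (dc s)) (fun s => ((du s).mul (dsh s)).neg)
    ?_ ?_ ?_
  · funext s
    exact Complex.conj_ofReal _
  all_goals
    intro s
    have hu := expI_mul_conj (δ s)
    have hA' : (A s : ℂ) = (Real.cosh (η s) + Real.sinh (η s)) ^ 2
        * ((D.rotated δ s).re + D.rate δ s) := by
      rw [hA, two_mul, Real.exp_add, ← Real.cosh_add_sinh]
      push_cast
      ring
    have hB' : (B s : ℂ) = (Real.cosh (η s) - Real.sinh (η s)) ^ 2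
        * ((D.rotated δ s).re - D.rate δ s) := by
      rw [hB, two_mul, neg_add, Real.exp_add, ← Real.cosh_sub_sinh]
      push_cast
      ring
    have hr : ((D.rate δ s : ℝ) : ℂ) = D.k / 2 + (deriv δ s : ℝ) - D.τ s := by
      rw [rate]; push_cast; ring
    have hy : 4 * D.C₂ s * Complex.exp (δ s * Complex.I) ^ 2
        = (D.rotated δ s).re + (D.rotated δ s).im * Complex.I := by
      rw [Complex.re_add_im, rotated, ← Complex.exp_nat_mul]
      push_cast
      congr 2
      ring
    have hy' : 4 * conj (D.C₂ s) * conj (Complex.exp (δ s * Complex.I)) ^ 2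
        = (D.rotated δ s).re - (D.rotated δ s).im * Complex.I := by
      have := congrArg (starRingEnd ℂ) hy
      simp only [map_mul, map_pow, map_add, map_ofNat, Complex.conj_ofReal, Complex.conj_I] at this
      rw [this]
      ring
    have hI : 1 / (4 * Complex.I) = -Complex.I / 4 := by
      field_simp
      rw [Complex.I_sq, neg_neg]
    have hI2 := Complex.I_mul_I
    simp only [Complex.ofReal_mul, Complex.ofReal_sub, Complex.ofReal_add, Complex.ofReal_div,
      Complex.ofReal_neg, Complex.ofReal_ofNat, hA', hB', hr, scaleP, scaleQ, map_mul, map_neg,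
      map_add, Complex.conj_ofReal, Complex.conj_I, hI]
    set u := Complex.exp (δ s * Complex.I)
    set u' := conj u
    set ch := (Real.cosh (η s) : ℂ)
    set sh := (Real.sinh (η s) : ℂ)
    set y := ((D.rotated δ s).re : ℂ)
    set x := ((D.rotated δ s).im : ℂ)
    set d := ((deriv δ s : ℝ) : ℂ)
    set C := D.C₂ s
    set C' := conj C
  · linear_combination ((D.k / 4 - D.τ s / 2) * (ch ^ 2 + sh ^ 2) + d / 2 * (ch ^ 2 + sh ^ 2)) * hu
      + (ch * sh / 2) * (hy + hy') - (d / 2 * (ch ^ 2 + sh ^ 2) * (u * u')) * hI2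
  · linear_combination (-(D.k / 4 - D.τ s / 2) * ch * sh - d / 2 * (ch * sh)) * hu
      - (ch ^ 2 / 4) * hy - (sh ^ 2 / 4) * hy' + (Complex.I * x / 4) * (ch ^ 2 - sh ^ 2) * hu
      + (u * u' * ch * sh * d / 2) * hI2

/-- Averaging of a rotation. -/
theorem lin_quad_averageElliptic {θ a : ℝ → ℝ} {ι₀ : ℝ}
    (hθ : ∀ s, HasDerivAt θ (2 * a s - ι₀) s) :
    lin (fun s => Complex.exp (-((θ s : ℝ) * Complex.I))) 0
        (quad (fun s => (a s : ℂ)) 0)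
      - drift (fun s => Complex.exp (-((θ s : ℝ) * Complex.I))) 0
      = cst ((1 / 2 : ℂ) * ι₀) * Zv * Zb := by
  have dp : ∀ s, HasDerivAt (fun s => Complex.exp (-((θ s : ℝ) * Complex.I)))
      (Complex.exp (-((θ s : ℝ) * Complex.I)) * -(((2 * a s - ι₀ : ℝ) : ℂ) * Complex.I)) s :=
    fun s => ((hθ s).ofReal_comp.mul_const Complex.I).neg.cexp
  have e : quad (fun _ => (1 / 2 : ℂ) * ι₀) 0 = cst ((1 / 2 : ℂ) * ι₀) * Zv * Zb := by
    rw [quad, map_zero, fn_zero, zero_mul, zero_mul, sub_zero, sub_zero, cst]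
  rw [← e]
  refine lin_quad_sub_drift dp (fun s => hasDerivAt_const s (0 : ℂ)) ?_ ?_ ?_
  · funext s
    exact Complex.conj_ofReal _
  · intro s
    have hu := expI_mul_conj (-θ s)
    have hI : 1 / (4 * Complex.I) = -Complex.I / 4 := by
      field_simp
      rw [Complex.I_sq, neg_neg]
    rw [Complex.ofReal_neg, neg_mul] at hu
    simp only [Pi.zero_apply, map_zero, map_mul, map_neg, Complex.conj_ofReal, Complex.conj_I, hI]
    push_cast
    linear_combination (a s + (2 * a s - ι₀) / 2 * Complex.I * Complex.I) * hu
      + (2 * a s - ι₀) / 2 * Complex.I_mul_I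
  · intro s
    simp

/-- Averaging of a hyperbolic rotation. -/
theorem lin_quad_averageHyperbolic {θ F : ℝ → ℝ} {ν₀ : ℝ}
    (hθ : ∀ s, HasDerivAt θ (F s - ν₀) s) :
    lin (fun s => (Real.cosh (θ s) : ℂ)) (fun s => -(Complex.I * Real.sinh (θ s)))
        (quad 0 (fun s => ((-F s / 4 : ℝ) : ℂ)))
      - drift (fun s => (Real.cosh (θ s) : ℂ)) (fun s => -(Complex.I * Real.sinh (θ s)))
      = cst ((1 / 4 : ℂ) * ν₀) * (Zv ^ 2 + Zb ^ 2) := by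
  have e : quad 0 (fun _ => -((1 / 4 : ℂ) * ν₀)) = cst ((1 / 4 : ℂ) * ν₀) * (Zv ^ 2 + Zb ^ 2) := by
    have h1 : cj (fun _ => -((1 / 4 : ℂ) * ν₀)) = fun _ => -((1 / 4 : ℂ) * ν₀) := by
      funext s
      have : (1 / 4 : ℂ) * ν₀ = ((1 / 4 * ν₀ : ℝ) : ℂ) := by push_cast; ring
      rw [cj_apply, this, map_neg, Complex.conj_ofReal]
    have h2 : (fun _ : ℝ => -((1 / 4 : ℂ) * ν₀)) = -fun _ => (1 / 4 : ℂ) * ν₀ := rfl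
    rw [quad, h1, h2, fn_neg, fn_zero, cst]
    ring
  have dp : ∀ s, HasDerivAt (fun s => (Real.cosh (θ s) : ℂ))
      ((Real.sinh (θ s) * (F s - ν₀) : ℝ) : ℂ) s := fun s => (hθ s).cosh.ofReal_comp
  have dq : ∀ s, HasDerivAt (fun s => -(Complex.I * Real.sinh (θ s)))
      (-(Complex.I * ((Real.cosh (θ s) * (F s - ν₀) : ℝ) : ℂ))) s := fun s =>
    ((hθ s).sinh.ofReal_comp.const_mul Complex.I).neg
  have hI : 1 / (4 * Complex.I) = -Complex.I / 4 := by
    field_simp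
    rw [Complex.I_sq, neg_neg]
  rw [← e]
  refine lin_quad_sub_drift dp dq (map_zero _) ?_ ?_
  · intro s
    simp only [Pi.zero_apply, map_mul, map_neg, Complex.conj_ofReal, Complex.conj_I, hI]
    push_cast
    ring
  · intro s
    have hch := cosh_sq_complex (θ s)
    have hI2 := Complex.I_mul_I
    simp only [Pi.zero_apply, map_mul, map_neg, Complex.conj_ofReal, Complex.conj_I, hI]
    push_cast at hch ⊢
    linear_combination (F s / 4 * Complex.sinh (θ s) ^ 2
      + (F s - ν₀) / 4 * (Complex.cosh (θ s) ^ 2 - Complex.sinh (θ s) ^ 2)) * hI2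
      + (ν₀ / 4) * hch

end AxisData

/-! ### Averaging -/

theorem hasDerivAt_primitive {G : ℝ → ℝ} (hG : Continuous G) (s : ℝ) :
    HasDerivAt (fun s => ∫ t in (0 : ℝ)..s, G t) (G s) s :=
  intervalIntegral.integral_hasDerivAt_right (hG.intervalIntegrable _ _)
    hG.stronglyMeasurable.stronglyMeasurableAtFilter hG.continuousAt

theorem contDiff_of_hasDerivAt {f g : ℝ → ℝ} (hf : ∀ s, HasDerivAt f (g s) s)
    (hg : ContDiff ℝ ∞ g) : ContDiff ℝ ∞ f := by
  rw [contDiff_infty_iff_deriv]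
  refine ⟨fun s => (hf s).differentiableAt, ?_⟩
  rwa [show deriv f = g from funext fun s => (hf s).deriv]

/-- A primitive of a periodic function, vanishing at `0`, is additive under translation by the
period. -/
theorem primitive_shift {ι G : ℝ → ℝ} {T : ℝ} (hι : ∀ s, HasDerivAt ι (G s) s) (h0 : ι 0 = 0)
    (hG : Function.Periodic G T) (s : ℝ) : ι (s + T) = ι s + ι T := by
  have h1 : ∀ s, HasDerivAt (fun s => ι (s + T) - ι s) 0 s := fun s => by
    have := ((hι (s + T)).comp_add_const s T).sub (hι s)
    rwa [hG s, sub_self] at this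
  have h2 := is_const_of_deriv_eq_zero (fun s => (h1 s).differentiableAt)
    (fun s => (h1 s).deriv) s 0
  simp only [zero_add, h0, sub_zero] at h2
  linarith

namespace AxisData

variable (D : AxisData)

theorem τ_smooth : ContDiff ℝ ∞ D.τ := (contDiff_infty_iff_deriv.1 D.γ_smooth).2

theorem periodic_deriv_of_shift {f : ℝ → ℝ} {T c : ℝ} (h : ∀ s, f (s + T) - f s = c) :
    Function.Periodic (deriv f) T := by
  intro s
  have e : (fun s => f (s + T)) = fun s => f s + c := funext fun s => by linarith [h s]
  rw [← deriv_comp_add_const, e, deriv_add_const]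

theorem τ_periodic : Function.Periodic D.τ D.T := by
  obtain ⟨c, hc⟩ := D.γ_shift
  exact periodic_deriv_of_shift hc

theorem C₂_smooth : ContDiff ℝ ∞ D.C₂ := by
  have e : D.C₂ = fun s => cj D.A₂ s * (D.B₀ s : ℂ)⁻¹ := rfl
  rw [e]
  exact (contDiff_cj D.A₂_smooth).mul ((Complex.ofRealCLM.contDiff.comp D.B₀_smooth).inv
    fun s => Complex.ofReal_ne_zero.2 (D.B₀_pos s).ne')

theorem C₂_periodic : Function.Periodic D.C₂ D.T := fun s => by
  rw [C₂, C₂, D.A₂_periodic, D.B₀_periodic]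

theorem rotated_smooth {δ : ℝ → ℝ} (hδ : ContDiff ℝ ∞ δ) : ContDiff ℝ ∞ (D.rotated δ) := by
  refine (contDiff_const.mul D.C₂_smooth).mul (ContDiff.cexp ?_)
  exact (contDiff_const.mul (Complex.ofRealCLM.contDiff.comp hδ)).mul contDiff_const

/-- A smooth rotation angle `δ` and scaling exponent `η` which bring the leading-order dynamics to
the form `v' = -i G v` (for `ε = 1`) or `v' = i G v̄` (for `ε = -1`): `balance` says that the two
off-diagonal entries of its real matrix are `G` and `-ε G`, and `deriv_η` that the diagonal
entries vanish. -/
structure IsNormalFrame (ε : ℝ) (δ η : ℝ → ℝ) (j : ℤ) : Prop where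
  δ_smooth : ContDiff ℝ ∞ δ
  η_smooth : ContDiff ℝ ∞ η
  δ_shift : ∀ s, δ (s + D.T) - δ s = j * Real.pi
  η_periodic : Function.Periodic η D.T
  deriv_η : ∀ s, HasDerivAt η (-(D.rotated δ s).im) s
  balance : ∀ s, Real.exp (2 * η s) * ((D.rotated δ s).re + D.rate δ s)
    + ε * (Real.exp (-(2 * η s)) * ((D.rotated δ s).re - D.rate δ s)) = 0

/-- The off-diagonal entry of the leading-order dynamics in a normal frame. -/
def growth (δ η : ℝ → ℝ) (s : ℝ) : ℝ :=
  Real.exp (2 * η s) * ((D.rotated δ s).re + D.rate δ s)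

variable {D} {ε : ℝ} {δ η : ℝ → ℝ} {j : ℤ}

namespace IsNormalFrame

theorem rate_smooth (h : D.IsNormalFrame ε δ η j) : ContDiff ℝ ∞ (D.rate δ) :=
  (contDiff_const.add (contDiff_infty_iff_deriv.1 h.δ_smooth).2).sub D.τ_smooth

theorem growth_smooth (h : D.IsNormalFrame ε δ η j) : ContDiff ℝ ∞ (D.growth δ η) :=
  (contDiff_const.mul h.η_smooth).exp.mul
    ((Complex.reCLM.contDiff.comp (D.rotated_smooth h.δ_smooth)).add h.rate_smooth)

theorem expI_shift (h : D.IsNormalFrame ε δ η j) (s : ℝ) :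
    Complex.exp (δ (s + D.T) * Complex.I)
      = Real.cos (j * Real.pi) * Complex.exp (δ s * Complex.I) := by
  have e : δ (s + D.T) = j * Real.pi + δ s := by linarith [h.δ_shift s]
  have hs : Real.sin (j * Real.pi) = 0 := Real.sin_int_mul_pi j
  have hexp : Complex.exp ((j * Real.pi : ℝ) * Complex.I) = (Real.cos (j * Real.pi) : ℂ) := by
    rw [Complex.exp_mul_I, ← Complex.ofReal_cos, ← Complex.ofReal_sin, hs]
    simp
  rw [e, Complex.ofReal_add, add_mul, Complex.exp_add, hexp]

theorem rotated_periodic (h : D.IsNormalFrame ε δ η j) :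
    Function.Periodic (D.rotated δ) D.T := by
  intro s
  have hc : (Real.cos (j * Real.pi) : ℂ) ^ 2 = 1 := by
    rw [← Complex.ofReal_pow, Real.cos_sq', Real.sin_int_mul_pi]; simp
  have hsq : ∀ t : ℝ, Complex.exp (2 * t * Complex.I) = Complex.exp (t * Complex.I) ^ 2 := by
    intro t
    rw [← Complex.exp_nat_mul]
    push_cast
    congr 1
    ring
  rw [rotated, rotated, D.C₂_periodic, hsq, hsq, h.expI_shift, mul_pow, hc, one_mul]

theorem rate_periodic (h : D.IsNormalFrame ε δ η j) : Function.Periodic (D.rate δ) D.T := by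
  intro s
  rw [rate, rate, periodic_deriv_of_shift h.δ_shift, D.τ_periodic]

theorem growth_periodic (h : D.IsNormalFrame ε δ η j) :
    Function.Periodic (D.growth δ η) D.T := by
  intro s
  rw [growth, growth, h.rotated_periodic, h.rate_periodic, h.η_periodic]

theorem scaleP_shift (h : D.IsNormalFrame ε δ η j) (s : ℝ) :
    scaleP δ η (s + D.T) = Real.cos (j * Real.pi) * scaleP δ η s := by
  rw [scaleP, scaleP, h.expI_shift, h.η_periodic, mul_assoc]

theorem scaleQ_shift (h : D.IsNormalFrame ε δ η j) (s : ℝ) :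
    scaleQ δ η (s + D.T) = Real.cos (j * Real.pi) * scaleQ δ η s := by
  rw [scaleQ, scaleQ, h.expI_shift, h.η_periodic, mul_assoc, mul_neg]

theorem exp_neg_mul (h : D.IsNormalFrame ε δ η j) (hε : ε ^ 2 = 1) (s : ℝ) :
    Real.exp (-(2 * η s)) * ((D.rotated δ s).re - D.rate δ s) = -ε * D.growth δ η s := by
  have := h.balance s
  rw [growth]
  linear_combination ε * this
    - (Real.exp (-(2 * η s)) * ((D.rotated δ s).re - D.rate δ s)) * hε

theorem rate_of_elliptic (h : D.IsNormalFrame 1 δ η j) (s : ℝ) :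
    D.rate δ s / Real.cosh (2 * η s) = D.growth δ η s := by
  rw [div_eq_iff (Real.cosh_pos _).ne', Real.cosh_eq]
  have h1 := h.exp_neg_mul (by norm_num) s
  have h2 : Real.exp (2 * η s) * Real.exp (-(2 * η s)) = 1 := by rw [← Real.exp_add]; simp
  rw [growth] at h1 ⊢
  linear_combination (-Real.exp (2 * η s) / 2) * h1 - (D.rate δ s) * h2

theorem rate_of_hyperbolic (h : D.IsNormalFrame (-1) δ η j) (s : ℝ) :
    -D.growth δ η s * Real.sinh (2 * η s) = D.rate δ s := by
  rw [Real.sinh_eq]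
  have h1 := h.exp_neg_mul (by norm_num) s
  have h2 : Real.exp (2 * η s) * Real.exp (-(2 * η s)) = 1 := by rw [← Real.exp_add]; simp
  rw [growth] at h1 ⊢
  linear_combination (Real.exp (2 * η s) / 2) * h1 + (D.rate δ s) * h2

theorem hasFloquetForm_elliptic (h : D.IsNormalFrame 1 δ η j) {ι : ℝ → ℝ} {ι₀ : ℝ}
    (hι : ∀ s, ι s = ∫ t in (0 : ℝ)..s, D.rate δ t / Real.cosh (2 * η t))
    (hι₀ : ι₀ = (ι D.T + if Even j then 0 else Real.pi) / D.T) :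
    D.HasFloquetForm (fun θ => averageElliptic ι ι₀ (rotateScale δ η θ))
      (cst ((1 / 2 : ℂ) * ι₀) * Zv * Zb) 1 := by
  have hι' : ι = fun s => ∫ t in (0 : ℝ)..s, D.growth δ η t := by
    funext s
    rw [hι]
    simp_rw [h.rate_of_elliptic]
  have dι : ∀ s, HasDerivAt ι (D.growth δ η s) s := by
    rw [hι']
    exact hasDerivAt_primitive h.growth_smooth.continuous
  have ι0 : ι 0 = 0 := by rw [hι]; simp
  have sι : ContDiff ℝ ∞ ι := contDiff_of_hasDerivAt dι h.growth_smooth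
  set θ : ℝ → ℝ := fun s => ι s - ι₀ * s with hθ
  have dθ : ∀ s, HasDerivAt θ (2 * (D.growth δ η s / 2) - ι₀) s := fun s => by
    have := (dι s).sub ((hasDerivAt_id s).const_mul ι₀)
    rwa [mul_one, ← mul_div_cancel₀ (D.growth δ η s) (two_ne_zero' ℝ)] at this
  have sθ : ContDiff ℝ ∞ θ := sι.sub (contDiff_const.mul contDiff_id)
  have hshift : ∀ s, θ (s + D.T) = θ s - if Even j then 0 else Real.pi := by
    intro s
    have h1 : ι₀ * D.T = ι D.T + if Even j then 0 else Real.pi := by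
      rw [hι₀, div_mul_cancel₀ _ D.T_pos.ne']
    simp only [hθ]
    rw [primitive_shift dι ι0 h.growth_periodic]
    linarith
  set p' : ℝ → ℂ := fun s => Complex.exp (-((θ s : ℝ) * Complex.I)) with hp'
  have sp' : ContDiff ℝ ∞ p' :=
    ((Complex.ofRealCLM.contDiff.comp sθ).mul contDiff_const).neg.cexp
  have hpshift : ∀ s, p' (s + D.T) = Real.cos (j * Real.pi) * p' s := by
    intro s
    simp only [hp', hshift s]
    by_cases hj : Even j
    · have : Real.cos (j * Real.pi) = 1 := by
        rw [Real.cos_int_mul_pi, hj.neg_one_zpow]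
      rw [if_pos hj, this, sub_zero, Complex.ofReal_one, one_mul]
    · have : Real.cos (j * Real.pi) = -1 := by
        rw [Real.cos_int_mul_pi, (Int.not_even_iff_odd.1 hj).neg_one_zpow]
      rw [if_neg hj, this, Complex.ofReal_sub, sub_mul, neg_sub, sub_eq_add_neg, Complex.exp_add,
        Complex.exp_pi_mul_I]
      simp
  have hc : (Real.cos (j * Real.pi) : ℂ) * Real.cos (j * Real.pi) = 1 := by
    rw [← Complex.ofReal_mul, ← pow_two, Real.cos_sq', Real.sin_int_mul_pi]; simp
  have hcan : p' * cj p' - 0 * cj 0 = 1 := by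
    funext s
    have := expI_mul_conj (-θ s)
    rw [Complex.ofReal_neg, neg_mul] at this
    rw [zero_mul, sub_zero]
    exact this
  refine D.hasFloquetForm_of_linPullback (p := scaleP δ η) (q := scaleQ δ η) (p' := p') (q' := 0)
    (scale_canonical δ η) hcan (contDiff_scaleP h.δ_smooth h.η_smooth)
    (contDiff_scaleQ h.δ_smooth h.η_smooth) sp' contDiff_const (one_pow 2) ?_ ?_
    (D.lin_quad_rotateScale h.δ_smooth h.deriv_η (fun _ => rfl) (fun _ => rfl)) ?_
  · intro s
    simp only [Pi.add_apply, Pi.mul_apply, map_zero, Pi.zero_apply, mul_zero, add_zero,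
      h.scaleP_shift, hpshift, Complex.ofReal_one, one_mul]
    linear_combination scaleP δ η s * p' s * hc
  · intro s
    simp only [Pi.add_apply, Pi.mul_apply, cj_apply, Pi.zero_apply, mul_zero, zero_add,
      h.scaleQ_shift, hpshift, Complex.ofReal_one, one_mul, map_mul, Complex.conj_ofReal]
    linear_combination scaleQ δ η s * conj (p' s) * hc
  · have e1 : (fun s => (((Real.exp (2 * η s) * ((D.rotated δ s).re + D.rate δ s)
        - Real.exp (-(2 * η s)) * ((D.rotated δ s).re - D.rate δ s)) / 4 : ℝ) : ℂ))
        = fun s => ((D.growth δ η s / 2 : ℝ) : ℂ) := by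
      funext s
      rw [h.exp_neg_mul (by norm_num), ← growth]
      congr 1
      ring
    have e2 : (fun s => (((Real.exp (2 * η s) * ((D.rotated δ s).re + D.rate δ s)
        + Real.exp (-(2 * η s)) * ((D.rotated δ s).re - D.rate δ s)) / 8 : ℝ) : ℂ)) = 0 := by
      funext s
      rw [h.exp_neg_mul (by norm_num), ← growth]
      simp
    rw [e1, e2]
    exact lin_quad_averageElliptic dθ

theorem hasFloquetForm_hyperbolic (h : D.IsNormalFrame (-1) δ η j) {ν : ℝ → ℝ} {ν₀ : ℝ}
    (hν : ∀ s, ν s = ∫ t in (0 : ℝ)..s, -D.growth δ η t) (hν₀ : ν₀ = ν D.T / D.T) :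
    D.HasFloquetForm (fun θ => averageHyperbolic ν ν₀ (rotateScale δ η θ))
      (cst ((1 / 4 : ℂ) * ν₀) * (Zv ^ 2 + Zb ^ 2)) (Real.cos (j * Real.pi)) := by
  have hν' : ν = fun s => ∫ t in (0 : ℝ)..s, -D.growth δ η t := funext hν
  have dν : ∀ s, HasDerivAt ν (-D.growth δ η s) s := by
    rw [hν']
    exact hasDerivAt_primitive h.growth_smooth.neg.continuous
  have ν0 : ν 0 = 0 := by rw [hν]; simp
  have sν : ContDiff ℝ ∞ ν := contDiff_of_hasDerivAt dν h.growth_smooth.neg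
  set θ : ℝ → ℝ := fun s => ν s - ν₀ * s with hθ
  have dθ : ∀ s, HasDerivAt θ (-D.growth δ η s - ν₀) s := fun s => by
    have := (dν s).sub ((hasDerivAt_id s).const_mul ν₀)
    rwa [mul_one] at this
  have sθ : ContDiff ℝ ∞ θ := sν.sub (contDiff_const.mul contDiff_id)
  have hshift : ∀ s, θ (s + D.T) = θ s := by
    intro s
    have h1 : ν₀ * D.T = ν D.T := by
      rw [hν₀, div_mul_cancel₀ _ D.T_pos.ne']
    have hper : Function.Periodic (fun s => -D.growth δ η s) D.T := fun s => by
      simp only [h.growth_periodic s]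
    simp only [hθ]
    rw [primitive_shift dν ν0 hper]
    linarith
  set p' : ℝ → ℂ := fun s => (Real.cosh (θ s) : ℂ) with hp'
  set q' : ℝ → ℂ := fun s => -(Complex.I * Real.sinh (θ s)) with hq'
  have hpshift : ∀ s, p' (s + D.T) = p' s := fun s => by simp only [hp', hshift s]
  have hqshift : ∀ s, q' (s + D.T) = q' s := fun s => by simp only [hq', hshift s]
  have hc : Real.cos (j * Real.pi) ^ 2 = 1 := by
    rw [Real.cos_sq', Real.sin_int_mul_pi]; simp
  have hcan : p' * cj p' - q' * cj q' = 1 := by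
    funext s
    have h1 := cosh_sq_complex (θ s)
    simp only [hp', hq', Pi.sub_apply, Pi.mul_apply, cj_apply, map_mul, map_neg,
      Complex.conj_ofReal, Complex.conj_I, Pi.one_apply]
    linear_combination h1 + (Real.sinh (θ s) : ℂ) ^ 2 * Complex.I_mul_I
  refine D.hasFloquetForm_of_linPullback (p := scaleP δ η) (q := scaleQ δ η) (p' := p') (q' := q')
    (scale_canonical δ η) hcan (contDiff_scaleP h.δ_smooth h.η_smooth)
    (contDiff_scaleQ h.δ_smooth h.η_smooth) (contDiff_cosh_complex sθ)
    (contDiff_const.mul (contDiff_sinh_complex sθ)).neg hc ?_ ?_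
    (D.lin_quad_rotateScale h.δ_smooth h.deriv_η (fun _ => rfl) (fun _ => rfl)) ?_
  · intro s
    simp only [Pi.add_apply, Pi.mul_apply, cj_apply, h.scaleP_shift, h.scaleQ_shift, hpshift,
      hqshift]
    ring
  · intro s
    simp only [Pi.add_apply, Pi.mul_apply, cj_apply, h.scaleP_shift, h.scaleQ_shift, hpshift,
      hqshift]
    ring
  · have e1 : (fun s => (((Real.exp (2 * η s) * ((D.rotated δ s).re + D.rate δ s)
        - Real.exp (-(2 * η s)) * ((D.rotated δ s).re - D.rate δ s)) / 4 : ℝ) : ℂ)) = 0 := by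
      funext s
      rw [h.exp_neg_mul (by norm_num), ← growth]
      simp
    have e2 : (fun s => (((Real.exp (2 * η s) * ((D.rotated δ s).re + D.rate δ s)
        + Real.exp (-(2 * η s)) * ((D.rotated δ s).re - D.rate δ s)) / 8 : ℝ) : ℂ))
        = fun s => ((-(-D.growth δ η s) / 4 : ℝ) : ℂ) := by
      funext s
      rw [h.exp_neg_mul (by norm_num), ← growth]
      congr 1
      ring
    rw [e1, e2]
    exact lin_quad_averageHyperbolic dθ

end IsNormalFrame

end AxisData

/-! ### Angles and matrix exponentials -/

/-- A smooth unit vector in the plane has a smooth angle. -/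
theorem exists_smooth_angle {u v : ℝ → ℝ} (hu : ContDiff ℝ ∞ u) (hv : ContDiff ℝ ∞ v)
    (h : ∀ s, u s ^ 2 + v s ^ 2 = 1) :
    ∃ φ : ℝ → ℝ, ContDiff ℝ ∞ φ ∧ ∀ s, u s = Real.cos (φ s) ∧ v s = Real.sin (φ s) := by
  obtain ⟨φ₀, hφ₀⟩ : ∃ φ₀ : ℝ, Complex.exp (φ₀ * Complex.I) = ⟨u 0, v 0⟩ := by
    rw [← Complex.norm_eq_one_iff, Complex.norm_def, Complex.normSq_mk, Real.sqrt_eq_one,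
      ← pow_two, ← pow_two, h]
  have du : ∀ s, HasDerivAt u (deriv u s) s := fun s =>
    (hu.differentiable (by simp) s).hasDerivAt
  have dv : ∀ s, HasDerivAt v (deriv v s) s := fun s =>
    (hv.differentiable (by simp) s).hasDerivAt
  have hG : ContDiff ℝ ∞ fun s => u s * deriv v s - v s * deriv u s :=
    (hu.mul (contDiff_infty_iff_deriv.1 hv).2).sub (hv.mul (contDiff_infty_iff_deriv.1 hu).2)
  set φ : ℝ → ℝ := fun s => φ₀ + ∫ t in (0 : ℝ)..s, (u t * deriv v t - v t * deriv u t) with hφ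
  have dφ : ∀ s, HasDerivAt φ (u s * deriv v s - v s * deriv u s) s := fun s =>
    (hasDerivAt_primitive hG.continuous s).const_add φ₀
  have hort : ∀ s, u s * deriv u s + v s * deriv v s = 0 := by
    intro s
    have h1 := ((du s).pow 2).add ((dv s).pow 2)
    have h2 : (fun s => u s ^ 2 + v s ^ 2) = fun _ => (1 : ℝ) := funext h
    have h3 := h1.unique (h2 ▸ hasDerivAt_const s (1 : ℝ))
    simp only [Nat.cast_ofNat, Nat.add_one_sub_one, pow_one] at h3
    linarith
  -- The components of `(u, v)` along the rotating frame of angle `φ` are constant.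
  have hA : ∀ s, HasDerivAt (fun s => u s * Real.cos (φ s) + v s * Real.sin (φ s)) 0 s := by
    intro s
    refine (((du s).mul (dφ s).cos).add ((dv s).mul (dφ s).sin)).congr_deriv ?_
    linear_combination (Real.cos (φ s) * u s + Real.sin (φ s) * v s) * hort s
      - (Real.cos (φ s) * deriv u s + Real.sin (φ s) * deriv v s) * h s
  have hB : ∀ s, HasDerivAt (fun s => v s * Real.cos (φ s) - u s * Real.sin (φ s)) 0 s := by
    intro s
    refine (((dv s).mul (dφ s).cos).sub ((du s).mul (dφ s).sin)).congr_deriv ?_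
    linear_combination (Real.cos (φ s) * v s - Real.sin (φ s) * u s) * hort s
      - (Real.cos (φ s) * deriv v s - Real.sin (φ s) * deriv u s) * h s
  have h0 : φ 0 = φ₀ := by simp [hφ]
  have hu0 : u 0 = Real.cos φ₀ := by
    rw [← Complex.exp_ofReal_mul_I_re, hφ₀]
  have hv0 : v 0 = Real.sin φ₀ := by
    rw [← Complex.exp_ofReal_mul_I_im, hφ₀]
  refine ⟨φ, contDiff_of_hasDerivAt dφ hG, fun s => ?_⟩
  have hA' := is_const_of_deriv_eq_zero (fun s => (hA s).differentiableAt)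
    (fun s => (hA s).deriv) s 0
  have hB' := is_const_of_deriv_eq_zero (fun s => (hB s).differentiableAt)
    (fun s => (hB s).deriv) s 0
  simp only [h0, hu0, hv0] at hA' hB'
  have hsc := Real.sin_sq_add_cos_sq (φ s)
  have hsc0 := Real.sin_sq_add_cos_sq φ₀
  constructor
  · linear_combination Real.cos (φ s) * hA' - Real.sin (φ s) * hB' - u s * hsc
      + Real.cos (φ s) * hsc0
  · linear_combination Real.sin (φ s) * hA' + Real.cos (φ s) * hB' - v s * hsc
      + Real.sin (φ s) * hsc0

/-- A continuous function with values in `π ℤ` is constant. -/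
theorem exists_int_mul_pi {g : ℝ → ℝ} (hg : Continuous g) (h : ∀ s, Real.sin (g s) = 0) :
    ∃ j : ℤ, ∀ s, g s = j * Real.pi := by
  choose n hn using fun s => Real.sin_eq_zero_iff.1 (h s)
  have hc : Continuous n := by
    rw [Int.isClosedEmbedding_coe_real.isEmbedding.continuous_iff]
    have e : ((↑) : ℤ → ℝ) ∘ n = fun s => g s / Real.pi := by
      funext s
      rw [Function.comp_apply, ← hn s, mul_div_cancel_right₀ _ Real.pi_ne_zero]
    rw [e]
    exact hg.div_const _
  refine ⟨n 0, fun s => ?_⟩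
  rw [← hn s, PreconnectedSpace.constant inferInstance hc (x := s) (y := 0)]

section
open scoped Matrix.Norms.Operator

theorem exp_mulVec_of_eigenvector {C : Matrix (Fin 2) (Fin 2) ℝ} {v : Fin 2 → ℝ} {c : ℝ}
    (h : C.mulVec v = c • v) : (NormedSpace.exp C).mulVec v = Real.exp c • v := by
  have hpow : ∀ n : ℕ, (C ^ n).mulVec v = c ^ n • v := by
    intro n
    induction n with
    | zero => simp
    | succ n ih =>
      rw [pow_succ, ← Matrix.mulVec_mulVec, h, Matrix.mulVec_smul, ih, smul_smul, pow_succ']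
  let L : Matrix (Fin 2) (Fin 2) ℝ →ₗ[ℝ] (Fin 2 → ℝ) :=
    { toFun := fun A => A.mulVec v
      map_add' := fun A B => Matrix.add_mulVec A B v
      map_smul' := fun r A => Matrix.smul_mulVec r A v }
  have hL : Continuous L := L.continuous_of_finiteDimensional
  have h1 := (NormedSpace.exp_series_hasSum_exp' (𝕂 := ℝ) C).map L hL
  have h2 := (NormedSpace.exp_series_hasSum_exp' (𝕂 := ℝ) c).smul_const v
  have e : (L ∘ fun n : ℕ => ((n.factorial : ℝ)⁻¹) • C ^ n)
      = fun n : ℕ => (((n.factorial : ℝ)⁻¹) • c ^ n) • v := by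
    funext n
    change ((((n.factorial : ℝ)⁻¹) • C ^ n).mulVec v) = _
    rw [Matrix.smul_mulVec, hpow, smul_smul, smul_eq_mul]
  rw [e] at h1
  rw [Real.exp_eq_exp_ℝ]
  exact h1.unique h2

end

/-- The exponential of a real matrix with real eigenvalues `± ν`, `ν ≠ 0`, has positive
eigenvalues. -/
theorem pos_of_exp_mulVec {C : Matrix (Fin 2) (Fin 2) ℝ} {ν t r : ℝ} (hν : ν ≠ 0)
    (hC : C * C = (ν ^ 2) • (1 : Matrix (Fin 2) (Fin 2) ℝ)) {v : Fin 2 → ℝ} (hv : v ≠ 0)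
    (h : (NormedSpace.exp (t • C)).mulVec v = r • v) : 0 < r := by
  have hcomm : Commute (NormedSpace.exp (t • C)) C :=
    ((Commute.refl C).smul_left t).exp_left
  -- The eigenvectors of `C` in the span of `v` and `C v` are eigenvectors of the exponential for
  -- the same eigenvalue as `v`.
  have key : ∀ c : ℝ, c ^ 2 = ν ^ 2 → C.mulVec v + c • v ≠ 0 → 0 < r := by
    intro c hc hne
    have h1 : C.mulVec (C.mulVec v + c • v) = c • (C.mulVec v + c • v) := by
      rw [Matrix.mulVec_add, Matrix.mulVec_smul, Matrix.mulVec_mulVec, hC, Matrix.smul_mulVec,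
        Matrix.one_mulVec, smul_add, smul_smul, ← pow_two, hc, add_comm]
    have h2 : (t • C).mulVec (C.mulVec v + c • v) = (t * c) • (C.mulVec v + c • v) := by
      rw [Matrix.smul_mulVec, h1, smul_smul]
    have h3 := exp_mulVec_of_eigenvector h2
    have h4 : (NormedSpace.exp (t • C)).mulVec (C.mulVec v + c • v)
        = r • (C.mulVec v + c • v) := by
      rw [Matrix.mulVec_add, Matrix.mulVec_smul, Matrix.mulVec_mulVec, hcomm.eq,
        ← Matrix.mulVec_mulVec, h, Matrix.mulVec_smul, smul_add, smul_comm]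
    rw [h3] at h4
    rw [← smul_left_injective ℝ hne h4]
    exact Real.exp_pos _
  by_contra hr
  have e1 : C.mulVec v + ν • v = 0 := by
    by_contra hne
    exact hr (key ν rfl hne)
  have e2 : C.mulVec v + (-ν) • v = 0 := by
    by_contra hne
    exact hr (key (-ν) (by ring) hne)
  have e3 : (2 * ν) • v = 0 := by
    have : (2 * ν) • v = (C.mulVec v + ν • v) - (C.mulVec v + (-ν) • v) := by module
    rw [this, e1, e2, sub_zero]
  exact (smul_ne_zero (mul_ne_zero two_ne_zero hν) hv) e3

theorem charpoly_fin_two_coeff {C : Matrix (Fin 2) (Fin 2) ℝ} {a : ℝ}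
    (h : C.charpoly = Polynomial.X ^ 2 + Polynomial.C a) :
    C 1 1 = -C 0 0 ∧ -(C 0 0 * C 0 0) - C 0 1 * C 1 0 = a := by
  rw [Matrix.charpoly_fin_two] at h
  have h1 := congrArg (fun p => Polynomial.coeff p 1) h
  have h0 := congrArg (fun p => Polynomial.coeff p 0) h
  simp [Polynomial.coeff_X_pow, Polynomial.coeff_C, Matrix.trace_fin_two, Matrix.det_fin_two]
    at h1 h0
  have h1' : C 1 1 = -C 0 0 := by linarith
  refine ⟨h1', ?_⟩
  rw [← h0, h1']
  ring

namespace AxisData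

variable (D : AxisData)

/-! ### The leading-order dynamics -/

/-- Real part of `4 C₂`. -/
def coefP (s : ℝ) : ℝ := (4 * D.C₂ s).re

/-- Imaginary part of `4 C₂`. -/
def coefQ (s : ℝ) : ℝ := (4 * D.C₂ s).im

/-- The rotation rate `k / 2 - τ`. -/
def coefR (s : ℝ) : ℝ := D.k / 2 - D.τ s

theorem linMatrix_eq (s : ℝ) : D.linMatrix s
    = !![D.coefQ s, D.coefP s + D.coefR s; D.coefP s - D.coefR s, -D.coefQ s] := by
  have hk : (D.k / 2 - D.τ s : ℂ) = ((D.coefR s : ℝ) : ℂ) := by rw [coefR]; push_cast; ring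
  have h4 : ∀ z : ℂ, (4 * z).re = 4 * z.re ∧ (4 * z).im = 4 * z.im := fun z => by
    constructor <;> simp
  rw [linMatrix]
  simp only [linRhs, hk, coefP, coefQ]
  ext i j
  fin_cases i <;> fin_cases j <;> simp

theorem rotated_eq (δ : ℝ → ℝ) (s : ℝ) : D.rotated δ s = ⟨D.coefP s, D.coefQ s⟩ *
    ⟨Real.cos (δ s) ^ 2 - Real.sin (δ s) ^ 2, 2 * Real.sin (δ s) * Real.cos (δ s)⟩ := by
  rw [rotated, coefP, coefQ, Complex.eta, ← Real.cos_two_mul', ← Real.sin_two_mul]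
  congr 1
  have : (2 * δ s : ℂ) = ((2 * δ s : ℝ) : ℂ) := by push_cast; ring
  apply Complex.ext
  · rw [this, Complex.exp_ofReal_mul_I_re]
  · rw [this, Complex.exp_ofReal_mul_I_im]

theorem rotated_re (δ : ℝ → ℝ) (s : ℝ) :
    (D.rotated δ s).re = D.coefP s * (Real.cos (δ s) ^ 2 - Real.sin (δ s) ^ 2)
      - D.coefQ s * (2 * Real.sin (δ s) * Real.cos (δ s)) := by
  rw [rotated_eq, Complex.mul_re]

theorem rotated_im (δ : ℝ → ℝ) (s : ℝ) :
    (D.rotated δ s).im = D.coefP s * (2 * Real.sin (δ s) * Real.cos (δ s))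
      + D.coefQ s * (Real.cos (δ s) ^ 2 - Real.sin (δ s) ^ 2) := by
  rw [rotated_eq, Complex.mul_im]

theorem rate_eq (δ : ℝ → ℝ) (s : ℝ) : D.rate δ s = D.coefR s + deriv δ s := by
  rw [rate, coefR]; ring

theorem coefP_smooth : ContDiff ℝ ∞ D.coefP :=
  Complex.reCLM.contDiff.comp (contDiff_const.mul D.C₂_smooth)

theorem coefQ_smooth : ContDiff ℝ ∞ D.coefQ :=
  Complex.imCLM.contDiff.comp (contDiff_const.mul D.C₂_smooth)

theorem coefR_smooth : ContDiff ℝ ∞ D.coefR := contDiff_const.sub D.τ_smooth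

/-- A solution of the leading-order dynamics in real coordinates. -/
def IsSolution (z w : ℝ → ℝ) : Prop :=
  (∀ s, HasDerivAt z (D.coefQ s * z s + (D.coefP s + D.coefR s) * w s) s) ∧
  ∀ s, HasDerivAt w ((D.coefP s - D.coefR s) * z s - D.coefQ s * w s) s

variable {D} {X : ℝ → Matrix (Fin 2) (Fin 2) ℝ}

theorem IsFundamental.isSolution (hX : D.IsFundamental X) (j : Fin 2) :
    D.IsSolution (fun s => X s 0 j) (fun s => X s 1 j) := by
  refine ⟨fun s => (hX.2 s 0 j).congr_deriv ?_, fun s => (hX.2 s 1 j).congr_deriv ?_⟩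
  · simp [linMatrix_eq, Matrix.mul_apply, Fin.sum_univ_two]
  · simp [linMatrix_eq, Matrix.mul_apply, Fin.sum_univ_two, sub_eq_add_neg]

/-- Two solutions have a constant Wronskian. -/
theorem IsSolution.wronskian {z w z' w' : ℝ → ℝ} (h : D.IsSolution z w)
    (h' : D.IsSolution z' w') (s : ℝ) : z s * w' s - w s * z' s = z 0 * w' 0 - w 0 * z' 0 := by
  have hd : ∀ s, HasDerivAt (fun s => z s * w' s - w s * z' s) 0 s := fun s => by
    refine (((h.1 s).mul (h'.2 s)).sub ((h.2 s).mul (h'.1 s))).congr_deriv ?_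
    ring
  exact is_const_of_deriv_eq_zero (fun s => (hd s).differentiableAt) (fun s => (hd s).deriv) s 0

theorem IsFundamental.det_eq_one (hX : D.IsFundamental X) (s : ℝ) :
    X s 0 0 * X s 1 1 - X s 1 0 * X s 0 1 = 1 := by
  have := (hX.isSolution 0).wronskian (hX.isSolution 1) s
  simpa [hX.1] using this

theorem IsFundamental.solution_eq (hX : D.IsFundamental X) {z w : ℝ → ℝ}
    (h : D.IsSolution z w) (s : ℝ) :
    z s = X s 0 0 * z 0 + X s 0 1 * w 0 ∧ w s = X s 1 0 * z 0 + X s 1 1 * w 0 := by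
  have h0 := (hX.isSolution 0).wronskian h s
  have h1 := (hX.isSolution 1).wronskian h s
  have hd := hX.det_eq_one s
  simp only [hX.1, Matrix.one_apply_eq, one_mul, Matrix.one_apply_ne (one_ne_zero' (Fin 2)),
    Matrix.one_apply_ne (zero_ne_one' (Fin 2)), zero_mul, sub_zero, zero_sub] at h0 h1
  constructor
  · linear_combination X s 0 1 * h0 - X s 0 0 * h1 - z s * hd
  · linear_combination X s 1 1 * h0 - X s 1 0 * h1 - w s * hd

theorem IsSolution.shift {z w : ℝ → ℝ} (h : D.IsSolution z w) :
    D.IsSolution (fun s => z (s + D.T)) (fun s => w (s + D.T)) := by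
  have hP : ∀ s, D.coefP (s + D.T) = D.coefP s := fun s => by rw [coefP, coefP, D.C₂_periodic]
  have hQ : ∀ s, D.coefQ (s + D.T) = D.coefQ s := fun s => by rw [coefQ, coefQ, D.C₂_periodic]
  have hR : ∀ s, D.coefR (s + D.T) = D.coefR s := fun s => by rw [coefR, coefR, D.τ_periodic]
  refine ⟨fun s => ?_, fun s => ?_⟩
  · have := (h.1 (s + D.T)).comp_add_const s D.T
    rwa [hP, hQ, hR] at this
  · have := (h.2 (s + D.T)).comp_add_const s D.T
    rwa [hP, hQ, hR] at this

theorem IsFundamental.shift (hX : D.IsFundamental X) (s : ℝ) : X (s + D.T) = X s * X D.T := by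
  have h0 := hX.solution_eq (hX.isSolution 0).shift s
  have h1 := hX.solution_eq (hX.isSolution 1).shift s
  simp only [zero_add] at h0 h1
  ext i j
  rw [Matrix.mul_apply, Fin.sum_univ_two]
  fin_cases i <;> fin_cases j
  · exact h0.1
  · exact h1.1
  · exact h0.2
  · exact h1.2

theorem IsSolution.contDiff {z w : ℝ → ℝ} (h : D.IsSolution z w) :
    ContDiff ℝ ∞ z ∧ ContDiff ℝ ∞ w := by
  have key : ∀ n : ℕ, ContDiff ℝ n z ∧ ContDiff ℝ n w := by
    have dz : deriv z = fun s => D.coefQ s * z s + (D.coefP s + D.coefR s) * w s :=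
      funext fun s => (h.1 s).deriv
    have dw : deriv w = fun s => (D.coefP s - D.coefR s) * z s - D.coefQ s * w s :=
      funext fun s => (h.2 s).deriv
    have le : ∀ n : ℕ, (n : WithTop ℕ∞) ≤ ∞ := fun n => by exact_mod_cast le_top
    intro n
    induction n with
    | zero =>
      rw [Nat.cast_zero, contDiff_zero, contDiff_zero]
      exact ⟨continuous_iff_continuousAt.2 fun s => (h.1 s).continuousAt,
        continuous_iff_continuousAt.2 fun s => (h.2 s).continuousAt⟩
    | succ n ih =>
      have hP := D.coefP_smooth.of_le (le n)
      have hQ := D.coefQ_smooth.of_le (le n)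
      have hR := D.coefR_smooth.of_le (le n)
      rw [Nat.cast_succ, contDiff_succ_iff_deriv, contDiff_succ_iff_deriv, dz, dw]
      exact ⟨⟨fun s => (h.1 s).differentiableAt, by simp, (hQ.mul ih.1).add ((hP.add hR).mul ih.2)⟩,
        ⟨fun s => (h.2 s).differentiableAt, by simp, ((hP.sub hR).mul ih.1).sub (hQ.mul ih.2)⟩⟩
  exact ⟨contDiff_infty.2 fun n => (key n).1, contDiff_infty.2 fun n => (key n).2⟩

/-- A periodic quadratic form `l x² - 2 m x y - n y²` of determinant `d` which is invariant under
the leading-order dynamics. The matrix with rows `(m, n)` and `(l, -m)` satisfies the Lax equation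
`M' = [A, M]`, where `A` is the matrix of the dynamics. -/
structure IsInvariantForm (D : AxisData) (d : ℝ) (m n l : ℝ → ℝ) : Prop where
  smooth : ContDiff ℝ ∞ m ∧ ContDiff ℝ ∞ n ∧ ContDiff ℝ ∞ l
  periodic : Function.Periodic m D.T ∧ Function.Periodic n D.T ∧ Function.Periodic l D.T
  deriv_m : ∀ s, HasDerivAt m ((D.coefP s + D.coefR s) * l s - (D.coefP s - D.coefR s) * n s) s
  deriv_n : ∀ s, HasDerivAt n (2 * D.coefQ s * n s - 2 * (D.coefP s + D.coefR s) * m s) s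
  deriv_l : ∀ s, HasDerivAt l (2 * (D.coefP s - D.coefR s) * m s - 2 * D.coefQ s * l s) s
  det : ∀ s, -(m s * m s) - n s * l s = d

/-- A traceless matrix `C` which commutes with the monodromy matrix defines an invariant quadratic
form, with coefficients the entries of `X C X⁻¹`. -/
theorem IsFundamental.exists_isInvariantForm (hX : D.IsFundamental X)
    {C : Matrix (Fin 2) (Fin 2) ℝ} {d : ℝ} (hcomm : Commute (X D.T) C)
    (hC : C.charpoly = Polynomial.X ^ 2 + Polynomial.C d) :
    ∃ m n l, D.IsInvariantForm d m n l ∧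
      ∀ s, ellipseMatrix X C s = !![l s, -m s; -m s, -n s] := by
  obtain ⟨htr, hdet⟩ := charpoly_fin_two_coeff hC
  set M : ℝ → Matrix (Fin 2) (Fin 2) ℝ := fun s => X s * C * (X s).adjugate with hM
  have hD : ∀ s, (X s).det = 1 := fun s => by
    rw [Matrix.det_fin_two, ← hX.det_eq_one s]; ring
  have hMT : ∀ s, M (s + D.T) = M s := by
    intro s
    have h1 : X D.T * (X D.T).adjugate = 1 := by rw [Matrix.mul_adjugate, hD, one_smul]
    simp only [hM]
    rw [hX.shift s, Matrix.adjugate_mul_distrib]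
    calc X s * X D.T * C * ((X D.T).adjugate * (X s).adjugate)
        = X s * (X D.T * C) * (X D.T).adjugate * (X s).adjugate := by noncomm_ring
      _ = X s * C * (X D.T * (X D.T).adjugate) * (X s).adjugate := by
        rw [hcomm.eq]; noncomm_ring
      _ = X s * C * (X s).adjugate := by rw [h1, mul_one]
  set c := C 0 0
  set b := C 0 1
  set a := C 1 0
  have em : ∀ s, M s 0 0 = (X s 0 0 * c + X s 0 1 * a) * X s 1 1
      - (X s 0 0 * b - X s 0 1 * c) * X s 1 0 := fun s => by
    simp only [hM, Matrix.mul_apply, Fin.sum_univ_two, Matrix.adjugate_fin_two, htr, a, b, c,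
      Matrix.of_apply, Matrix.cons_val_zero, Matrix.cons_val_one]
    ring
  have en : ∀ s, M s 0 1 = -((X s 0 0 * c + X s 0 1 * a) * X s 0 1)
      + (X s 0 0 * b - X s 0 1 * c) * X s 0 0 := fun s => by
    simp only [hM, Matrix.mul_apply, Fin.sum_univ_two, Matrix.adjugate_fin_two, htr, a, b, c,
      Matrix.of_apply, Matrix.cons_val_zero, Matrix.cons_val_one]
    ring
  have el : ∀ s, M s 1 0 = (X s 1 0 * c + X s 1 1 * a) * X s 1 1
      - (X s 1 0 * b - X s 1 1 * c) * X s 1 0 := fun s => by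
    simp only [hM, Matrix.mul_apply, Fin.sum_univ_two, Matrix.adjugate_fin_two, htr, a, b, c,
      Matrix.of_apply, Matrix.cons_val_zero, Matrix.cons_val_one]
    ring
  obtain ⟨hx, hz⟩ := hX.isSolution 0
  obtain ⟨hy, hw⟩ := hX.isSolution 1
  obtain ⟨sx, sz⟩ := (hX.isSolution 0).contDiff
  obtain ⟨sy, sw⟩ := (hX.isSolution 1).contDiff
  refine ⟨fun s => M s 0 0, fun s => M s 0 1, fun s => M s 1 0, ⟨⟨?_, ?_, ?_⟩,
    ⟨fun s => by simp only [hMT s], fun s => by simp only [hMT s], fun s => by simp only [hMT s]⟩,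
    fun s => ?_, fun s => ?_, fun s => ?_, fun s => ?_⟩, fun s => ?_⟩
  · simp_rw [em]
    exact (((sx.mul contDiff_const).add (sy.mul contDiff_const)).mul sw).sub
      (((sx.mul contDiff_const).sub (sy.mul contDiff_const)).mul sz)
  · simp_rw [en]
    exact (((sx.mul contDiff_const).add (sy.mul contDiff_const)).mul sy).neg.add
      (((sx.mul contDiff_const).sub (sy.mul contDiff_const)).mul sx)
  · simp_rw [el]
    exact (((sz.mul contDiff_const).add (sw.mul contDiff_const)).mul sw).sub
      (((sz.mul contDiff_const).sub (sw.mul contDiff_const)).mul sz)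
  · simp_rw [em, en, el]
    refine (((((hx s).mul_const c).add ((hy s).mul_const a)).mul (hw s)).sub
      ((((hx s).mul_const b).sub ((hy s).mul_const c)).mul (hz s))).congr_deriv ?_
    simp only [Pi.add_apply, Pi.sub_apply]
    ring
  · simp_rw [em, en]
    refine (((((hx s).mul_const c).add ((hy s).mul_const a)).mul (hy s)).neg.add
      ((((hx s).mul_const b).sub ((hy s).mul_const c)).mul (hx s))).congr_deriv ?_
    simp only [Pi.add_apply, Pi.sub_apply]
    ring
  · simp_rw [em, el]
    refine (((((hz s).mul_const c).add ((hw s).mul_const a)).mul (hw s)).sub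
      ((((hz s).mul_const b).sub ((hw s).mul_const c)).mul (hz s))).congr_deriv ?_
    simp only [Pi.add_apply, Pi.sub_apply]
    ring
  · rw [em, en, el]
    have h1 := hX.det_eq_one s
    rw [← hdet]
    linear_combination (-(c * c) - b * a) *
      (X s 0 0 * X s 1 1 - X s 1 0 * X s 0 1 + 1) * h1
  · have hinv : (X s)⁻¹ = (X s).adjugate := by
      rw [Matrix.inv_def, hD, Ring.inverse_one, one_smul]
    have hJ : !![0, 1; -1, 0] * C = !![a, -c; -c, -b] := by
      rw [C.eta_fin_two, htr]
      simp [a, b, c]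
    simp only [em, en, el]
    rw [ellipseMatrix, hinv, hJ, Matrix.adjugate_fin_two]
    ext i j
    fin_cases i <;> fin_cases j <;> simp [Matrix.mul_apply, Fin.sum_univ_two] <;> ring

/-- A smooth principal axis of an invariant quadratic form gives a normal frame. The scaling
exponent `η` is determined by `e^{2η} = |μ / f|`, where `μ` is the eigenvalue of the form on the
principal axis, and the equations for `η` and `δ` are those for the derivative of `μ` and of the
off-diagonal entry of the form in the rotated frame, which vanishes. -/
theorem IsInvariantForm.exists_isNormalFrame {ε f : ℝ} {m n l δ : ℝ → ℝ} {j : ℤ} (hf : f ≠ 0)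
    (hε : ε ≠ 0) (h : D.IsInvariantForm (ε * f ^ 2) m n l) (hδ : ContDiff ℝ ∞ δ)
    (hshift : ∀ s, δ (s + D.T) - δ s = j * Real.pi)
    (hK : ∀ s, (l s + n s) * (Real.sin (δ s) * Real.cos (δ s))
      + m s * (Real.cos (δ s) ^ 2 - Real.sin (δ s) ^ 2) = 0) :
    ∃ η, D.IsNormalFrame ε δ η j := by
  have dδ : ∀ s, HasDerivAt δ (deriv δ s) s := fun s =>
    (hδ.differentiable (by simp) s).hasDerivAt
  set μ : ℝ → ℝ := fun s => l s * Real.cos (δ s) ^ 2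
    - 2 * m s * (Real.sin (δ s) * Real.cos (δ s)) - n s * Real.sin (δ s) ^ 2 with hμ
  set μ' : ℝ → ℝ := fun s => l s * Real.sin (δ s) ^ 2
    + 2 * m s * (Real.sin (δ s) * Real.cos (δ s)) - n s * Real.cos (δ s) ^ 2 with hμ'
  have hsc : ∀ s, Real.sin (δ s) ^ 2 + Real.cos (δ s) ^ 2 = 1 := fun s =>
    Real.sin_sq_add_cos_sq (δ s)
  -- The form is diagonal with entries `μ` and `μ'` in the rotated frame.
  have el : ∀ s, l s = μ s * Real.cos (δ s) ^ 2 + μ' s * Real.sin (δ s) ^ 2 := fun s => by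
    simp only [hμ, hμ']
    linear_combination (-l s * (Real.sin (δ s) ^ 2 + Real.cos (δ s) ^ 2 + 1)) * hsc s
      + (2 * Real.sin (δ s) * Real.cos (δ s)) * hK s
  have em : ∀ s, m s = -(μ s - μ' s) * (Real.sin (δ s) * Real.cos (δ s)) := fun s => by
    simp only [hμ, hμ']
    linear_combination (-m s * (Real.sin (δ s) ^ 2 + Real.cos (δ s) ^ 2 + 1)) * hsc s
      + (Real.cos (δ s) ^ 2 - Real.sin (δ s) ^ 2) * hK s
  have en : ∀ s, n s = -(μ s * Real.sin (δ s) ^ 2 + μ' s * Real.cos (δ s) ^ 2) := fun s => by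
    simp only [hμ, hμ']
    linear_combination (-n s * (Real.sin (δ s) ^ 2 + Real.cos (δ s) ^ 2 + 1)) * hsc s
      + (2 * Real.sin (δ s) * Real.cos (δ s)) * hK s
  have hprod : ∀ s, μ s * μ' s = ε * f ^ 2 := fun s => by
    rw [← h.det s, em, en, el]
    linear_combination (-(μ s * μ' s) * (Real.sin (δ s) ^ 2 + Real.cos (δ s) ^ 2 + 1)) * hsc s
  have hμ0 : ∀ s, μ s ≠ 0 := fun s h0 => by
    have := hprod s
    rw [h0, zero_mul] at this
    exact mul_ne_zero hε (pow_ne_zero 2 hf) this.symm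
  have dc := fun s => (dδ s).cos
  have ds' := fun s => (dδ s).sin
  have dμ : ∀ s, HasDerivAt μ (-2 * (D.rotated δ s).im * μ s) s := by
    intro s
    refine (((h.deriv_l s).mul ((dc s).pow 2)).sub (((h.deriv_m s).const_mul 2).mul
      ((ds' s).mul (dc s))) |>.sub ((h.deriv_n s).mul ((ds' s).pow 2))).congr_deriv ?_
    simp only [Pi.mul_apply, Pi.pow_apply, Nat.cast_ofNat, Nat.add_one_sub_one, pow_one]
    rw [rotated_im]
    linear_combination (-2 * deriv δ s - 2 * D.coefR s) * hK s
      + 2 * D.coefP s * (Real.cos (δ s) ^ 2 + Real.sin (δ s) ^ 2) * em s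
      - (2 * D.coefP s * Real.sin (δ s) * Real.cos (δ s)
        + 2 * D.coefQ s * Real.cos (δ s) ^ 2) * el s
      + (2 * D.coefP s * Real.sin (δ s) * Real.cos (δ s)
        - 2 * D.coefQ s * Real.sin (δ s) ^ 2) * en s
      - (4 * D.coefP s * μ s * Real.sin (δ s) * Real.cos (δ s)
        + 2 * D.coefQ s * μ s * (Real.cos (δ s) ^ 2 - Real.sin (δ s) ^ 2)) * hsc s
  have dK : ∀ s, μ s * ((D.rotated δ s).re + D.rate δ s)
      + μ' s * ((D.rotated δ s).re - D.rate δ s) = 0 := by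
    intro s
    have h1 := (((h.deriv_l s).add (h.deriv_n s)).mul ((ds' s).mul (dc s))).add
      ((h.deriv_m s).mul (((dc s).pow 2).sub ((ds' s).pow 2)))
    have h2 : (fun s => (l s + n s) * (Real.sin (δ s) * Real.cos (δ s))
      + m s * (Real.cos (δ s) ^ 2 - Real.sin (δ s) ^ 2)) = fun _ => (0 : ℝ) := funext hK
    have h3 := h1.unique (h2 ▸ hasDerivAt_const s (0 : ℝ))
    simp only [Pi.mul_apply, Pi.pow_apply, Pi.add_apply, Pi.sub_apply, Nat.cast_ofNat,
      Nat.add_one_sub_one, pow_one] at h3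
    rw [rotated_re, rate_eq]
    linear_combination h3
      + 4 * (D.coefR s + deriv δ s) * (Real.sin (δ s) * Real.cos (δ s)) * em s
      - (-2 * D.coefQ s * (Real.sin (δ s) * Real.cos (δ s)) + (D.coefP s + D.coefR s + deriv δ s)
        * (Real.cos (δ s) ^ 2 - Real.sin (δ s) ^ 2)) * el s
      - (2 * D.coefQ s * (Real.sin (δ s) * Real.cos (δ s)) - (D.coefP s - D.coefR s - deriv δ s)
        * (Real.cos (δ s) ^ 2 - Real.sin (δ s) ^ 2)) * en s
      - ((μ s - μ' s) * (D.coefR s + deriv δ s) * (Real.sin (δ s) ^ 2 + Real.cos (δ s) ^ 2 + 1)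
        + (μ s + μ' s) * (D.coefP s * (Real.cos (δ s) ^ 2 - Real.sin (δ s) ^ 2)
          - D.coefQ s * (2 * Real.sin (δ s) * Real.cos (δ s)))) * hsc s
  have dη : ∀ s, HasDerivAt (fun s => 1 / 2 * Real.log (μ s / f)) (-(D.rotated δ s).im) s := by
    intro s
    refine ((((dμ s).div_const f).log (div_ne_zero (hμ0 s) hf)).const_mul (1 / 2)).congr_deriv ?_
    have := hμ0 s
    field_simp
  refine ⟨fun s => 1 / 2 * Real.log (μ s / f), hδ, ?_, hshift, fun s => ?_, dη, fun s => ?_⟩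
  · exact contDiff_of_hasDerivAt dη (Complex.imCLM.contDiff.comp (D.rotated_smooth hδ)).neg
  · have e : δ (s + D.T) = δ s + j * Real.pi := by linarith [hshift s]
    have e1 : Real.cos (δ (s + D.T)) = Real.cos (j * Real.pi) * Real.cos (δ s) := by
      rw [e, Real.cos_add, Real.sin_int_mul_pi]; ring
    have e2 : Real.sin (δ (s + D.T)) = Real.cos (j * Real.pi) * Real.sin (δ s) := by
      rw [e, Real.sin_add, Real.sin_int_mul_pi]; ring
    have hc : Real.cos (j * Real.pi) ^ 2 = 1 := by
      rw [Real.cos_sq', Real.sin_int_mul_pi]; simp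
    have hμT : μ (s + D.T) = μ s := by
      simp only [hμ]
      rw [e1, e2, h.periodic.1, h.periodic.2.1, h.periodic.2.2]
      linear_combination (l s * Real.cos (δ s) ^ 2 - 2 * m s * (Real.sin (δ s) * Real.cos (δ s))
        - n s * Real.sin (δ s) ^ 2) * hc
    simp only [hμT]
  · have hx : μ s / f ≠ 0 := div_ne_zero (hμ0 s) hf
    have e : 2 * (1 / 2 * Real.log (μ s / f)) = Real.log (μ s / f) := by ring
    have hbal : μ s / f * ((D.rotated δ s).re + D.rate δ s)
        + ε * ((μ s / f)⁻¹ * ((D.rotated δ s).re - D.rate δ s)) = 0 := by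
      have := hμ0 s
      have h1 : μ' s = ε * f ^ 2 / μ s := by rw [← hprod s, mul_div_cancel_left₀ _ this]
      have h2 := dK s
      rw [h1] at h2
      field_simp at h2 ⊢
      rwa [mul_zero] at h2 ⊢
    rw [e, Real.exp_neg, Real.exp_log_eq_abs hx]
    rcases abs_choice (μ s / f) with habs | habs <;> rw [habs]
    · exact hbal
    · rw [inv_neg]
      linear_combination -hbal

end AxisData

namespace AxisData

variable {D : AxisData} {X : ℝ → Matrix (Fin 2) (Fin 2) ℝ}

/-! ### Normal frames of elliptic and hyperbolic axes -/

/-- For an elliptic axis the rotation angle is that of the given principal axis. -/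
theorem IsElliptic.exists_isNormalFrame (hX : D.IsFundamental X)
    {C : Matrix (Fin 2) (Fin 2) ℝ} (h : D.IsElliptic X C)
    (haxis : HasSmoothPrincipalAxis D.T X C) : ∃ δ η j, D.IsNormalFrame 1 δ η j := by
  obtain ⟨hT, f, hf, hC⟩ := h
  have hcomm : Commute (X D.T) C := by
    rw [hT]
    exact ((Commute.refl C).smul_left D.T).exp_left
  obtain ⟨m, n, l, hform, hell⟩ := hX.exists_isInvariantForm hcomm hC
  obtain ⟨d, hd, hunit, hper, heig⟩ := haxis
  obtain ⟨δ, hδ, hcs⟩ := exists_smooth_angle (contDiff_pi.1 hd 0) (contDiff_pi.1 hd 1) hunit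
  have hsin : ∀ s, Real.sin (δ (s + D.T) - δ s) = 0 := by
    intro s
    rw [Real.sin_sub, ← (hcs _).1, ← (hcs _).2, ← (hcs _).1, ← (hcs _).2]
    rcases hper s with h | h <;> rw [h]
    · ring
    · simp only [Pi.neg_apply]; ring
  obtain ⟨j, hj⟩ := exists_int_mul_pi
    ((hδ.continuous.comp (continuous_add_const D.T)).sub hδ.continuous) hsin
  rw [← one_mul (f ^ 2)] at hform
  obtain ⟨η, hη⟩ := hform.exists_isNormalFrame hf one_ne_zero hδ hj fun s => by
    obtain ⟨μ, hμ⟩ := heig s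
    rw [hell] at hμ
    have h0 := congrFun hμ 0
    have h1 := congrFun hμ 1
    simp [Matrix.mulVec, dotProduct, Fin.sum_univ_two] at h0 h1
    rw [← (hcs s).1, ← (hcs s).2]
    linear_combination d s 1 * h0 - d s 0 * h1
  exact ⟨δ, η, j, hη⟩

/-- If the dynamics reads `v' = i G v̄` in a normal frame, then `v = e^{∫ G} (1 + i)` is a solution.
Over a period it gets multiplied by a positive number and the sign acquired by the frame. -/
theorem IsNormalFrame.exists_eigenvector {δ η : ℝ → ℝ} {j : ℤ} (h : D.IsNormalFrame (-1) δ η j)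
    (hX : D.IsFundamental X) :
    ∃ (v : Fin 2 → ℝ) (g : ℝ), v ≠ 0 ∧ 0 < g ∧
      (X D.T).mulVec v = (Real.cos (j * Real.pi) * g) • v := by
  -- The solution below is `e^{∫ G} (1 + i)` in the original coordinate: its real and imaginary
  -- parts are those of `e^{∫ G} e^{iδ} (e^{-η} + i e^{η})`.
  set g : ℝ → ℝ := fun s => Real.exp (∫ t in (0 : ℝ)..s, D.growth δ η t) with hg
  have dg : ∀ s, HasDerivAt g (g s * D.growth δ η s) s := fun s =>
    (hasDerivAt_primitive h.growth_smooth.continuous s).exp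
  have dδ : ∀ s, HasDerivAt δ (deriv δ s) s := fun s =>
    (h.δ_smooth.differentiable (by simp) s).hasDerivAt
  have dE : ∀ s, HasDerivAt (fun s => Real.exp (η s))
      (Real.exp (η s) * -(D.rotated δ s).im) s := fun s => (h.deriv_η s).exp
  have dE' : ∀ s, HasDerivAt (fun s => Real.exp (-η s))
      (Real.exp (-η s) * -(-(D.rotated δ s).im)) s := fun s => (h.deriv_η s).neg.exp
  have hEE : ∀ s, Real.exp (η s) * Real.exp (-η s) = 1 := fun s => by
    rw [← Real.exp_add, add_neg_cancel, Real.exp_zero]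
  have hsc : ∀ s, Real.sin (δ s) ^ 2 + Real.cos (δ s) ^ 2 = 1 := fun s =>
    Real.sin_sq_add_cos_sq (δ s)
  have hG1 : ∀ s, D.growth δ η s * Real.exp (-η s)
      = Real.exp (η s) * ((D.rotated δ s).re + D.rate δ s) := fun s => by
    rw [growth, two_mul, Real.exp_add]
    linear_combination Real.exp (η s) * ((D.rotated δ s).re + D.rate δ s) * hEE s
  have hG2 : ∀ s, D.growth δ η s * Real.exp (η s)
      = Real.exp (-η s) * ((D.rotated δ s).re - D.rate δ s) := fun s => by
    have h1 := h.exp_neg_mul (by norm_num) s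
    rw [two_mul, neg_add, Real.exp_add] at h1
    linear_combination -Real.exp (η s) * h1
      + Real.exp (-η s) * ((D.rotated δ s).re - D.rate δ s) * hEE s
  have hsol : D.IsSolution
      (fun s => g s * (Real.exp (-η s) * Real.cos (δ s) - Real.exp (η s) * Real.sin (δ s)))
      (fun s => g s * (Real.exp (-η s) * Real.sin (δ s) + Real.exp (η s) * Real.cos (δ s))) := by
    constructor
    · intro s
      refine ((dg s).mul (((dE' s).mul (dδ s).cos).sub ((dE s).mul (dδ s).sin))).congr_deriv ?_
      have h1 := hG1 s
      have h2 := hG2 s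
      rw [rotated_re, rate_eq] at h1 h2
      simp only [Pi.mul_apply, Pi.sub_apply]
      rw [rotated_im]
      linear_combination g s * Real.cos (δ s) * h1 - g s * Real.sin (δ s) * h2
        + g s * (Real.exp (η s) * (D.coefP s * Real.cos (δ s) - D.coefQ s * Real.sin (δ s))
          + Real.exp (-η s) * (D.coefQ s * Real.cos (δ s) + D.coefP s * Real.sin (δ s))) * hsc s
    · intro s
      refine ((dg s).mul (((dE' s).mul (dδ s).sin).add ((dE s).mul (dδ s).cos))).congr_deriv ?_
      have h1 := hG1 s
      have h2 := hG2 s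
      rw [rotated_re, rate_eq] at h1 h2
      simp only [Pi.mul_apply, Pi.add_apply]
      rw [rotated_im]
      linear_combination g s * Real.sin (δ s) * h1 + g s * Real.cos (δ s) * h2
        + g s * (Real.exp (-η s) * (D.coefP s * Real.cos (δ s) - D.coefQ s * Real.sin (δ s))
          - Real.exp (η s) * (D.coefQ s * Real.cos (δ s) + D.coefP s * Real.sin (δ s))) * hsc s
  have hg0 : g 0 = 1 := by simp [hg]
  have hηT : η D.T = η 0 := by simpa using h.η_periodic 0
  have hδT : δ D.T = δ 0 + j * Real.pi := by
    have := h.δ_shift 0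
    rw [zero_add] at this
    linarith
  have hcT : Real.cos (δ D.T) = Real.cos (j * Real.pi) * Real.cos (δ 0) := by
    rw [hδT, Real.cos_add, Real.sin_int_mul_pi]; ring
  have hsT : Real.sin (δ D.T) = Real.cos (j * Real.pi) * Real.sin (δ 0) := by
    rw [hδT, Real.sin_add, Real.sin_int_mul_pi]; ring
  obtain ⟨e0, e1⟩ := hX.solution_eq hsol D.T
  simp only [hg0, one_mul, hηT, hcT, hsT] at e0 e1
  refine ⟨![Real.exp (-η 0) * Real.cos (δ 0) - Real.exp (η 0) * Real.sin (δ 0),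
    Real.exp (-η 0) * Real.sin (δ 0) + Real.exp (η 0) * Real.cos (δ 0)], g D.T, ?_,
    Real.exp_pos _, ?_⟩
  · intro hv
    have h0 := congrFun hv 0
    have h1 := congrFun hv 1
    simp only [Matrix.cons_val_zero, Matrix.cons_val_one, Pi.zero_apply] at h0 h1
    refine (Real.exp_pos (-η 0)).ne' ?_
    linear_combination Real.cos (δ 0) * h0 + Real.sin (δ 0) * h1 - Real.exp (-η 0) * hsc 0
  · funext i
    fin_cases i
    · simp only [Matrix.mulVec, dotProduct, Fin.sum_univ_two, Fin.zero_eta, Pi.smul_apply,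
        Matrix.cons_val_zero, Matrix.cons_val_one, smul_eq_mul]
      linear_combination -e0
    · simp only [Matrix.mulVec, dotProduct, Fin.sum_univ_two, Fin.mk_one, Pi.smul_apply,
        Matrix.cons_val_zero, Matrix.cons_val_one, smul_eq_mul]
      linear_combination -e1

/-- A hyperbolic axis has a normal frame: the principal axes of an indefinite form never
degenerate. Whether the frame returns to itself or to its opposite is read off from the
monodromy matrix. -/
theorem IsHyperbolic.exists_isNormalFrame (hX : D.IsFundamental X) {σ : ℝ}
    (h : D.IsHyperbolic X σ) :
    ∃ δ η j, D.IsNormalFrame (-1) δ η j ∧ σ = Real.cos (j * Real.pi) := by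
  obtain ⟨hσ, C, hT, ν, hν, hC⟩ := h
  have hσ2 : σ * σ = 1 := by rcases hσ with rfl | rfl <;> norm_num
  have hC' : C.charpoly = Polynomial.X ^ 2 + Polynomial.C (-1 * ν ^ 2) := by
    rw [hC, neg_one_mul, Polynomial.C_neg, sub_eq_add_neg]
  have hcomm : Commute (X D.T) C := by
    rw [hT]
    exact ((Commute.refl C).smul_left D.T).exp_left.smul_left σ
  obtain ⟨m, n, l, hform, -⟩ := hX.exists_isInvariantForm hcomm hC'
  have hpos : ∀ s, 0 < (l s + n s) ^ 2 + (2 * m s) ^ 2 := fun s => by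
    have h1 := hform.det s
    have h2 : (l s + n s) ^ 2 + (2 * m s) ^ 2 = (l s - n s) ^ 2 + 4 * ν ^ 2 := by
      linear_combination -4 * h1
    rw [h2]
    positivity
  -- The form has its principal axes at the angles `φ / 2` and `φ / 2 + π / 2`, where `φ` is the
  -- angle of the nonvanishing vector `(l + n, -2 m)`.
  set ρ : ℝ → ℝ := fun s => Real.sqrt ((l s + n s) ^ 2 + (2 * m s) ^ 2) with hρ
  obtain ⟨sm, sn, sl⟩ := hform.smooth
  obtain ⟨pm, pn, pl⟩ := hform.periodic
  have sρ : ContDiff ℝ ∞ ρ :=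
    (((sl.add sn).pow 2).add ((contDiff_const.mul sm).pow 2)).sqrt fun s => (hpos s).ne'
  have hρ0 : ∀ s, ρ s ≠ 0 := fun s => (Real.sqrt_pos.2 (hpos s)).ne'
  have hρ2 : ∀ s, ρ s ^ 2 = (l s + n s) ^ 2 + (2 * m s) ^ 2 := fun s =>
    Real.sq_sqrt (hpos s).le
  obtain ⟨φ, hφ, hcs⟩ := exists_smooth_angle (u := fun s => (l s + n s) / ρ s)
    (v := fun s => -(2 * m s) / ρ s) ((sl.add sn).div sρ hρ0)
    ((contDiff_const.mul sm).neg.div sρ hρ0) fun s => by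
      rw [div_pow, div_pow, ← add_div, neg_sq, ← hρ2, div_self (pow_ne_zero 2 (hρ0 s))]
  have hρT : ∀ s, ρ (s + D.T) = ρ s := fun s => by simp only [hρ, pm s, pn s, pl s]
  have hδ : ContDiff ℝ ∞ fun s => φ s / 2 := hφ.div_const 2
  have hsin : ∀ s, Real.sin (φ (s + D.T) / 2 - φ s / 2) = 0 := by
    intro s
    have hc : Real.cos (φ (s + D.T)) = Real.cos (φ s) := by
      rw [← (hcs _).1, ← (hcs _).1, pn, pl, hρT]
    have hs : Real.sin (φ (s + D.T)) = Real.sin (φ s) := by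
      rw [← (hcs _).2, ← (hcs _).2, pm, hρT]
    have h1 := Real.sin_sq_eq_half_sub (φ (s + D.T) / 2 - φ s / 2)
    rw [show 2 * (φ (s + D.T) / 2 - φ s / 2) = φ (s + D.T) - φ s by ring, Real.cos_sub, hc, hs]
      at h1
    refine pow_eq_zero_iff two_ne_zero |>.1 ?_
    linear_combination h1 - 1 / 2 * Real.sin_sq_add_cos_sq (φ s)
  obtain ⟨j, hj⟩ := exists_int_mul_pi
    ((hδ.continuous.comp (continuous_add_const D.T)).sub hδ.continuous) hsin
  obtain ⟨η, hη⟩ := hform.exists_isNormalFrame hν (neg_ne_zero.2 one_ne_zero) hδ hj fun s => by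
    have h2 : φ s = 2 * (φ s / 2) := by ring
    have hc := (hcs s).1
    have hs := (hcs s).2
    rw [h2, Real.cos_two_mul', div_eq_iff (hρ0 s)] at hc
    rw [h2, Real.sin_two_mul, div_eq_iff (hρ0 s)] at hs
    linear_combination Real.sin (φ s / 2) * Real.cos (φ s / 2) * hc
      - 1 / 2 * (Real.cos (φ s / 2) ^ 2 - Real.sin (φ s / 2) ^ 2) * hs
  refine ⟨fun s => φ s / 2, η, j, hη, ?_⟩
  obtain ⟨v, g, hv, hg, hXv⟩ := hη.exists_eigenvector hX
  obtain ⟨htr, hdet⟩ := charpoly_fin_two_coeff hC'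
  have hCC : C * C = (ν ^ 2) • (1 : Matrix (Fin 2) (Fin 2) ℝ) := by
    ext i k
    rw [Matrix.mul_apply, Fin.sum_univ_two]
    fin_cases i <;> fin_cases k <;> simp [htr] <;> linarith
  have hexp : (NormedSpace.exp (D.T • C)).mulVec v = (σ * (Real.cos (j * Real.pi) * g)) • v := by
    rw [mul_smul, ← hXv, hT, Matrix.smul_mulVec, smul_smul, hσ2, one_smul]
  have hr := pos_of_exp_mulVec hν hCC hv hexp
  rw [← mul_assoc] at hr
  have hr' := pos_of_mul_pos_left hr hg.le
  have hc2 : Real.cos (j * Real.pi) ^ 2 = 1 := by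
    rw [Real.cos_sq', Real.sin_int_mul_pi]; simp
  rcases hσ with rfl | rfl <;> rcases sq_eq_one_iff.1 hc2 with hc | hc <;>
    rw [hc] at hr' ⊢ <;> norm_num at hr'

theorem cos_int_mul_pi_eq_one_iff (j : ℤ) : Real.cos (j * Real.pi) = 1 ↔ Even j := by
  rw [Real.cos_int_mul_pi]
  by_cases hj : Even j
  · simp [hj, hj.neg_one_zpow]
  · rw [(Int.not_even_iff_odd.1 hj).neg_one_zpow]
    norm_num [hj]

end AxisData

end NearAxis

end

theorem mainTheorem2 (D : NearAxis.AxisData) (X : ℝ → Matrix (Fin 2) (Fin 2) ℝ)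
    (hX : D.IsFundamental X) :
    (∀ C : Matrix (Fin 2) (Fin 2) ℝ, D.IsElliptic X C →
      NearAxis.HasSmoothPrincipalAxis D.T X C →
      ∃ (δ η ι : ℝ → ℝ) (ι₀ : ℝ) (j : ℤ),
        ContDiff ℝ ∞ δ ∧ ContDiff ℝ ∞ η ∧
        (∀ s, δ (s + D.T) - δ s = j * Real.pi) ∧ Function.Periodic η D.T ∧
        (∀ s, ι s = ∫ t in (0 : ℝ)..s, D.rate δ t / Real.cosh (2 * η t)) ∧
        ι₀ = (ι D.T + if Even j then 0 else Real.pi) / D.T ∧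
        D.HasFloquetForm
          (fun θ => NearAxis.averageElliptic ι ι₀ (NearAxis.rotateScale δ η θ))
          (NearAxis.cst ((1 / 2 : ℂ) * ι₀) * NearAxis.Zv * NearAxis.Zb) 1) ∧
    (∀ σ : ℝ, D.IsHyperbolic X σ →
      ∃ (δ η F ν : ℝ → ℝ) (ν₀ : ℝ) (j : ℤ),
        ContDiff ℝ ∞ δ ∧ ContDiff ℝ ∞ η ∧
        (∀ s, δ (s + D.T) - δ s = j * Real.pi) ∧ (Even j ↔ σ = 1) ∧
        Function.Periodic η D.T ∧
        ContDiff ℝ ∞ F ∧ (∀ s, F s * Real.sinh (2 * η s) = D.rate δ s) ∧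
        (∀ s, ν s = ∫ t in (0 : ℝ)..s, F t) ∧
        ν₀ = ν D.T / D.T ∧
        D.HasFloquetForm
          (fun θ => NearAxis.averageHyperbolic ν ν₀ (NearAxis.rotateScale δ η θ))
          (NearAxis.cst ((1 / 4 : ℂ) * ν₀) * (NearAxis.Zv ^ 2 + NearAxis.Zb ^ 2)) σ) := by
  refine ⟨fun C h haxis => ?_, fun σ h => ?_⟩
  · obtain ⟨δ, η, j, hN⟩ := h.exists_isNormalFrame hX haxis
    exact ⟨δ, η, _, _, j, hN.δ_smooth, hN.η_smooth, hN.δ_shift, hN.η_periodic, fun _ => rfl, rfl,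
      hN.hasFloquetForm_elliptic (fun _ => rfl) rfl⟩
  · obtain ⟨δ, η, j, hN, rfl⟩ := h.exists_isNormalFrame hX
    exact ⟨δ, η, fun s => -D.growth δ η s, _, _, j, hN.δ_smooth, hN.η_smooth, hN.δ_shift,
      (NearAxis.AxisData.cos_int_mul_pi_eq_one_iff j).symm, hN.η_periodic, hN.growth_smooth.neg,
      hN.rate_of_hyperbolic, fun _ => rfl, rfl,
      hN.hasFloquetForm_hyperbolic (fun _ => rfl) rfl⟩
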